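/- **Setting.** Let $T$ be a non-empty compact Hausdorff space and $\mathcal A$ a collection of closed subsets of $T$ that contains $\emptyset$ and $T$, is closed under arbitrary intersections, contains no two disjoint non-empty sets, and is separable from above: there are finite subcollections $\mathcal A_1\subseteq\mathcal A_2\subseteq\cdots$ of $\mathcal A$, closed under intersection, and maps $g_n$ sending each $A\in\mathcal A$ to a finite union of sets of $\mathcal A_n$, such that $A=\bigcap_n g_n(A)$, $g_{n+1}(A)\subseteq g_n(A)$, $A\subseteq g_n(A)^{\circ}$, $g_n(\emptyset)=\emptyset$, and $g_n$ preserves arbitrary intersections and (in the sense that $\bigcup_i A_i=\bigcup_j A_j'$ implies $\bigcup_i g_n(A_i)=\bigcup_j g_n(A'_j)$) finite unions. Let $\emptyset'$ be the intersection of all non-empty sets of $\mathcal A$, $\mathcal A(u)$ the class of finite unions of sets of $\mathcal A$, $\mathcal C=\{A\setminus B: A\in\mathcal A,B\in\mathcal A(u)\}$ and $\mathcal C(u)$ the class of finite unions of sets of $\mathcal C$. A *consistent ordering* $\{A_0=\emptyset',A_1,\dots,A_n\}$, $n\ge 1$, of a finite sub-semilattice $\mathcal A'=\{A_1,\dots,A_n\}$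 of $\mathcal A$ (distinct non-empty sets, closed under intersection) is a numbering in which no set precedes a proper subset of itself belonging to $\mathcal A'$. A *flow* with values in a class of sets is an increasing map from a compact interval to it; it is *continuous* if $f(t)=\bigcap_k f(\tau_k)$ for decreasing $\tau_k\to t$ and $f(t)=\overline{\bigcup_k f(\tau_k)}$ for increasing $\tau_k\to t$. For each finite sub-semilattice and each consistent ordering of it, fix a simple flow connecting it: a continuous flow $f:[0,a]\to\mathcal A(u)$ with $f(0)=\emptyset'$ and a partition $0=t_0<t_1<\dots<t_n=a$ such that $f(t)=\bigcup_{j=1}^{i}A_j\cup f_{i+1}(t)$ for $t\in[t_i,t_{i+1}]$, where $f_{i+1}:[t_i,t_{i+1}]\to\mathcal A$ is a continuous flow with $f_{i+1}(t_{i+1})=A_{i+1}$; hence $f(t_i)=\bigcup_{j=1}^iA_j$ for $i\ge 1$. Let $\mathcal S$ be the collection of the chosen flows. A *transition system* $\mathcal Q=(Q_{BB'})$, indexed by the pairs $B\subseteq B'$ in $\mathcal A(u)$, is a family of transition probabilities on $\mathbf R$ with $Q_{BB}(x;\cdot)=\delta_x$ and $Q_{BB''}(x;\Gamma)=\int Q_{B'B''}(y;\Gamma)\,Q_{BB'}(x;dy)$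 for $B\subseteq B'\subseteq B''$; a one-parameter transition system $(Q_{st})_{0\le s\le t\le a}$ is defined likewise. A real process $X=(X_A)_{A\in\mathcal A}$ on a complete probability space has an (a.s. unique) additive extension to $\mathcal C(u)$ if the values $X_{A\setminus B}=X_A-X_{A\cap B}$, and the values on finite unions of sets of $\mathcal A$ or of $\mathcal C$ given by inclusion–exclusion, are a.s. independent of the representation. Such an $X$ is *$\mathcal Q$-Markov* if $P[X_{B'}\in\Gamma\mid\mathcal F_B]=Q_{BB'}(X_B;\Gamma)$ a.s. for all $B\subseteq B'$ in $\mathcal A(u)$ and all Borel $\Gamma$, where $\mathcal F_B=\sigma(X_A:A\in\mathcal A,A\subseteq B)$. Its initial distribution is the law of $X_{\emptyset'}$. Let $B(\mathbf R)$ be the Banach space of bounded measurable functions $\mathbf R\to\mathbf R$ with the supremum norm. Let $\mathcal D$ be a dense subspace. Linear operators $\mathcal G_s:\mathcal D\to B(\mathbf R)$, $s\in[0,a]$, are *the generator* of the semigroup $T_{st}h(x)=\int h(y)Q_{st}(x;dy)$ of a one-parameter transition system $(Q_{st})$ if $T_{st}\mathcal D\subseteq\mathcal D$ and, for all $h\in\mathcal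 D$, $T_{st}h$ is continuously differentiable in norm in $s$ and in $t$, with $\frac{\partial^+}{\partial t}T_{st}h|_{t=s}=\mathcal G_sh$ for $s<a$ and $-\frac{\partial^-}{\partial r}T_{rs}h|_{r=s}=\mathcal G_sh$ for $s>0$. The *generator* of a $\mathcal Q$-Markov process is the family $(\mathcal G^f)_{f\in\mathcal S}$, where $\mathcal G^f$ is the generator of the semigroup of $(Q_{f(s)f(t)})_{s\le t}$. **Theorem.** Let $\mu$ be a probability measure on $\mathbf R$, let $\mathcal D$ be a dense subspace of $B(\mathbf R)$, and for each $f\in\mathcal S$ let $\mathcal G^f=(\mathcal G^f_s)_s$ be a family of linear operators $\mathcal D\to B(\mathbf R)$ that is the generator of the semigroup $\mathcal T^f=(T^f_{st})$ of a one-parameter transition system $\mathcal Q^f=(Q^f_{st})$. Suppose that: *(Matching.)* Whenever $f,g\in\mathcal S$ and $f(s)=g(u)$, $f(t)=g(v)$ for some $s<t$, $u<v$, then for every $h\in\mathcal D$ $$\int_s^t\mathcal G^f_rT^f_{rt}h\,dr=\int_u^v\mathcal G^g_rT^g_{rv}h\,dr .$$ *(Consistency.)* Let $\{A_0=\emptyset',A_1,\dots,A_n\}$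 and $\{A_0=\emptyset',A'_1,\dots,A'_n\}$ be consistent orderings of the same finite sub-semilattice, $A_i=A'_{\pi(i)}$ with a permutation $\pi$ (so $\pi(1)=1$), and $f,g\in\mathcal S$ the corresponding flows with partition points $t_i$, $u_i$. For $2\le i\le n$ let $l_1\le\dots\le l_{2(i-1)}$ be the increasing ordering of $\pi(2)-1,\pi(2),\dots,\pi(i)-1,\pi(i)$, and $p$ the index with $l_{p-1}=\pi(i)-1$, $l_p=\pi(i)$. Write $T_1\cdots T_m[\varphi]$ for the integral of a function $\varphi$ of several variables $y_l$ against the product of the corresponding transition probabilities, started at $y_1=x_1$, and put $\Sigma_k=\sum_{j=2}^{k}(y_{\pi(j)}-y_{\pi(j)-1})$, $\Pi=\prod_{j=2}^{i-1}h_j(y_{\pi(j)}-y_{\pi(j)-1})$. Then for all $h_2,\dots,h_i\in\mathcal D$ and for $\mu^f_{t_1}$-almost all $x_1$, where $\mu^f_{t_1}=\int Q^f_{0t_1}(x;\cdot)\,\mu(dx)$, $$\int_{t_{i-1}}^{t_i}T^g_{u_1u_{l_1}}\cdots T^g_{u_{l_{p-3}}u_{l_{p-2}}}T^g_{u_{l_{p-2}}u_{l_{p+1}}}T^g_{u_{l_{p+1}}u_{l_{p+2}}}\cdots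 T^g_{u_{l_{2(i-1)-1}}u_{l_{2(i-1)}}}\bigl[\Pi\cdot(\mathcal G^f_wT^f_{wt_i}h_i)(x_1+\Sigma_{i-1})\bigr](x_1)\,dw$$ $$=\int_{u_{l_{p-1}}}^{u_{l_p}}T^g_{u_1u_{l_1}}\cdots T^g_{u_{l_{p-2}}u_{l_{p-1}}}\,\mathcal G^g_vT^g_{vu_{l_p}}\,T^g_{u_{l_p}u_{l_{p+1}}}\cdots T^g_{u_{l_{2(i-1)-1}}u_{l_{2(i-1)}}}[\varphi](x_1)\,dv,$$ where $\varphi=\Pi\cdot h_i(x_1+\Sigma_i)$ if $p=2(i-1)$ (then no factors with an index larger than $p$ occur) and $\varphi=\Pi\cdot[h_i(x_1+\Sigma_i)-h_i(x_1+\Sigma_{i-1})]$ if $p<2(i-1)$. It is part of the condition that the right-hand side is meaningful: for all values of $x_1,y_{l_1},\dots,y_{l_{p-1}}$, the function of $y_{l_p}$ obtained from $\varphi$ by applying $T^g_{u_{l_p}u_{l_{p+1}}}\cdots T^g_{u_{l_{2(i-1)-1}}u_{l_{2(i-1)}}}$ belongs to $\mathcal D$, and, for $\mu^f_{t_1}$-almost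 all $x_1$, the integral over $v$ and $y$ converges absolutely. Then there exist a transition system $\mathcal Q=(Q_{BB'})_{B\subseteq B'}$ indexed by $\mathcal A(u)$ and a $\mathcal Q$-Markov process $X=(X_A)_{A\in\mathcal A}$ with initial distribution $\mu$ whose generator is exactly $\{\mathcal G^f:f\in\mathcal S\}$. -/

import Mathlib

open Set Filter Topology MeasureTheory ProbabilityTheory

universe u

namespace SetMarkov

/-! ## The indexing collection and the classes of sets that it generates -/

section Sets

variable {T : Type u}

/-- Finite unions of members of `𝓑`; for `𝓑 = 𝒜` this is the class `𝒜(u)`. -/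
def finUnions (𝓑 : Set (Set T)) : Set (Set T) :=
  {B | ∃ 𝓕 : Set (Set T), 𝓕.Finite ∧ 𝓕 ⊆ 𝓑 ∧ B = ⋃₀ 𝓕}

/-- The class `𝒞` of all sets `A \ B` with `A ∈ 𝒜` and `B ∈ 𝒜(u)`. -/
def diffs (𝒜 : Set (Set T)) : Set (Set T) :=
  {C | ∃ A ∈ 𝒜, ∃ B ∈ finUnions 𝒜, C = A \ B}

/-- The minimal set `∅'`: the intersection of all nonempty members of `𝒜`. -/
def minSet (𝒜 : Set (Set T)) : Set T := ⋂₀ (𝒜 \ {∅})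

/-- Separability from above. -/
def SeparableFromAbove [TopologicalSpace T] (𝒜 : Set (Set T)) : Prop :=
  ∃ (𝒜' : ℕ → Set (Set T)) (g : ℕ → Set T → Set T),
    (∀ n, (𝒜' n).Finite ∧ 𝒜' n ⊆ 𝒜 ∧ ∀ A ∈ 𝒜' n, ∀ B ∈ 𝒜' n, A ∩ B ∈ 𝒜' n) ∧
    (∀ n, 𝒜' n ⊆ 𝒜' (n + 1)) ∧
    (∀ n, ∀ A ∈ 𝒜, g n A ∈ finUnions (𝒜' n)) ∧
    (∀ A ∈ 𝒜, A = ⋂ n, g n A) ∧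
    (∀ n, ∀ A ∈ 𝒜, g (n + 1) A ⊆ g n A ∧ A ⊆ interior (g n A)) ∧
    (∀ n, ∀ 𝓕 : Set (Set T), 𝓕 ⊆ 𝒜 → 𝓕.Nonempty → g n (⋂₀ 𝓕) = ⋂ A ∈ 𝓕, g n A) ∧
    (∀ n, ∀ 𝓕 𝓖 : Set (Set T), 𝓕.Finite → 𝓖.Finite → 𝓕 ⊆ 𝒜 → 𝓖 ⊆ 𝒜 →
      ⋃₀ 𝓕 = ⋃₀ 𝓖 → ⋃ A ∈ 𝓕, g n A = ⋃ A ∈ 𝓖, g n A) ∧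
    (∀ n, g n ∅ = ∅)

/-- The standing assumptions on the semilattice `𝒜` of closed subsets of `T`. -/
structure IsIndexingCollection [TopologicalSpace T] (𝒜 : Set (Set T)) : Prop where
  isClosed : ∀ A ∈ 𝒜, IsClosed A
  sInter_mem : ∀ 𝓕 : Set (Set T), 𝓕 ⊆ 𝒜 → 𝓕.Nonempty → ⋂₀ 𝓕 ∈ 𝒜
  empty_mem : ∅ ∈ 𝒜
  univ_mem : univ ∈ 𝒜
  inter_nonempty : ∀ A ∈ 𝒜, ∀ B ∈ 𝒜, A.Nonempty → B.Nonempty → (A ∩ B).Nonempty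
  separable : SeparableFromAbove 𝒜

/-- A consistent ordering `{A 0 = ∅', A 1, …, A n}` of a finite sub-semilattice
`{A 1, …, A n}` of `𝒜` (consisting of nonempty sets): the sets `A 1, …, A n` are distinct, closed
under intersection, and no set is numbered before one of its proper subsets that belongs to the
sub-semilattice. The values of `A` beyond `n` are normalized to `∅`, so that two orderings are
equal as soon as they list the same sets in the same order. -/
structure ConsistentOrdering (𝒜 : Set (Set T)) where
  n : ℕ
  A : ℕ → Set T
  n_pos : 1 ≤ n
  zero_eq : A 0 = minSet 𝒜
  mem : ∀ i ∈ Finset.Icc 1 n, A i ∈ 𝒜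
  nonempty : ∀ i ∈ Finset.Icc 1 n, (A i).Nonempty
  distinct : ∀ i ∈ Finset.Icc 1 n, ∀ j ∈ Finset.Icc 1 n, A i = A j → i = j
  inter_mem : ∀ i ∈ Finset.Icc 1 n, ∀ j ∈ Finset.Icc 1 n,
    ∃ k ∈ Finset.Icc 1 n, A i ∩ A j = A k
  consistent : ∀ i ∈ Finset.Icc 1 n, ∀ j ∈ Finset.Icc 1 n, A i ⊂ A j → i < j
  beyond : ∀ i, n < i → A i = ∅

/-! ## Flows -/

/-- `f` is a flow on `[a, b]` with values in `𝓑`: an increasing map `[a, b] → 𝓑`. -/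
structure IsFlow (𝓑 : Set (Set T)) (a b : ℝ) (f : ℝ → Set T) : Prop where
  mem : ∀ t ∈ Icc a b, f t ∈ 𝓑
  mono : ∀ s ∈ Icc a b, ∀ t ∈ Icc a b, s ≤ t → f s ⊆ f t

/-- `f` is a continuous flow on `[a, b]` with values in `𝓑`. -/
structure IsContinuousFlow [TopologicalSpace T] (𝓑 : Set (Set T)) (a b : ℝ)
    (f : ℝ → Set T) : Prop extends IsFlow 𝓑 a b f where
  right : ∀ t ∈ Icc a b, ∀ τ : ℕ → ℝ, (∀ k, τ k ∈ Icc a b) → Antitone τ →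
    Tendsto τ atTop (𝓝 t) → f t = ⋂ k, f (τ k)
  left : ∀ t ∈ Icc a b, ∀ τ : ℕ → ℝ, (∀ k, τ k ∈ Icc a b) → Monotone τ →
    Tendsto τ atTop (𝓝 t) → f t = closure (⋃ k, f (τ k))

/-- A simple flow `f : [0, a] → 𝒜(u)`, together with a partition
`0 = time 0 < time 1 < ⋯ < time n = a`, that connects the sets of the sub-semilattice in the sense
of the consistent ordering `o`: `f` is a continuous flow with `f 0 = ∅'`, and on
`[time i, time (i + 1)]` it is `A 1 ∪ ⋯ ∪ A i ∪ piece i`, where `piece i` is a continuous `𝒜`-valued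
flow that ends in `A (i + 1)`. In particular `f (time i) = A 1 ∪ ⋯ ∪ A i` for `1 ≤ i ≤ n`. -/
structure ConnectingFlow [TopologicalSpace T] {𝒜 : Set (Set T)} (o : ConsistentOrdering 𝒜) where
  time : ℕ → ℝ
  f : ℝ → Set T
  piece : ℕ → ℝ → Set T
  time_zero : time 0 = 0
  time_lt : ∀ i < o.n, time i < time (i + 1)
  flow : IsContinuousFlow (finUnions 𝒜) 0 (time o.n) f
  f_zero : f 0 = minSet 𝒜
  piece_flow : ∀ i < o.n, IsContinuousFlow 𝒜 (time i) (time (i + 1)) (piece i)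
  piece_end : ∀ i < o.n, piece i (time (i + 1)) = o.A (i + 1)
  f_eq : ∀ i < o.n, ∀ t ∈ Icc (time i) (time (i + 1)),
    f t = (⋃ j ∈ Finset.Icc 1 i, o.A j) ∪ piece i t

/-- The right end `a` of the domain `[0, a]` of a connecting flow. -/
def ConnectingFlow.a [TopologicalSpace T] {𝒜 : Set (Set T)} {o : ConsistentOrdering 𝒜}
    (F : ConnectingFlow o) : ℝ := F.time o.n

end Sets

/-! ## Transition systems -/

/-- Transition probabilities on `ℝ`. -/
abbrev TransProb : Type := {κ : Kernel ℝ ℝ // IsMarkovKernel κ}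

/-- `Q` is a transition system with parameters in the subset `I` of an ordered set. (Only the
values `Q i j` with `i, j ∈ I`, `i ≤ j` matter.) It is used with `I = 𝒜(u)`, ordered by inclusion,
and with `I = [0, a] ⊆ ℝ`. -/
structure IsTransitionSystem {ι : Type*} [Preorder ι] (I : Set ι) (Q : ι → ι → TransProb) :
    Prop where
  refl : ∀ i ∈ I, ∀ x, (Q i i).1 x = Measure.dirac x
  comp : ∀ i ∈ I, ∀ j ∈ I, ∀ k ∈ I, i ≤ j → j ≤ k → ∀ x, ∀ Γ, MeasurableSet Γ →
    (Q i k).1 x Γ = ∫⁻ y, (Q j k).1 y Γ ∂((Q i j).1 x)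

/-! ## Bounded measurable functions, semigroups and generators -/

/-- The bounded measurable functions, as a subspace of the space `ℓ^∞(ℝ)` of all bounded
functions `ℝ → ℝ` with the supremum norm. -/
def bddMeasSubmodule : Submodule ℝ (lp (fun _ : ℝ => ℝ) ⊤) where
  carrier := {h | Measurable (fun x => h x)}
  add_mem' := fun {_ _} ha hb => Measurable.add ha hb
  zero_mem' := measurable_const
  smul_mem' := fun c _ ha => Measurable.const_smul ha c

/-- The space `B(ℝ)` of bounded measurable functions `ℝ → ℝ` with the supremum norm. -/
abbrev BddMeas : Type := bddMeasSubmodule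

instance : CoeFun BddMeas (fun _ => ℝ → ℝ) := ⟨fun h x => h.1 x⟩

theorem BddMeas.measurable (h : BddMeas) : Measurable (fun x => h x) := h.2

theorem BddMeas.abs_le (h : BddMeas) (x : ℝ) : ‖h x‖ ≤ ‖h‖ :=
  lp.norm_apply_le_norm (by simp) h.1 x

theorem norm_integral_le (κ : TransProb) (h : BddMeas) (x : ℝ) :
    ‖∫ y, h y ∂(κ.1 x)‖ ≤ ‖h‖ := by
  have := κ.2
  have h1 := norm_integral_le_of_norm_le_const (μ := κ.1 x) (f := fun y => h y) (C := ‖h‖)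
    (Eventually.of_forall fun y => h.abs_le y)
  simpa using h1

/-- The operator on `B(ℝ)` associated with a transition probability:
`(transOp κ h) x = ∫ h(y) κ(x; dy)`. -/
noncomputable def transOp (κ : TransProb) (h : BddMeas) : BddMeas :=
  ⟨⟨fun x => ∫ y, h y ∂(κ.1 x), memℓp_infty ⟨‖h‖, by
      rintro _ ⟨x, rfl⟩
      exact norm_integral_le κ h x⟩⟩, by
    have := κ.2
    exact (StronglyMeasurable.integral_kernel (κ := κ.1)
      h.measurable.stronglyMeasurable).measurable⟩

/-- The value at `h` of an operator `G` with domain `D` (and `0` if `h ∉ D`, a value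
that never matters). -/
noncomputable def opApply {D : Submodule ℝ BddMeas} (G : D →ₗ[ℝ] BddMeas) (h : BddMeas) :
    BddMeas :=
  open Classical in if hh : h ∈ D then G ⟨h, hh⟩ else 0

/-- `G s`, `s ∈ [0, a]`, with common domain `D`, is the generator at time `s` of the semigroup
`T s t = transOp (Q s t)` associated with the one-parameter transition system `Q` on `[0, a]`: the
subspace `D` is invariant; for `h ∈ D` the function `T s t h` is strongly continuously
differentiable in `t` and in `s`; its right derivative in `t` at `t = s` is `G s h`, and the left
derivative of `r ↦ T r s h` at `r = s` is `- G s h`. (At `s = a` resp. `s = 0` the one-sided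
derivative in question is taken along a one-point set, where the condition is empty.) -/
structure IsGenerator (a : ℝ) (Q : ℝ → ℝ → TransProb) (D : Submodule ℝ BddMeas)
    (G : ℝ → D →ₗ[ℝ] BddMeas) : Prop where
  maps : ∀ s ∈ Icc 0 a, ∀ t ∈ Icc s a, ∀ h ∈ D, transOp (Q s t) h ∈ D
  contDiff_right : ∀ s ∈ Icc 0 a, ∀ h ∈ D,
    ContDiffOn ℝ 1 (fun t => transOp (Q s t) h) (Icc s a)
  contDiff_left : ∀ t ∈ Icc 0 a, ∀ h ∈ D,
    ContDiffOn ℝ 1 (fun s => transOp (Q s t) h) (Icc 0 t)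
  deriv_right : ∀ s ∈ Icc 0 a, ∀ h : D,
    HasDerivWithinAt (fun t => transOp (Q s t) h.1) (G s h) (Icc s a) s
  deriv_left : ∀ s ∈ Icc 0 a, ∀ h : D,
    HasDerivWithinAt (fun r => transOp (Q r s) h.1) (-(G s h)) (Icc 0 s) s

/-! ## The notation `T₁ T₂ ⋯ T_m [φ(y₁, y₂, …)]` -/

/-- Given coordinates `y`, replace the coordinate with index `l` by a point chosen according to
`κ(y k; ·)`. -/
noncomputable def stepKernel (κ : Kernel ℝ ℝ) (k l : ℕ) : Kernel (ℕ → ℝ) (ℕ → ℝ) :=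
  (Kernel.id ×ₖ (κ.comap (fun y : ℕ → ℝ => y k) (measurable_pi_apply k))).map
    (fun p => Function.update p.1 l p.2)

/-- For a list `l₁, l₂, …, l_m` of indices, the product of the transition probabilities
`Q_{u k, u l₁}(y_k; dy_{l₁})`, `Q_{u l₁, u l₂}(y_{l₁}; dy_{l₂})`, …, so that
`∫ y', φ y' ∂(pathKernel Q u k [l₁, …, l_m] y)` is
`T_{u k, u l₁} T_{u l₁, u l₂} ⋯ T_{u l_{m-1}, u l_m} [φ]` evaluated at the given `y_k`. -/
noncomputable def pathKernel (Q : ℝ → ℝ → TransProb) (u : ℕ → ℝ) :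
    ℕ → List ℕ → Kernel (ℕ → ℝ) (ℕ → ℝ)
  | _, [] => Kernel.id
  | k, l :: L => pathKernel Q u l L ∘ₖ stepKernel (Q (u k) (u l)).1 k l

/-! ## The matching and consistency conditions for families of generators -/

section Conditions

variable {T : Type u} [TopologicalSpace T] {𝒜 : Set (Set T)}

/-- The matching condition: if `f, g` are flows of the collection with `f(s) = g(u)` and
`f(t) = g(v)` for some `s < t`, `u < v`, then
`∫_s^t G^f_r T^f_{rt} h dr = ∫_u^v G^g_r T^g_{rv} h dr` for all `h ∈ D`. -/
def Matching (S : ∀ o : ConsistentOrdering 𝒜, ConnectingFlow o)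
    (Q : ConsistentOrdering 𝒜 → ℝ → ℝ → TransProb) (D : Submodule ℝ BddMeas)
    (G : ConsistentOrdering 𝒜 → ℝ → D →ₗ[ℝ] BddMeas) : Prop :=
  ∀ o₁ o₂ : ConsistentOrdering 𝒜, ∀ s t u v : ℝ,
    0 ≤ s → s < t → t ≤ (S o₁).a → 0 ≤ u → u < v → v ≤ (S o₂).a →
    (S o₁).f s = (S o₂).f u → (S o₁).f t = (S o₂).f v →
    ∀ h ∈ D, ∀ x : ℝ,
      ∫ r in s..t, opApply (G o₁ r) (transOp (Q o₁ r t) h) x =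
        ∫ r in u..v, opApply (G o₂ r) (transOp (Q o₂ r v) h) x

/-- `∑_{j=2}^{i} (y_{π(j)} - y_{π(j)-1})`. -/
noncomputable def incrSum (π : ℕ → ℕ) (i : ℕ) (y : ℕ → ℝ) : ℝ :=
  ∑ j ∈ Finset.Icc 2 i, (y (π j) - y (π j - 1))

/-- `∏_{j=2}^{i-1} h_j(y_{π(j)} - y_{π(j)-1})`. -/
noncomputable def incrProd {D : Submodule ℝ BddMeas} (h : ℕ → D) (π : ℕ → ℕ) (i : ℕ)
    (y : ℕ → ℝ) : ℝ :=
  ∏ j ∈ Finset.Icc 2 (i - 1), (h j).1 (y (π j) - y (π j - 1))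

open Classical in
/-- The function to which the right-hand side of the consistency condition is applied. Here `hi`
is the list `l_{p+1}, …, l_{2(i-1)}`, which is empty if and only if `p = 2(i-1)`. -/
noncomputable def rhsFun {D : Submodule ℝ BddMeas} (h : ℕ → D) (π : ℕ → ℕ) (i : ℕ)
    (hi : List ℕ) (y : ℕ → ℝ) : ℝ :=
  if hi = [] then incrProd h π i y * (h i).1 (y 1 + incrSum π i y)
  else incrProd h π i y *
    ((h i).1 (y 1 + incrSum π i y) - (h i).1 (y 1 + incrSum π (i - 1) y))

/-- The consistency condition for two generators `Gf`, `Gg`, with partition points `t`, `u`, and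
for the permutation `π` of `{1, …, n}`. The increasing ordering `l₁ ≤ ⋯ ≤ l_{2(i-1)}` of
`π(2)-1, π(2), …, π(i)-1, π(i)` is the list `lo ++ [π(i)-1, π(i)] ++ hi`, that is
`l_{p-1} = π(i)-1`, `l_p = π(i)`, `lo = [l₁, …, l_{p-2}]`, `hi = [l_{p+1}, …, l_{2(i-1)}]`.
The condition includes that its right-hand side is meaningful: the function `U y` to which
`G^g_v T^g_{v,u_{l_p}}` is applied belongs to `D`, and the integral over `v` and `y` converges
absolutely. -/
def GeneratorConsistency (μ : Measure ℝ) (Qf Qg : ℝ → ℝ → TransProb) (D : Submodule ℝ BddMeas)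
    (Gf Gg : ℝ → D →ₗ[ℝ] BddMeas) (n : ℕ) (t u : ℕ → ℝ) (π : ℕ → ℕ) : Prop :=
  ∀ i ∈ Finset.Icc 2 n, ∀ lo hi : List ℕ,
    (lo ++ [π i - 1, π i] ++ hi).Pairwise (· ≤ ·) →
    (lo ++ [π i - 1, π i] ++ hi).Perm
      ((List.range' 2 (i - 1)).flatMap fun j => [π j - 1, π j]) →
    ∀ h : ℕ → D,
      ∃ U : (ℕ → ℝ) → D,
        (∀ y z, (U y).1 z =
          ∫ y', rhsFun h π i hi y' ∂(pathKernel Qg u (π i) hi (Function.update y (π i) z))) ∧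
        ∀ᵐ x₁ ∂(μ.bind (Qf 0 (t 1)).1),
          Integrable (fun q : ℝ × (ℕ → ℝ) =>
              opApply (Gg q.1) (transOp (Qg q.1 (u (π i))) (U q.2).1) (q.2 (π i - 1)))
            ((volume.restrict (Icc (u (π i - 1)) (u (π i)))).prod
              (pathKernel Qg u 1 (lo ++ [π i - 1]) (fun _ => x₁))) ∧
          ∫ w in (t (i - 1))..(t i),
              (∫ y, incrProd h π i y *
                  opApply (Gf w) (transOp (Qf w (t i)) (h i).1) (y 1 + incrSum π (i - 1) y)
                ∂(pathKernel Qg u 1 (lo ++ hi) (fun _ => x₁))) =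
            ∫ v in (u (π i - 1))..(u (π i)),
              (∫ y, opApply (Gg v) (transOp (Qg v (u (π i))) (U y).1) (y (π i - 1))
                ∂(pathKernel Qg u 1 (lo ++ [π i - 1]) (fun _ => x₁)))

/-- The consistency condition for the whole family: it is required for any two consistent
orderings `{A₁, …, A_n}`, `{A'₁, …, A'_n}` of the same finite sub-semilattice, with
`A_i = A'_{π(i)}`. -/
def Consistency (μ : Measure ℝ) (S : ∀ o : ConsistentOrdering 𝒜, ConnectingFlow o)
    (Q : ConsistentOrdering 𝒜 → ℝ → ℝ → TransProb) (D : Submodule ℝ BddMeas)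
    (G : ConsistentOrdering 𝒜 → ℝ → D →ₗ[ℝ] BddMeas) : Prop :=
  ∀ o₁ o₂ : ConsistentOrdering 𝒜, ∀ π : ℕ → ℕ, o₁.n = o₂.n →
    (∀ i ∈ Finset.Icc 1 o₁.n, π i ∈ Finset.Icc 1 o₁.n ∧ o₁.A i = o₂.A (π i)) →
    GeneratorConsistency μ (Q o₁) (Q o₂) D (G o₁) (G o₂) o₁.n (S o₁).time (S o₂).time π

end Conditions

/-! ## Set-indexed processes -/

section Processes

variable {T : Type u} {Ω : Type*}

/-- `∑_i X_{C_i} - ∑_{i<j} X_{C_i ∩ C_j} + ⋯ + (-1)^{n+1} X_{C_1 ∩ ⋯ ∩ C_n}`. -/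
noncomputable def inclExcl (X : Set T → Ω → ℝ) {n : ℕ} (C : Fin n → Set T) (ω : Ω) : ℝ :=
  ∑ J : Finset (Fin n) with J.Nonempty, (-1) ^ (J.card + 1) * X (⋂ i ∈ J, C i) ω

/-- `X` restricted to `𝒜` is a set-indexed process with an (almost surely unique) additive
extension to `𝒞(u)`, and `X` on `𝒞(u)` is that extension. The values of `X` outside `𝒞(u)` are
irrelevant. -/
structure IsAdditiveProcess [MeasurableSpace Ω] (𝒜 : Set (Set T)) (P : Measure Ω)
    (X : Set T → Ω → ℝ) : Prop where
  measurable : ∀ C ∈ finUnions (diffs 𝒜), Measurable (X C)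
  union : ∀ (n : ℕ) (A : Fin n → Set T), (∀ i, A i ∈ 𝒜) →
    X (⋃ i, A i) =ᵐ[P] inclExcl X A
  diff : ∀ A ∈ 𝒜, ∀ B ∈ finUnions 𝒜, X (A \ B) =ᵐ[P] fun ω => X A ω - X (A ∩ B) ω
  union_diffs : ∀ (n : ℕ) (C : Fin n → Set T), (∀ i, C i ∈ diffs 𝒜) →
    X (⋃ i, C i) =ᵐ[P] inclExcl X C

/-- The minimal filtration `ℱ_B = σ(X_A; A ∈ 𝒜, A ⊆ B)`. -/
@[reducible] def minFiltration (𝒜 : Set (Set T)) (X : Set T → Ω → ℝ) (B : Set T) : MeasurableSpace Ω :=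
  ⨆ A ∈ {A | A ∈ 𝒜 ∧ A ⊆ B}, MeasurableSpace.comap (X A) inferInstance

/-- `X` is `Q`-Markov: `X` is an additive process, and
`P[X_{B'} ∈ Γ | ℱ_B] = Q_{BB'}(X_B; Γ)` a.s. for all `B ⊆ B'` in `𝒜(u)` and all Borel `Γ`. -/
structure IsQMarkov [MeasurableSpace Ω] (𝒜 : Set (Set T)) (P : Measure Ω)
    (Q : Set T → Set T → TransProb) (X : Set T → Ω → ℝ) : Prop where
  additive : IsAdditiveProcess 𝒜 P X
  markov : ∀ B ∈ finUnions 𝒜, ∀ B' ∈ finUnions 𝒜, B ⊆ B' → ∀ Γ : Set ℝ, MeasurableSet Γ →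
    P⟦X B' ⁻¹' Γ | minFiltration 𝒜 X B⟧ =ᵐ[P] fun ω => ((Q B B').1 (X B ω)).real Γ

end Processes

end SetMarkov

namespace SetMarkov

open scoped ENNReal

/-! ### Bounded measurable functions and the operators of transition probabilities -/

/-! Integrating the backward equation turns the integral of `G_r T_{rt} h` over [s, t] into `T_{st}
h - h` (`IsGenerator.integral_eq`). The matching condition therefore says that two flows through the
same pair of sets carry the same transition probability, first when tested on `D` and then by
density everywhere (`Matching.eq_of_le`). Any chain `B₁ ⊆ B₂ ⊆ B₃` of nonempty sets of `𝒜(u)` lies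
on one chosen flow (`IsIndexingCollection.exists_flow_through`), so the transition probabilities
read off arbitrary flows satisfy Chapman–Kolmogorov. The empty set, where an additive process is 0,
is added as a state that is left with the right one-dimensional law (`setTrans`).

A consistent ordering `o` gives a Markov chain along `∅ = o.D 0 ⊆ o.D 1 ⊆ ⋯`. Its increments are
placed on the left neighbourhoods `o.atom i`, which produces a random additive set function `o.val`.
The neighbourhoods depend on the semilattice only and not on its numbering
(`ConsistentOrdering.atom_eq`), so the question is whether the joint law of the increments does so
too. This is the content of the consistency condition. Both of its sides can be integrated in time
by the backward equation. After averaging over the starting value it states that, for the chain Y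
along one ordering, replacing `h_i(Y₁ + Σ_i)` by `(T^f h_i)(Y₁ + Σ_{i-1})` does not change
expectations against functions of the earlier rearranged increments
(`GeneratorConsistency.integral_eq`). Hence the rearranged partial sums of Y move by the transitions
of the other ordering and have the law of its chain (`IsMatchingFamily.map_permSum_orderLaw`).

A larger semilattice has an ordering adapted to the smaller one, whose chain is then a subsequence.
With the previous step, the finite-dimensional laws on `𝒞(u)` do not depend on the ordering
(`IsMatchingFamily.map_val_eq`), and Kolmogorov's theorem gives X. Additivity is inherited because
every `o.val` is exactly additive. For the Markov property, given `B ⊆ B'` and finitely many `A ⊆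
B`, an ordering adapted to all of them makes X at `B` and `B'` two values of one chain and X at each
`A` a function of the past (`HasOrderLaws.measure_inter_eq`); a π-system argument passes to the
whole σ-algebra. The generators are the given ones because `setTrans` along a chosen flow returns
that flow's transition system. -/

theorem BddMeas.ext_apply {h h' : BddMeas} (H : ∀ x, h x = h' x) : h = h' :=
  Subtype.ext (Subtype.ext (funext H))

/-- A bounded measurable function as an element of `B(ℝ)`. -/
noncomputable def BddMeas.ofFun (f : ℝ → ℝ) (hf : Measurable f) (C : ℝ) (hC : ∀ x, ‖f x‖ ≤ C) :
    BddMeas :=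
  ⟨⟨f, memℓp_infty ⟨C, by rintro _ ⟨x, rfl⟩; exact hC x⟩⟩, hf⟩

@[simp] theorem BddMeas.ofFun_apply (f : ℝ → ℝ) (hf : Measurable f) (C : ℝ)
    (hC : ∀ x, ‖f x‖ ≤ C) (x : ℝ) : BddMeas.ofFun f hf C hC x = f x := rfl

@[simp] theorem BddMeas.sub_apply (h h' : BddMeas) (x : ℝ) : (h - h') x = h x - h' x := rfl

/-- The indicator function of a Borel set as an element of `B(ℝ)`. -/
noncomputable def BddMeas.ind (Γ : Set ℝ) (hΓ : MeasurableSet Γ) : BddMeas :=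
  BddMeas.ofFun (Γ.indicator 1) (measurable_one.indicator hΓ) 1 fun x => by
    by_cases hx : x ∈ Γ <;> simp [hx]

@[simp] theorem BddMeas.ind_apply (Γ : Set ℝ) (hΓ : MeasurableSet Γ) (x : ℝ) :
    BddMeas.ind Γ hΓ x = Γ.indicator 1 x := rfl

/-- Evaluation at a point as a continuous linear functional on `B(ℝ)`. -/
noncomputable def BddMeas.eval (x : ℝ) : BddMeas →L[ℝ] ℝ :=
  LinearMap.mkContinuous ⟨⟨fun h => h x, fun _ _ => rfl⟩, fun _ _ => rfl⟩ 1 fun h => by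
    rw [one_mul]; exact h.abs_le x

@[simp] theorem BddMeas.eval_apply (x : ℝ) (h : BddMeas) : BddMeas.eval x h = h x := rfl

theorem BddMeas.norm_le {h : BddMeas} {C : ℝ} (hC : 0 ≤ C) (H : ∀ x, ‖h x‖ ≤ C) : ‖h‖ ≤ C :=
  lp.norm_le_of_forall_le hC H

theorem BddMeas.integrable (h : BddMeas) (ν : Measure ℝ) [IsFiniteMeasure ν] :
    Integrable (fun x => h x) ν :=
  Integrable.of_bound h.measurable.aestronglyMeasurable ‖h‖ (Eventually.of_forall h.abs_le)

theorem transOp_apply (κ : TransProb) (h : BddMeas) (x : ℝ) :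
    transOp κ h x = ∫ y, h y ∂(κ.1 x) := rfl

theorem norm_transOp_le (κ : TransProb) (h : BddMeas) : ‖transOp κ h‖ ≤ ‖h‖ :=
  BddMeas.norm_le (norm_nonneg _) fun x => norm_integral_le κ h x

theorem transOp_sub (κ : TransProb) (h h' : BddMeas) :
    transOp κ (h - h') = transOp κ h - transOp κ h' := by
  have := κ.2
  refine BddMeas.ext_apply fun x => ?_
  simp only [transOp_apply, BddMeas.sub_apply]
  exact integral_sub (h.integrable _) (h'.integrable _)

theorem continuous_transOp (κ : TransProb) : Continuous (transOp κ) := by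
  refine (LipschitzWith.of_dist_le_mul (K := 1) fun h h' => ?_).continuous
  rw [dist_eq_norm, dist_eq_norm, ← transOp_sub]
  simpa using norm_transOp_le κ (h - h')

/-- The operators are contractions, so agreement on a dense subspace extends to all of B(ℝ), in
particular to indicators, and these determine the kernels. -/
theorem transProb_eq_of_transOp {D : Submodule ℝ BddMeas} (hD : Dense (D : Set BddMeas))
    {κ κ' : TransProb} (H : ∀ h ∈ D, transOp κ h = transOp κ' h) : κ = κ' := by
  have := κ.2
  have := κ'.2
  have hall : transOp κ = transOp κ' :=
    Continuous.ext_on hD (continuous_transOp κ) (continuous_transOp κ') H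
  refine Subtype.ext (Kernel.ext fun x => Measure.ext fun Γ hΓ => ?_)
  have h1 : transOp κ (BddMeas.ind Γ hΓ) x = transOp κ' (BddMeas.ind Γ hΓ) x := by rw [hall]
  simp only [transOp_apply, BddMeas.ind_apply] at h1
  rw [integral_indicator_one hΓ, integral_indicator_one hΓ] at h1
  exact (measureReal_eq_measureReal_iff).1 h1

theorem IsTransitionSystem.transOp_self {ι : Type*} [Preorder ι] {I : Set ι}
    {Q : ι → ι → TransProb} (hQ : IsTransitionSystem I Q) {i : ι} (hi : i ∈ I) (h : BddMeas) :
    transOp (Q i i) h = h :=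
  BddMeas.ext_apply fun x => by rw [transOp_apply, hQ.refl i hi x]; simp

theorem IsTransitionSystem.kernel_comp {ι : Type*} [Preorder ι] {I : Set ι}
    {Q : ι → ι → TransProb} (hQ : IsTransitionSystem I Q) {i j k : ι} (hi : i ∈ I) (hj : j ∈ I)
    (hk : k ∈ I) (hij : i ≤ j) (hjk : j ≤ k) :
    (Q i k).1 = (Q j k).1 ∘ₖ (Q i j).1 :=
  Kernel.ext fun x => Measure.ext fun Γ hΓ => by
    rw [hQ.comp i hi j hj k hk hij hjk x Γ hΓ, Kernel.comp_apply' _ _ _ hΓ]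

theorem IsTransitionSystem.transOp_comp {ι : Type*} [Preorder ι] {I : Set ι}
    {Q : ι → ι → TransProb} (hQ : IsTransitionSystem I Q) {i j k : ι} (hi : i ∈ I) (hj : j ∈ I)
    (hk : k ∈ I) (hij : i ≤ j) (hjk : j ≤ k) (h : BddMeas) :
    transOp (Q i k) h = transOp (Q i j) (transOp (Q j k) h) := by
  have := (Q i k).2
  refine BddMeas.ext_apply fun x => ?_
  have h2 : Integrable (fun x => h x) (((Q j k).1 ∘ₖ (Q i j).1) x) := by
    rw [← hQ.kernel_comp hi hj hk hij hjk]; exact h.integrable _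
  rw [transOp_apply, hQ.kernel_comp hi hj hk hij hjk, Kernel.integral_comp h2]
  rfl

/-! ### The backward equation -/

section Generator

variable {a : ℝ} {Q : ℝ → ℝ → TransProb} {D : Submodule ℝ BddMeas} {G : ℝ → D →ₗ[ℝ] BddMeas}

/-- For `r ≤ s` one has `T_{rt} h = T_{rs} (T_{st} h)`, and invariance of `D` allows the
left-derivative axiom at `s` to be applied to `T_{st} h`. -/
theorem IsGenerator.hasDerivWithinAt (hG : IsGenerator a Q D G)
    (hQ : IsTransitionSystem (Icc 0 a) Q) {s t : ℝ} (hs : 0 ≤ s) (hst : s ≤ t) (hta : t ≤ a)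
    {h : BddMeas} (hh : h ∈ D) :
    HasDerivWithinAt (fun r => transOp (Q r t) h) (-(opApply (G s) (transOp (Q s t) h)))
      (Icc 0 s) s := by
  have hsa : s ∈ Icc 0 a := ⟨hs, hst.trans hta⟩
  have hta' : t ∈ Icc 0 a := ⟨hs.trans hst, hta⟩
  have hm : transOp (Q s t) h ∈ D := hG.maps s hsa t ⟨hst, hta⟩ h hh
  have h1 := hG.deriv_left s hsa ⟨_, hm⟩
  rw [opApply, dif_pos hm]
  have hc : ∀ r ∈ Icc 0 s, transOp (Q r t) h = transOp (Q r s) (transOp (Q s t) h) := fun r hr =>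
    hQ.transOp_comp ⟨hr.1, hr.2.trans hsa.2⟩ hsa hta' hr.2 hst h
  exact h1.congr hc (hc s ⟨hs, le_rfl⟩)

/-- The function `r ↦ G_r T_{rt} h` on `(0, t]` has a continuous extension, whose integral is given
by the backward equation. -/
theorem IsGenerator.exists_continuous (hG : IsGenerator a Q D G)
    (hQ : IsTransitionSystem (Icc 0 a) Q) {t : ℝ} (ht : 0 ≤ t) (hta : t ≤ a)
    {h : BddMeas} (hh : h ∈ D) :
    ∃ Ψ : ℝ → BddMeas, Continuous Ψ ∧
      (∀ s ∈ Ioc 0 t, opApply (G s) (transOp (Q s t) h) = Ψ s) ∧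
      ∀ s ∈ Icc 0 t, ∀ x, ∫ r in s..t, Ψ r x = transOp (Q s t) h x - h x := by
  rcases ht.eq_or_lt with rfl | ht0
  · refine ⟨fun _ => 0, continuous_const, by simp, fun s hs x => ?_⟩
    obtain rfl : s = 0 := le_antisymm hs.2 hs.1
    rw [hQ.transOp_self ⟨le_rfl, hta⟩]
    simp
  have hcd := hG.contDiff_left t ⟨ht, hta⟩ h hh
  set φ : ℝ → BddMeas := fun s => transOp (Q s t) h with hφ
  have hu : UniqueDiffOn ℝ (Icc 0 t) := uniqueDiffOn_Icc ht0
  have hcont : ContinuousOn (derivWithin φ (Icc 0 t)) (Icc 0 t) :=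
    hcd.continuousOn_derivWithin hu le_rfl
  have hdiff : ∀ s ∈ Icc 0 t, HasDerivWithinAt φ (derivWithin φ (Icc 0 t) s) (Icc 0 t) s :=
    fun s hs => ((hcd.differentiableOn one_ne_zero) s hs).hasDerivWithinAt
  have hΨ : ∀ s ∈ Icc 0 t,
      IccExtend ht ((Icc 0 t).domRestrict (derivWithin φ (Icc 0 t))) s
        = derivWithin φ (Icc 0 t) s := fun s hs => by rw [IccExtend_of_mem _ _ hs]; rfl
  refine ⟨fun s => -IccExtend ht ((Icc 0 t).domRestrict (derivWithin φ (Icc 0 t))) s,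
    (hcont.domRestrict.Icc_extend').neg, fun s hs => ?_, fun s hs x => ?_⟩
  · have hs' : s ∈ Icc 0 t := ⟨hs.1.le, hs.2⟩
    have h1 := hG.hasDerivWithinAt hQ hs.1.le hs.2 hta hh
    have h2 := (hdiff s hs').mono (Icc_subset_Icc_right hs.2)
    -- Left derivatives at `s > 0` are unique, which identifies the continuous derivative with the
    -- backward equation. At `s = 0` the left-derivative axiom is void, hence the half-open interval
    -- in the statement.
    have h3 := (uniqueDiffOn_Icc hs.1 s ⟨hs.1.le, le_rfl⟩).eq_deriv _ h1 h2
    simp only [hΨ s hs', ← h3, neg_neg]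
  · have hcΨ : Continuous fun r => -IccExtend ht
      ((Icc 0 t).domRestrict (derivWithin φ (Icc 0 t))) r := (hcont.domRestrict.Icc_extend').neg
    have h0 : ContinuousOn (fun r => BddMeas.eval x (-φ r)) (Icc s t) :=
      ((BddMeas.eval x).continuous.comp_continuousOn
        (hcd.continuousOn.neg)).mono (Icc_subset_Icc_left hs.1)
    have h1 := intervalIntegral.integral_eq_sub_of_hasDerivAt_of_le hs.2 h0
      (f' := fun r => BddMeas.eval x (-IccExtend ht
        ((Icc 0 t).domRestrict (derivWithin φ (Icc 0 t))) r))
      (fun r hr => by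
        have hr' : r ∈ Icc 0 t := ⟨hs.1.trans hr.1.le, hr.2.le⟩
        have h2 := (hdiff r hr').hasDerivAt
          (Icc_mem_nhds (hs.1.trans_lt hr.1) hr.2)
        simp only [hΨ r hr']
        exact (BddMeas.eval x).hasFDerivAt.comp_hasDerivAt r h2.neg)
      (((BddMeas.eval x).continuous.comp hcΨ).intervalIntegrable _ _)
    simp only [BddMeas.eval_apply] at h1
    rw [h1]
    have h3 : φ t = h := hQ.transOp_self ⟨ht, hta⟩ h
    rw [h3]
    change -(h x) - -(φ s x) = φ s x - h x
    ring

/-- The integrand agrees with the continuous derivative on (s, t], so the only time at which it is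
not controlled, 0, does not affect the integral. -/
theorem IsGenerator.integral_eq (hG : IsGenerator a Q D G)
    (hQ : IsTransitionSystem (Icc 0 a) Q) {s t : ℝ} (hs : 0 ≤ s) (hst : s ≤ t) (hta : t ≤ a)
    {h : BddMeas} (hh : h ∈ D) (x : ℝ) :
    ∫ r in s..t, opApply (G r) (transOp (Q r t) h) x = transOp (Q s t) h x - h x := by
  obtain ⟨Ψ, -, hΨ, hint⟩ := hG.exists_continuous hQ (hs.trans hst) hta hh
  rw [← hint s ⟨hs, hst⟩ x]
  refine intervalIntegral.integral_congr_ae (Eventually.of_forall fun r hr => ?_)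
  rw [uIoc_of_le hst] at hr
  rw [hΨ r ⟨hs.trans_lt hr.1, hr.2⟩]

end Generator

/-! ### Consequences of the matching condition -/

section Matching

variable {T : Type u} [TopologicalSpace T] {𝒜 : Set (Set T)}
  {S : ∀ o : ConsistentOrdering 𝒜, ConnectingFlow o}
  {D : Submodule ℝ BddMeas}
  {G : ConsistentOrdering 𝒜 → ℝ → D →ₗ[ℝ] BddMeas}
  {Qf : ConsistentOrdering 𝒜 → ℝ → ℝ → TransProb}

/-- By the backward equation each side of the matching identity is `T h - h`, so the two operators
agree on `D`. -/
theorem Matching.eq_of_lt (hmatch : Matching S Qf D G) (hD : Dense (D : Set BddMeas))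
    (hQf : ∀ o, IsTransitionSystem (Icc 0 (S o).a) (Qf o))
    (hG : ∀ o, IsGenerator (S o).a (Qf o) D (G o)) {o₁ o₂ : ConsistentOrdering 𝒜} {s t u v : ℝ}
    (hs : 0 ≤ s) (hst : s < t) (ht : t ≤ (S o₁).a) (hu : 0 ≤ u) (huv : u < v)
    (hv : v ≤ (S o₂).a) (h₁ : (S o₁).f s = (S o₂).f u) (h₂ : (S o₁).f t = (S o₂).f v) :
    Qf o₁ s t = Qf o₂ u v :=
  transProb_eq_of_transOp hD fun h hh => BddMeas.ext_apply fun x => by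
    have := hmatch o₁ o₂ s t u v hs hst ht hu huv hv h₁ h₂ h hh x
    rw [(hG o₁).integral_eq (hQf o₁) hs hst.le ht hh,
      (hG o₂).integral_eq (hQf o₂) hu huv.le hv hh] at this
    linarith

/-- The identical transition probability. -/
noncomputable def idTrans : TransProb := ⟨Kernel.id, inferInstance⟩

theorem transOp_idTrans (h : BddMeas) : transOp idTrans h = h :=
  BddMeas.ext_apply fun x => by simp [transOp_apply, idTrans, Kernel.id_apply]

theorem IsTransitionSystem.eq_idTrans {ι : Type*} [Preorder ι] {I : Set ι}
    {Q : ι → ι → TransProb} (hQ : IsTransitionSystem I Q) {i : ι} (hi : i ∈ I) :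
    Q i i = idTrans :=
  Subtype.ext (Kernel.ext fun x => by rw [hQ.refl i hi x]; simp [idTrans, Kernel.id_apply])

/-- A flow with equal values at `s` and `t` is constant in between, so matching the flow with itself
gives `Q_{st} = Q_{sv}` for all `v` in (s, t). Letting `v` decrease to `s`, strong continuity leaves
only the identity. -/
theorem Matching.eq_idTrans (hmatch : Matching S Qf D G) (hD : Dense (D : Set BddMeas))
    (hQf : ∀ o, IsTransitionSystem (Icc 0 (S o).a) (Qf o))
    (hG : ∀ o, IsGenerator (S o).a (Qf o) D (G o)) {o : ConsistentOrdering 𝒜} {s t : ℝ}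
    (hs : 0 ≤ s) (hst : s ≤ t) (ht : t ≤ (S o).a) (h : (S o).f s = (S o).f t) :
    Qf o s t = idTrans := by
  rcases hst.eq_or_lt with rfl | hlt
  · exact (hQf o).eq_idTrans ⟨hs, ht⟩
  have hfl := (S o).flow
  have hmid : ∀ v ∈ Ioo s t, Qf o s t = Qf o s v := fun v hv => by
    refine hmatch.eq_of_lt hD hQf hG hs hlt ht hs hv.1 (hv.2.le.trans ht) rfl ?_
    refine Subset.antisymm ?_ ?_
    · rw [← h]
      exact hfl.mono s ⟨hs, hst.trans ht⟩ v ⟨hs.trans hv.1.le, hv.2.le.trans ht⟩ hv.1.le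
    · exact hfl.mono v ⟨hs.trans hv.1.le, hv.2.le.trans ht⟩ t ⟨hs.trans hst, ht⟩ hv.2.le
  refine transProb_eq_of_transOp hD fun g hg => ?_
  rw [transOp_idTrans, ← (hQf o).transOp_self (i := s) ⟨hs, hst.trans ht⟩ g]
  have hc : ContinuousWithinAt (fun v => transOp (Qf o s v) g) (Icc s (S o).a) s :=
    ((hG o).contDiff_right s ⟨hs, hst.trans ht⟩ g hg).continuousOn s ⟨le_rfl, hst.trans ht⟩
  have hc' : Tendsto (fun v => transOp (Qf o s v) g) (𝓝[Ioo s t] s)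
      (𝓝 (transOp (Qf o s s) g)) :=
    hc.mono_left (nhdsWithin_mono _ fun v hv => ⟨hv.1.le, hv.2.le.trans ht⟩)
  have hne : (𝓝[Ioo s t] s).NeBot := left_nhdsWithin_Ioo_neBot hlt
  have hev : (fun v => transOp (Qf o s v) g) =ᶠ[𝓝[Ioo s t] s] fun _ => transOp (Qf o s t) g :=
    eventually_mem_nhdsWithin.mono fun v hv => by simp only [← hmid v hv]
  rw [(hQf o).transOp_self (i := s) ⟨hs, hst.trans ht⟩ g] at hc' ⊢
  exact tendsto_nhds_unique (tendsto_const_nhds.congr' hev.symm) hc'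

/-- The matching condition requires two nondegenerate intervals. If the two sets coincide, both
transitions are the identity even if one flow rests there and the other does not; otherwise neither
interval is degenerate. -/
theorem Matching.eq_of_le (hmatch : Matching S Qf D G) (hD : Dense (D : Set BddMeas))
    (hQf : ∀ o, IsTransitionSystem (Icc 0 (S o).a) (Qf o))
    (hG : ∀ o, IsGenerator (S o).a (Qf o) D (G o)) {o₁ o₂ : ConsistentOrdering 𝒜} {s t u v : ℝ}
    (hs : 0 ≤ s) (hst : s ≤ t) (ht : t ≤ (S o₁).a) (hu : 0 ≤ u) (huv : u ≤ v)
    (hv : v ≤ (S o₂).a) (h₁ : (S o₁).f s = (S o₂).f u) (h₂ : (S o₁).f t = (S o₂).f v) :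
    Qf o₁ s t = Qf o₂ u v := by
  by_cases hB : (S o₁).f s = (S o₁).f t
  · rw [hmatch.eq_idTrans hD hQf hG hs hst ht hB,
      hmatch.eq_idTrans hD hQf hG hu huv hv (by rw [← h₁, ← h₂, hB])]
  · refine hmatch.eq_of_lt hD hQf hG hs (hst.lt_of_ne ?_) ht hu (huv.lt_of_ne ?_) hv h₁ h₂
    · rintro rfl; exact hB rfl
    · rintro rfl; exact hB (h₁.trans h₂.symm)

end Matching

/-! ### Combinatorics of consistent orderings -/

section Orderings

variable {T : Type u}

theorem mem_finUnions_of_mem {𝓑 : Set (Set T)} {A : Set T} (hA : A ∈ 𝓑) : A ∈ finUnions 𝓑 :=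
  ⟨{A}, finite_singleton A, by simpa using hA, by simp⟩

theorem empty_mem_finUnions (𝓑 : Set (Set T)) : ∅ ∈ finUnions 𝓑 :=
  ⟨∅, finite_empty, empty_subset _, by simp⟩

theorem union_mem_finUnions {𝓑 : Set (Set T)} {A B : Set T} (hA : A ∈ finUnions 𝓑)
    (hB : B ∈ finUnions 𝓑) : A ∪ B ∈ finUnions 𝓑 := by
  obtain ⟨F, hF, hFB, rfl⟩ := hA
  obtain ⟨F', hF', hFB', rfl⟩ := hB
  exact ⟨F ∪ F', hF.union hF', union_subset hFB hFB', (sUnion_union _ _).symm⟩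

theorem iUnion_mem_finUnions {𝓑 : Set (Set T)} {n : ℕ} {A : Fin n → Set T}
    (hA : ∀ i, A i ∈ 𝓑) : ⋃ i, A i ∈ finUnions 𝓑 :=
  ⟨range A, finite_range A, by rintro _ ⟨i, rfl⟩; exact hA i, (sUnion_range A).symm⟩

theorem IsIndexingCollection.inter_mem [TopologicalSpace T] {𝒜 : Set (Set T)}
    (h𝒜 : IsIndexingCollection 𝒜) {A B : Set T} (hA : A ∈ 𝒜) (hB : B ∈ 𝒜) : A ∩ B ∈ 𝒜 := by
  have := h𝒜.sInter_mem {A, B} (by rintro _ (rfl | rfl) <;> assumption) ⟨A, by simp⟩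
  simpa using this

theorem IsIndexingCollection.inter_mem_finUnions [TopologicalSpace T] {𝒜 : Set (Set T)}
    (h𝒜 : IsIndexingCollection 𝒜) {A B : Set T} (hA : A ∈ 𝒜) (hB : B ∈ finUnions 𝒜) :
    A ∩ B ∈ finUnions 𝒜 := by
  obtain ⟨F, hF, hFB, rfl⟩ := hB
  refine ⟨(fun C => A ∩ C) '' F, hF.image _, ?_, ?_⟩
  · rintro _ ⟨C, hC, rfl⟩
    exact h𝒜.inter_mem hA (hFB hC)
  · ext x
    simp

theorem IsIndexingCollection.minSet_mem [TopologicalSpace T] [Nonempty T] {𝒜 : Set (Set T)}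
    (h𝒜 : IsIndexingCollection 𝒜) : minSet 𝒜 ∈ 𝒜 :=
  h𝒜.sInter_mem _ sdiff_subset ⟨univ, h𝒜.univ_mem, by simp⟩

/-- The nonempty members are compact and directed by reverse inclusion, because any two of them meet
in a nonempty member. -/
theorem IsIndexingCollection.minSet_nonempty [TopologicalSpace T] [CompactSpace T] [Nonempty T]
    {𝒜 : Set (Set T)} (h𝒜 : IsIndexingCollection 𝒜) : (minSet 𝒜).Nonempty := by
  have : Nonempty (𝒜 \ {∅} : Set (Set T)) := ⟨⟨univ, h𝒜.univ_mem, by simp⟩⟩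
  rw [minSet, sInter_eq_iInter]
  refine IsCompact.nonempty_iInter_of_directed_nonempty_isCompact_isClosed _ ?_ ?_ ?_ ?_
  · rintro ⟨A, hA, hA0⟩ ⟨B, hB, hB0⟩
    have hAB := h𝒜.inter_nonempty A hA B hB (nonempty_iff_ne_empty.2 hA0)
      (nonempty_iff_ne_empty.2 hB0)
    exact ⟨⟨A ∩ B, h𝒜.inter_mem hA hB, hAB.ne_empty⟩, inter_subset_left, inter_subset_right⟩
  · exact fun A => nonempty_iff_ne_empty.2 A.2.2
  · exact fun A => (h𝒜.isClosed _ A.2.1).isCompact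
  · exact fun A => h𝒜.isClosed _ A.2.1

theorem minSet_subset {𝒜 : Set (Set T)} {A : Set T} (hA : A ∈ 𝒜) (hne : A.Nonempty) :
    minSet 𝒜 ⊆ A :=
  sInter_subset_of_mem ⟨hA, hne.ne_empty⟩

theorem minSet_subset_finUnions {𝒜 : Set (Set T)} {B : Set T} (hB : B ∈ finUnions 𝒜)
    (hne : B.Nonempty) : minSet 𝒜 ⊆ B := by
  obtain ⟨F, -, hF, rfl⟩ := hB
  obtain ⟨x, A, hA, hx⟩ := hne
  exact (minSet_subset (hF hA) ⟨x, hx⟩).trans (subset_sUnion_of_mem hA)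

namespace ConsistentOrdering

variable {𝒜 : Set (Set T)} (o : ConsistentOrdering 𝒜)

/-- The union of the first `i` sets of a consistent ordering. -/
def D (i : ℕ) : Set T := ⋃ j ∈ Finset.Icc 1 i, o.A j

/-- The finite sub-semilattice listed by a consistent ordering. -/
def sets : Set (Set T) := o.A '' Icc 1 o.n

/-- The `i`-th left neighbourhood of a consistent ordering. -/
def atom (i : ℕ) : Set T := o.D i \ o.D (i - 1)

@[simp] theorem D_zero : o.D 0 = ∅ := by simp [D]

theorem mem_D {i : ℕ} {x : T} : x ∈ o.D i ↔ ∃ j, 1 ≤ j ∧ j ≤ i ∧ x ∈ o.A j := by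
  simp [D, and_assoc]

theorem D_mono : Monotone o.D := fun _ _ hij x hx => by
  obtain ⟨k, h1, h2, h3⟩ := o.mem_D.1 hx
  exact o.mem_D.2 ⟨k, h1, h2.trans hij, h3⟩

theorem A_subset_D {i j : ℕ} (hi : 1 ≤ i) (hij : i ≤ j) : o.A i ⊆ o.D j := fun _ hx =>
  o.mem_D.2 ⟨i, hi, hij, hx⟩

theorem D_one : o.D 1 = o.A 1 := by simp [D]

theorem A_mem (h0 : ∅ ∈ 𝒜) {i : ℕ} (hi : 1 ≤ i) : o.A i ∈ 𝒜 := by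
  rcases le_or_gt i o.n with h | h
  · exact o.mem i (Finset.mem_Icc.2 ⟨hi, h⟩)
  · rwa [o.beyond i h]

theorem D_mem_finUnions (h0 : ∅ ∈ 𝒜) (i : ℕ) : o.D i ∈ finUnions 𝒜 := by
  refine ⟨o.A '' (Icc 1 i), (finite_Icc 1 i).image _, ?_, ?_⟩
  · rintro _ ⟨j, hj, rfl⟩
    exact o.A_mem h0 hj.1
  · ext x
    simp [mem_D, and_assoc]

theorem D_nonempty {i : ℕ} (hi : 1 ≤ i) : (o.D i).Nonempty :=
  (o.nonempty 1 (Finset.mem_Icc.2 ⟨le_rfl, o.n_pos⟩)).mono (o.A_subset_D le_rfl hi)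

theorem sets_subset : o.sets ⊆ 𝒜 := by
  rintro _ ⟨i, hi, rfl⟩
  exact o.mem i (Finset.mem_Icc.2 hi)

theorem sets_finite : o.sets.Finite := (finite_Icc 1 o.n).image _

theorem nonempty_of_mem_sets {A : Set T} (hA : A ∈ o.sets) : A.Nonempty := by
  obtain ⟨i, hi, rfl⟩ := hA
  exact o.nonempty i (Finset.mem_Icc.2 hi)

theorem inter_mem_sets {A B : Set T} (hA : A ∈ o.sets) (hB : B ∈ o.sets) : A ∩ B ∈ o.sets := by
  obtain ⟨i, hi, rfl⟩ := hA
  obtain ⟨j, hj, rfl⟩ := hB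
  obtain ⟨k, hk, h⟩ := o.inter_mem i (Finset.mem_Icc.2 hi) j (Finset.mem_Icc.2 hj)
  exact ⟨k, Finset.mem_Icc.1 hk, h.symm⟩

/-- The right-hand side does not involve the numbering, so left neighbourhoods belong to the
semilattice. Proper subsets of `A i` come earlier by consistency. Conversely, a point of `A i` that
lies in an earlier `A j` lies in the member `A i ∩ A j`, which is a proper subset, since `A i ⊆ A j`
would put `i` first. -/
theorem atom_eq {i : ℕ} (hi : i ∈ Icc 1 o.n) :
    o.atom i = o.A i \ ⋃₀ {A ∈ o.sets | A ⊂ o.A i} := by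
  ext x
  have hi' : i ∈ Finset.Icc 1 o.n := Finset.mem_Icc.2 hi
  constructor
  · rintro ⟨hx, hx'⟩
    obtain ⟨j, h1, h2, h3⟩ := o.mem_D.1 hx
    have hji : j = i := by
      by_contra hne
      exact hx' (o.mem_D.2 ⟨j, h1, by omega, h3⟩)
    subst hji
    refine ⟨h3, ?_⟩
    rintro ⟨A, ⟨⟨k, hk, rfl⟩, hkj⟩, hxA⟩
    have := o.consistent k (Finset.mem_Icc.2 hk) j hi' hkj
    exact hx' (o.mem_D.2 ⟨k, hk.1, by omega, hxA⟩)
  · rintro ⟨hx, hx'⟩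
    refine ⟨o.A_subset_D hi.1 le_rfl hx, fun hxD => ?_⟩
    obtain ⟨j, h1, h2, h3⟩ := o.mem_D.1 hxD
    have hj : j ∈ Icc 1 o.n := ⟨h1, by have := hi.2; omega⟩
    have hj' : j ∈ Finset.Icc 1 o.n := Finset.mem_Icc.2 hj
    have hi1 := hi.1
    refine hx' ⟨o.A i ∩ o.A j, ⟨o.inter_mem_sets ⟨i, hi, rfl⟩ ⟨j, hj, rfl⟩,
      inter_subset_left.ssubset_of_ne fun heq => ?_⟩, hx, h3⟩
    have hsub : o.A i ⊆ o.A j := inter_eq_left.1 heq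
    rcases hsub.eq_or_ssubset with h | h
    · have := o.distinct i hi' j hj' h
      omega
    · have := o.consistent i hi' j hj' h
      omega

/-- If a point of the neighbourhood lies in `A`, then `A i ∩ A` is a member containing it and cannot
be a proper subset of `A i`. -/
theorem atom_subset_or_disjoint {i : ℕ} (hi : i ∈ Icc 1 o.n) {A : Set T} (hA : A ∈ o.sets) :
    o.atom i ⊆ A ∨ Disjoint (o.atom i) A := by
  rw [or_iff_not_imp_right, not_disjoint_iff]
  rintro ⟨x, hx, hxA⟩
  rw [o.atom_eq hi] at hx ⊢
  have hAi : o.A i ⊆ A := by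
    by_contra hnot
    refine hx.2 ⟨o.A i ∩ A, ⟨o.inter_mem_sets ⟨i, hi, rfl⟩ hA,
      inter_subset_left.ssubset_of_ne fun heq => hnot (inter_eq_left.1 heq)⟩, hx.1, hxA⟩
  exact sdiff_subset.trans hAi

theorem atom_congr {o o' : ConsistentOrdering 𝒜} (h : o.sets = o'.sets) {i j : ℕ}
    (hi : i ∈ Icc 1 o.n) (hj : j ∈ Icc 1 o'.n) (hij : o.A i = o'.A j) : o.atom i = o'.atom j := by
  rw [o.atom_eq hi, o'.atom_eq hj, h, hij]

theorem bijOn : BijOn o.A (Icc 1 o.n) o.sets :=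
  BijOn.mk (mapsTo_image _ _) (fun i hi j hj h => o.distinct i (Finset.mem_Icc.2 hi) j
    (Finset.mem_Icc.2 hj) h) (surjOn_image _ _)

theorem ncard_sets : o.sets.ncard = o.n := by
  rw [sets, o.bijOn.injOn.ncard_image, ← Finset.coe_Icc, ncard_coe_finset]
  simp

/-- Two consistent orderings of the same sub-semilattice differ by a permutation. -/
theorem exists_perm {o o' : ConsistentOrdering 𝒜} (h : o.sets = o'.sets) :
    o.n = o'.n ∧ ∃ π : ℕ → ℕ, BijOn π (Icc 1 o.n) (Icc 1 o.n) ∧ (∀ i ∈ Icc 1 o.n,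
      o.A i = o'.A (π i)) ∧ π 1 = 1 := by
  have hn : o.n = o'.n := by rw [← ncard_sets, h, ncard_sets]
  have hex : ∀ i ∈ Icc 1 o.n, ∃ j ∈ Icc 1 o.n, o.A i = o'.A j := fun i hi => by
    have : o.A i ∈ o'.sets := h ▸ mem_image_of_mem _ hi
    obtain ⟨j, hj, hij⟩ := this
    exact ⟨j, hn ▸ hj, hij.symm⟩
  choose! π hπ hA using hex
  have hinj : InjOn π (Icc 1 o.n) := fun i hi j hj hij =>
    o.bijOn.injOn hi hj (by rw [hA i hi, hA j hj, hij])
  have hbij : BijOn π (Icc 1 o.n) (Icc 1 o.n) :=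
    ((finite_Icc 1 o.n).injOn_iff_bijOn_of_mapsTo hπ).1 hinj
  refine ⟨hn, π, hbij, hA, ?_⟩
  have h1 : (1 : ℕ) ∈ Icc 1 o.n := ⟨le_rfl, o.n_pos⟩
  -- The first set of any consistent ordering is the least one: a proper intersection with another
  -- member would have to be numbered before 1. Hence both orderings start with the same set.
  have hmin : ∀ (p : ConsistentOrdering 𝒜), ∀ A ∈ p.sets, p.A 1 ⊆ A := by
    rintro p _ ⟨i, hi, rfl⟩
    have hp1 : (1 : ℕ) ∈ Icc 1 p.n := ⟨le_rfl, p.n_pos⟩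
    obtain ⟨k, hk, hki⟩ := p.inter_mem_sets ⟨1, hp1, rfl⟩ ⟨i, hi, rfl⟩
    by_contra hnot
    have hss : p.A k ⊂ p.A 1 := by
      rw [hki]
      exact inter_subset_left.ssubset_of_ne fun heq => hnot (inter_eq_left.1 heq)
    have := p.consistent k (Finset.mem_Icc.2 hk) 1 (Finset.mem_Icc.2 hp1) hss
    have := hk.1
    omega
  have heq : o.A 1 = o'.A 1 := by
    refine Subset.antisymm (hmin o _ ?_) (hmin o' _ ?_)
    · rw [h]; exact ⟨1, ⟨le_rfl, o'.n_pos⟩, rfl⟩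
    · rw [← h]; exact ⟨1, h1, rfl⟩
  refine o'.bijOn.injOn (hn ▸ hπ 1 h1) ⟨le_rfl, o'.n_pos⟩ ?_
  rw [← hA 1 h1, heq]

end ConsistentOrdering

/-- A finite set can be listed in such a way that a given function is monotone along the list. -/
theorem exists_enumeration {α : Type*} [Nonempty α] {s : Set α} (hs : s.Finite) (K : α → ℕ) :
    ∃ b : ℕ → α, BijOn b (Icc 1 s.ncard) s ∧
      ∀ i ∈ Icc 1 s.ncard, ∀ j ∈ Icc 1 s.ncard, i ≤ j → K (b i) ≤ K (b j) := by
  classical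
  have := hs.fintype
  obtain ⟨n, hn⟩ : ∃ n, n = s.ncard := ⟨_, rfl⟩
  have e : Fin n ≃ s := (Fintype.equivFinOfCardEq (by rw [hn, ncard_eq_toFinset_card' s,
    toFinset_card])).symm
  let σ := Tuple.sort fun i => K (e i)
  have hmono : Monotone ((fun i => K (e i)) ∘ σ) := Tuple.monotone_sort _
  rw [← hn]
  refine ⟨fun i => if h : i - 1 < n then e (σ ⟨i - 1, h⟩) else Classical.arbitrary α,
    ⟨?_, ?_, ?_⟩, ?_⟩
  · rintro i ⟨h1, h2⟩
    have : i - 1 < n := by omega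
    simp [this]
  · rintro i ⟨h1, h2⟩ j ⟨h3, h4⟩ hij
    have h5 : i - 1 < n := by omega
    have h6 : j - 1 < n := by omega
    simp only [h5, h6, dif_pos] at hij
    have := σ.injective (e.injective (Subtype.ext hij))
    simp at this
    omega
  · intro x hx
    have h5 := (σ.symm (e.symm ⟨x, hx⟩)).2
    refine ⟨σ.symm (e.symm ⟨x, hx⟩) + 1, ⟨by omega, by omega⟩, ?_⟩
    simp
  · rintro i ⟨h1, h2⟩ j ⟨h3, h4⟩ hij
    have h5 : i - 1 < n := by omega
    have h6 : j - 1 < n := by omega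
    simp only [h5, h6, dif_pos]
    exact hmono (show (⟨i - 1, h5⟩ : Fin n) ≤ ⟨j - 1, h6⟩ by
      simp only [Fin.mk_le_mk]; omega)

/-- A finite sub-semilattice has a consistent ordering that is adapted to a given increasing chain
of unions of its members. -/
theorem exists_ordering_adapted {𝒜 𝓕 : Set (Set T)} (hfin : 𝓕.Finite) (hne : 𝓕.Nonempty)
    (hsub : 𝓕 ⊆ 𝒜) (hnon : ∀ A ∈ 𝓕, A.Nonempty) (hinter : ∀ A ∈ 𝓕, ∀ B ∈ 𝓕, A ∩ B ∈ 𝓕)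
    {B : ℕ → Set T} (hB : Monotone B) (m : ℕ) (hBu : ∀ i ≤ m, ∃ 𝓖 ⊆ 𝓕, B i = ⋃₀ 𝓖) :
    ∃ (o : ConsistentOrdering 𝒜) (κ : ℕ → ℕ), o.sets = 𝓕 ∧ Monotone κ ∧
      (∀ i, κ i ≤ o.n) ∧ ∀ i ≤ m, o.D (κ i) = B i := by
  classical
  have := hfin.fintype
  -- Sorting by `K` is lexicographic: first by the number of sets of the chain that fail to contain
  -- `A`, then by the number of members below `A`. The first criterion exhausts each `B i` before
  -- leaving it, the second respects strict inclusion; `d` never exceeds the cardinality of `𝓕`, so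
  -- it cannot outweigh a unit of `c`.
  let c : Set T → ℕ := fun A => ((Finset.range (m + 1)).filter fun i => ¬ A ⊆ B i).card
  let d : Set T → ℕ := fun A => (𝓕.toFinset.filter fun A' => A' ⊆ A).card
  let K : Set T → ℕ := fun A => c A * (𝓕.toFinset.card + 1) + d A
  have hd : ∀ A, d A ≤ 𝓕.toFinset.card := fun A => Finset.card_filter_le _ _
  have hcK : ∀ A A', c A < c A' → K A < K A' := fun A A' h => by
    have h1 := hd A
    have h2 : (c A + 1) * (𝓕.toFinset.card + 1) ≤ c A' * (𝓕.toFinset.card + 1) :=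
      Nat.mul_le_mul_right _ h
    simp only [K]
    nlinarith
  have hcmono : ∀ A A', A ⊆ A' → c A ≤ c A' := fun A A' h =>
    Finset.card_le_card (Finset.monotone_filter_right _ fun i _ hi hi' => hi (h.trans hi'))
  have hKlt : ∀ A ∈ 𝓕, ∀ A' ∈ 𝓕, A ⊂ A' → K A < K A' := fun A _ A' hA' h => by
    rcases (hcmono A A' h.subset).lt_or_eq with h1 | h1
    · exact hcK A A' h1
    · have : d A < d A' := Finset.card_lt_card <| by
        refine Finset.ssubset_iff_of_subset
          (Finset.monotone_filter_right _ fun C _ hC => hC.trans h.subset) |>.2 ⟨A', ?_, ?_⟩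
        · simp [hA']
        · simp only [Finset.mem_filter, not_and]
          exact fun _ h2 => h.not_subset h2
      simp only [K, h1]
      omega
  have hKB : ∀ i ≤ m, ∀ A A', A ⊆ B i → ¬ A' ⊆ B i → K A < K A' := fun i hi A A' h h' => by
    refine hcK A A' (Finset.card_lt_card ?_)
    refine Finset.ssubset_iff_of_subset (fun j hj => ?_) |>.2 ⟨i, ?_, ?_⟩
    · simp only [Finset.mem_filter, Finset.mem_range] at hj ⊢
      have hji : j < i := by
        by_contra hle
        exact hj.2 (h.trans (hB (not_lt.1 hle)))
      exact ⟨hj.1, fun h2 => h' (h2.trans (hB hji.le))⟩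
    · simp [h']; omega
    · simp [h]
  obtain ⟨b, hb, hbK⟩ := exists_enumeration hfin K
  set n := 𝓕.ncard with hn
  have hn1 : 1 ≤ n := (ncard_pos hfin).2 hne
  let A : ℕ → Set T := fun i => if i = 0 then minSet 𝒜 else if i ≤ n then b i else ∅
  have hA : ∀ i ∈ Icc 1 n, A i = b i := fun i hi => by
    have h1 : i ≠ 0 := by have := hi.1; omega
    simp [A, h1, hi.2]
  have hAF : ∀ i ∈ Finset.Icc 1 n, A i ∈ 𝓕 := fun i hi => by
    rw [hA i (Finset.mem_Icc.1 hi)]; exact hb.mapsTo (Finset.mem_Icc.1 hi)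
  let o : ConsistentOrdering 𝒜 :=
    { n := n
      A := A
      n_pos := hn1
      zero_eq := by simp [A]
      mem := fun i hi => hsub (hAF i hi)
      nonempty := fun i hi => hnon _ (hAF i hi)
      distinct := fun i hi j hj h => by
        have hi' := Finset.mem_Icc.1 hi
        have hj' := Finset.mem_Icc.1 hj
        rw [hA i hi', hA j hj'] at h
        exact hb.injOn hi' hj' h
      inter_mem := fun i hi j hj => by
        obtain ⟨k, hk, hk'⟩ := hb.surjOn (hinter _ (hAF i hi) _ (hAF j hj))
        exact ⟨k, Finset.mem_Icc.2 hk, by rw [hA k hk, hk']⟩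
      consistent := fun i hi j hj h => by
        by_contra hle
        have h1 := hKlt _ (hAF i hi) _ (hAF j hj) h
        have hi' := Finset.mem_Icc.1 hi
        have hj' := Finset.mem_Icc.1 hj
        rw [hA i hi', hA j hj'] at h1
        exact absurd (hbK j hj' i hi' (not_lt.1 hle)) (not_le.2 h1)
      beyond := fun i hi => by
        have h1 : i ≠ 0 := by omega
        simp [A, h1, not_le.2 hi] }
  have hosets : o.sets = 𝓕 := by
    rw [← hb.image_eq]
    exact image_congr fun i hi => hA i hi
  -- The largest number of a set contained in `B i`. The supremum is 0 when there is none, which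
  -- fits `o.D 0 = ∅`.
  let κ : ℕ → ℕ := fun i => ((Finset.Icc 1 n).filter fun j => A j ⊆ B i).sup id
  refine ⟨o, κ, hosets, fun i j hij => ?_, fun i => ?_, fun i hi => ?_⟩
  · exact Finset.sup_mono (Finset.monotone_filter_right _ fun k _ hk => hk.trans (hB hij))
  · exact Finset.sup_le fun j hj => (Finset.mem_Icc.1 (Finset.mem_filter.1 hj).1).2
  · have hlow : ∀ j, 1 ≤ j → j ≤ κ i → A j ⊆ B i := by
      intro j hj1 hj2
      have hne' : ((Finset.Icc 1 n).filter fun j => A j ⊆ B i).Nonempty := by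
        by_contra hempty
        rw [Finset.not_nonempty_iff_eq_empty] at hempty
        have : κ i = 0 := by simp only [κ, hempty]; rfl
        omega
      obtain ⟨k, hk, hk'⟩ := Finset.exists_mem_eq_sup _ hne' id
      have hk2 := Finset.mem_filter.1 hk
      have hkm := Finset.mem_Icc.1 hk2.1
      have hjk : j ≤ k := hj2.trans_eq hk'
      have hjm : j ∈ Icc 1 n := ⟨hj1, hjk.trans hkm.2⟩
      by_contra hnot
      have h1 := hKB i hi _ _ hk2.2 hnot
      rw [hA j hjm, hA k hkm] at h1
      exact absurd (hbK j hjm k hkm hjk) (not_le.2 h1)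
    ext x
    rw [o.mem_D]
    constructor
    · rintro ⟨j, h1, h2, h3⟩
      exact hlow j h1 h2 h3
    · intro hx
      obtain ⟨𝓖, h𝓖, hBi⟩ := hBu i hi
      rw [hBi] at hx
      obtain ⟨C, hC, hxC⟩ := hx
      obtain ⟨j, hj, hjC⟩ := hb.surjOn (h𝓖 hC)
      have hAj : A j = C := by rw [hA j hj, hjC]
      refine ⟨j, hj.1, ?_, by change x ∈ A j; rwa [hAj]⟩
      refine Finset.le_sup (f := id) (Finset.mem_filter.2 ⟨Finset.mem_Icc.2 hj, ?_⟩)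
      rw [hAj, hBi]
      exact subset_sUnion_of_mem hC

/-- Any finite set of members of `𝒜` is contained in a finite sub-semilattice. -/
theorem IsIndexingCollection.exists_semilattice [TopologicalSpace T] [Nonempty T]
    {𝒜 : Set (Set T)} (h𝒜 : IsIndexingCollection 𝒜) {𝓐 : Set (Set T)} (hfin : 𝓐.Finite)
    (hsub : 𝓐 ⊆ 𝒜) :
    ∃ 𝓕 : Set (Set T), 𝓕.Finite ∧ 𝓕.Nonempty ∧ 𝓕 ⊆ 𝒜 ∧ (∀ A ∈ 𝓕, A.Nonempty) ∧
      (∀ A ∈ 𝓕, ∀ B ∈ 𝓕, A ∩ B ∈ 𝓕) ∧ ∀ A ∈ 𝓐, A.Nonempty → A ∈ 𝓕 := by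
  have hcl : InfClosed 𝒜 := fun A hA B hB => h𝒜.inter_mem hA hB
  have hsub' : infClosure (insert univ 𝓐) ⊆ 𝒜 :=
    infClosure_min (insert_subset h𝒜.univ_mem hsub) hcl
  -- The whole space makes the semilattice nonempty. Discarding `∅` preserves closure under
  -- intersections, since nonempty members are never disjoint.
  refine ⟨{A ∈ infClosure (insert univ 𝓐) | A.Nonempty},
    (hfin.insert univ).infClosure.subset (sep_subset _ _),
    ⟨univ, subset_infClosure (mem_insert _ _), univ_nonempty⟩,
    (sep_subset _ _).trans hsub', fun A hA => hA.2, fun A hA B hB => ⟨?_, ?_⟩, fun A hA hne => ?_⟩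
  · exact infClosed_infClosure hA.1 hB.1
  · exact h𝒜.inter_nonempty A (hsub' hA.1) B (hsub' hB.1) hA.2 hB.2
  · exact ⟨subset_infClosure (mem_insert_of_mem _ hA), hne⟩

/-- The constituents of the sets `B i` are put into the semilattice together with `𝓐`, so that each
`B i` becomes a union of its members. -/
theorem IsIndexingCollection.exists_ordering [TopologicalSpace T] [Nonempty T]
    {𝒜 : Set (Set T)} (h𝒜 : IsIndexingCollection 𝒜) {𝓐 : Set (Set T)} (hfin : 𝓐.Finite)
    (hsub : 𝓐 ⊆ 𝒜) {B : ℕ → Set T} (hB : Monotone B) (m : ℕ) (hBu : ∀ i ≤ m, B i ∈ finUnions 𝒜) :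
    ∃ (o : ConsistentOrdering 𝒜) (κ : ℕ → ℕ), (∀ A ∈ 𝓐, A.Nonempty → A ∈ o.sets) ∧ Monotone κ ∧
      (∀ i, κ i ≤ o.n) ∧ ∀ i ≤ m, o.D (κ i) = B i := by
  choose! 𝓖 h𝓖 h𝓖' hB𝓖 using hBu
  obtain ⟨𝓕, hF, hFne, hFsub, hFnon, hFinter, hF𝓐⟩ := h𝒜.exists_semilattice
    (𝓐 := 𝓐 ∪ ⋃ i ∈ Iic m, 𝓖 i) (hfin.union ((finite_Iic m).biUnion fun i hi => h𝓖 i hi))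
    (union_subset hsub (iUnion₂_subset fun i hi => h𝓖' i hi))
  obtain ⟨o, κ, ho, hκ, hκn, hD⟩ := exists_ordering_adapted hF hFne hFsub hFnon hFinter hB m
    (fun i hi => ⟨𝓖 i \ {∅}, fun A hA => hF𝓐 A (Or.inr (mem_iUnion₂.2 ⟨i, hi, hA.1⟩))
      (nonempty_iff_ne_empty.2 hA.2), by rw [hB𝓖 i hi, sUnion_sdiff_singleton_empty]⟩)
  exact ⟨o, κ, fun A hA hne => ho ▸ hF𝓐 A (Or.inl hA) hne, hκ, hκn, hD⟩

/-- A consistent ordering of a larger semilattice can be rearranged so that it is adapted to a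
consistent ordering of a smaller one. -/
theorem ConsistentOrdering.exists_refinement {𝒜 : Set (Set T)} {o : ConsistentOrdering 𝒜}
    {o' : ConsistentOrdering 𝒜} (h : o.sets ⊆ o'.sets) :
    ∃ (p : ConsistentOrdering 𝒜) (κ : ℕ → ℕ), p.sets = o'.sets ∧ Monotone κ ∧
      (∀ i, κ i ≤ p.n) ∧ ∀ i ≤ o.n, p.D (κ i) = o.D i := by
  refine exists_ordering_adapted o'.sets_finite ⟨_, 1, ⟨le_rfl, o'.n_pos⟩, rfl⟩ o'.sets_subset
    (fun A hA => o'.nonempty_of_mem_sets hA) (fun A hA B hB => o'.inter_mem_sets hA hB)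
    o.D_mono o.n fun i hi => ⟨o.A '' Icc 1 i, ?_, ?_⟩
  · exact (image_mono (Icc_subset_Icc_right hi)).trans h
  · ext x
    simp [mem_D, and_assoc]

end Orderings

/-! ### Partition points of the connecting flows -/

section Flows

variable {T : Type u} [TopologicalSpace T] {𝒜 : Set (Set T)} {o : ConsistentOrdering 𝒜}
  (F : ConnectingFlow o)

theorem ConnectingFlow.time_le {i j : ℕ} (hij : i ≤ j) (hj : j ≤ o.n) : F.time i ≤ F.time j := by
  induction j, hij using Nat.le_induction with
  | base => exact le_rfl
  | succ k hk ih => exact (ih (by omega)).trans (F.time_lt k (by omega)).le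

theorem ConnectingFlow.time_mem {i : ℕ} (hi : i ≤ o.n) : F.time i ∈ Icc 0 F.a :=
  ⟨F.time_zero ▸ F.time_le (Nat.zero_le i) hi, F.time_le hi le_rfl⟩

/-- The index 0 has to be excluded: the flow starts in `∅'`, whereas `o.D 0 = ∅`. -/
theorem ConnectingFlow.f_time {i : ℕ} (hi : i ∈ Icc 1 o.n) : F.f (F.time i) = o.D i := by
  obtain ⟨k, rfl⟩ : ∃ k, i = k + 1 := ⟨i - 1, by have := hi.1; omega⟩
  have hk : k < o.n := hi.2
  rw [F.f_eq k hk _ ⟨(F.time_lt k hk).le, le_rfl⟩, F.piece_end k hk]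
  ext x
  simp only [ConsistentOrdering.mem_D, mem_union, mem_iUnion, Finset.mem_Icc]
  constructor
  · rintro (⟨j, hj, hx⟩ | hx)
    · exact ⟨j, hj.1, by omega, hx⟩
    · exact ⟨k + 1, by omega, le_rfl, hx⟩
  · rintro ⟨j, h1, h2, hx⟩
    rcases h2.lt_or_eq with h | rfl
    · exact Or.inl ⟨j, ⟨h1, by omega⟩, hx⟩
    · exact Or.inr hx

end Flows

/-! ### The transition system -/

section Transition

variable {T : Type u} [TopologicalSpace T] {𝒜 : Set (Set T)}

open Classical in
/-- The transition probability from `B` to `B'` along any flow of the collection through `B` and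
`B'`. -/
noncomputable def flowTrans (S : ∀ o : ConsistentOrdering 𝒜, ConnectingFlow o)
    (Qf : ConsistentOrdering 𝒜 → ℝ → ℝ → TransProb) (B B' : Set T) : TransProb :=
  if h : ∃ p : ConsistentOrdering 𝒜 × ℝ × ℝ, 0 ≤ p.2.1 ∧ p.2.1 ≤ p.2.2 ∧ p.2.2 ≤ (S p.1).a ∧
    (S p.1).f p.2.1 = B ∧ (S p.1).f p.2.2 = B' then Qf h.choose.1 h.choose.2.1 h.choose.2.2
  else idTrans

/-- The law at `B` of a process with initial distribution `μ`. -/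
noncomputable def flowLaw (S : ∀ o : ConsistentOrdering 𝒜, ConnectingFlow o)
    (Qf : ConsistentOrdering 𝒜 → ℝ → ℝ → TransProb) (μ : Measure ℝ) (B : Set T) : Measure ℝ :=
  μ.bind (flowTrans S Qf (minSet 𝒜) B).1

instance (S : ∀ o : ConsistentOrdering 𝒜, ConnectingFlow o)
    (Qf : ConsistentOrdering 𝒜 → ℝ → ℝ → TransProb) (μ : Measure ℝ) [IsProbabilityMeasure μ]
    (B : Set T) : IsProbabilityMeasure (flowLaw S Qf μ B) := by
  have := (flowTrans S Qf (minSet 𝒜) B).2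
  rw [flowLaw]
  infer_instance

open Classical in
/-- The set-indexed transition system; from `∅` one moves to `B` according to the law at `B`. -/
noncomputable def setTrans (S : ∀ o : ConsistentOrdering 𝒜, ConnectingFlow o)
    (Qf : ConsistentOrdering 𝒜 → ℝ → ℝ → TransProb) (μ : Measure ℝ) [IsProbabilityMeasure μ]
    (B B' : Set T) : TransProb :=
  if B = B' then idTrans else if B = ∅ then ⟨Kernel.const ℝ (flowLaw S Qf μ B'), inferInstance⟩
  else flowTrans S Qf B B'

/-- The assumptions on a family of generators and semigroups under which the set-indexed
transition system is constructed. -/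
structure IsMatchingFamily (S : ∀ o : ConsistentOrdering 𝒜, ConnectingFlow o)
    (D : Submodule ℝ BddMeas) (G : ConsistentOrdering 𝒜 → ℝ → D →ₗ[ℝ] BddMeas)
    (Qf : ConsistentOrdering 𝒜 → ℝ → ℝ → TransProb) : Prop where
  indexing : IsIndexingCollection 𝒜
  dense : Dense (D : Set BddMeas)
  isTransitionSystem : ∀ o, IsTransitionSystem (Icc 0 (S o).a) (Qf o)
  isGenerator : ∀ o, IsGenerator (S o).a (Qf o) D (G o)
  matching : Matching S Qf D G

variable {S : ∀ o : ConsistentOrdering 𝒜, ConnectingFlow o} {D : Submodule ℝ BddMeas}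
  {G : ConsistentOrdering 𝒜 → ℝ → D →ₗ[ℝ] BddMeas}
  {Qf : ConsistentOrdering 𝒜 → ℝ → ℝ → TransProb} {μ : Measure ℝ} [IsProbabilityMeasure μ]

/-- Matching makes the flow picked by choice irrelevant. -/
theorem IsMatchingFamily.flowTrans_eq (H : IsMatchingFamily S D G Qf) {o : ConsistentOrdering 𝒜}
    {s t : ℝ} (hs : 0 ≤ s) (hst : s ≤ t) (ht : t ≤ (S o).a) :
    flowTrans S Qf ((S o).f s) ((S o).f t) = Qf o s t := by
  have hex : ∃ p : ConsistentOrdering 𝒜 × ℝ × ℝ, 0 ≤ p.2.1 ∧ p.2.1 ≤ p.2.2 ∧ p.2.2 ≤ (S p.1).a ∧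
    (S p.1).f p.2.1 = (S o).f s ∧ (S p.1).f p.2.2 = (S o).f t := ⟨(o, s, t), hs, hst, ht, rfl, rfl⟩
  rw [flowTrans, dif_pos hex]
  obtain ⟨h1, h2, h3, h4, h5⟩ := hex.choose_spec
  exact H.matching.eq_of_le H.dense H.isTransitionSystem H.isGenerator h1 h2 h3 hs hst ht h4 h5

/-- An ordering adapted to the three-term chain has the three sets among its unions `o.D i`, which
its flow visits at partition points. Nonemptiness of `B₁` keeps the first index away from 0, where
the flow value is not `o.D 0`. -/
theorem IsIndexingCollection.exists_flow_through [Nonempty T] (h𝒜 : IsIndexingCollection 𝒜)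
    (S : ∀ o : ConsistentOrdering 𝒜, ConnectingFlow o) {B₁ B₂ B₃ : Set T}
    (h₁ : B₁ ∈ finUnions 𝒜) (h₂ : B₂ ∈ finUnions 𝒜) (h₃ : B₃ ∈ finUnions 𝒜) (hne : B₁.Nonempty)
    (h₁₂ : B₁ ⊆ B₂) (h₂₃ : B₂ ⊆ B₃) :
    ∃ (o : ConsistentOrdering 𝒜) (s t v : ℝ), 0 ≤ s ∧ s ≤ t ∧ t ≤ v ∧ v ≤ (S o).a ∧
      (S o).f s = B₁ ∧ (S o).f t = B₂ ∧ (S o).f v = B₃ := by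
  let B : ℕ → Set T := fun i => if i = 0 then B₁ else if i = 1 then B₂ else B₃
  have hB : Monotone B := monotone_nat_of_le_succ fun i => by
    rcases i with _ | _ | i
    · simpa [B] using h₁₂
    · simpa [B] using h₂₃
    · simp [B]
  have hBu : ∀ i ≤ 2, B i ∈ finUnions 𝒜 := fun i _ => by
    simp only [B]; split_ifs <;> assumption
  obtain ⟨o, κ, -, hκ, hκn, hD⟩ := h𝒜.exists_ordering finite_empty (empty_subset _) hB 2 hBu
  have hpos : ∀ i, 1 ≤ κ i := fun i => by
    have h0 : 1 ≤ κ 0 := by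
      by_contra hlt
      have h0 : κ 0 = 0 := by omega
      have := hD 0 (by norm_num)
      rw [h0, o.D_zero] at this
      simp only [B, if_true] at this
      exact hne.ne_empty this.symm
    exact h0.trans (hκ (Nat.zero_le i))
  have hf : ∀ i ≤ 2, (S o).f ((S o).time (κ i)) = B i := fun i hi => by
    rw [(S o).f_time ⟨hpos i, hκn i⟩, hD i hi]
  exact ⟨o, (S o).time (κ 0), (S o).time (κ 1), (S o).time (κ 2), ((S o).time_mem (hκn 0)).1,
    (S o).time_le (hκ (by norm_num)) (hκn 1), (S o).time_le (hκ (by norm_num)) (hκn 2),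
    ((S o).time_mem (hκn 2)).2, hf 0 (by norm_num), hf 1 (by norm_num), hf 2 le_rfl⟩

/-- All three transitions can be read off one flow, whose own transition system satisfies
Chapman–Kolmogorov. -/
theorem IsMatchingFamily.flowTrans_comp [Nonempty T] (H : IsMatchingFamily S D G Qf)
    {B₁ B₂ B₃ : Set T} (h₁ : B₁ ∈ finUnions 𝒜) (h₂ : B₂ ∈ finUnions 𝒜) (h₃ : B₃ ∈ finUnions 𝒜)
    (hne : B₁.Nonempty) (h₁₂ : B₁ ⊆ B₂) (h₂₃ : B₂ ⊆ B₃) :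
    (flowTrans S Qf B₁ B₃).1 = (flowTrans S Qf B₂ B₃).1 ∘ₖ (flowTrans S Qf B₁ B₂).1 := by
  obtain ⟨o, s, t, v, hs, hst, htv, hv, rfl, rfl, rfl⟩ :=
    H.indexing.exists_flow_through S h₁ h₂ h₃ hne h₁₂ h₂₃
  rw [H.flowTrans_eq hs (hst.trans htv) hv, H.flowTrans_eq (hs.trans hst) htv hv,
    H.flowTrans_eq hs hst (htv.trans hv)]
  exact (H.isTransitionSystem o).kernel_comp ⟨hs, hst.trans (htv.trans hv)⟩
    ⟨hs.trans hst, htv.trans hv⟩ ⟨hs.trans (hst.trans htv), hv⟩ hst htv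

theorem IsMatchingFamily.flowTrans_self [Nonempty T] (H : IsMatchingFamily S D G Qf)
    {B : Set T} (hB : B ∈ finUnions 𝒜) (hne : B.Nonempty) : flowTrans S Qf B B = idTrans := by
  obtain ⟨o, s, t, v, hs, hst, htv, hv, rfl, -, -⟩ :=
    H.indexing.exists_flow_through S hB hB hB hne subset_rfl subset_rfl
  have hsa := hst.trans (htv.trans hv)
  rw [H.flowTrans_eq hs le_rfl hsa]
  exact (H.isTransitionSystem o).eq_idTrans ⟨hs, hsa⟩

@[simp] theorem setTrans_self (B : Set T) : setTrans S Qf μ B B = idTrans := by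
  simp [setTrans]

theorem setTrans_empty {B : Set T} (hB : B.Nonempty) :
    (setTrans S Qf μ ∅ B).1 = Kernel.const ℝ (flowLaw S Qf μ B) := by
  simp [setTrans, hB.ne_empty.symm]

theorem IsMatchingFamily.setTrans_eq_flowTrans [Nonempty T] (H : IsMatchingFamily S D G Qf)
    {B B' : Set T} (hB : B ∈ finUnions 𝒜) (hne : B.Nonempty) :
    setTrans S Qf μ B B' = flowTrans S Qf B B' := by
  rw [setTrans]
  split_ifs with h1 h2
  · rw [← h1, H.flowTrans_self hB hne]
  · exact absurd h2 hne.ne_empty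
  · rfl

theorem IsMatchingFamily.setTrans_comp [CompactSpace T] [Nonempty T]
    (H : IsMatchingFamily S D G Qf)
    {B₁ B₂ B₃ : Set T} (h₁ : B₁ ∈ finUnions 𝒜) (h₂ : B₂ ∈ finUnions 𝒜) (h₃ : B₃ ∈ finUnions 𝒜)
    (h₁₂ : B₁ ⊆ B₂) (h₂₃ : B₂ ⊆ B₃) :
    (setTrans S Qf μ B₁ B₃).1 = (setTrans S Qf μ B₂ B₃).1 ∘ₖ (setTrans S Qf μ B₁ B₂).1 := by
  rcases B₁.eq_empty_or_nonempty with rfl | hne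
  · rcases B₂.eq_empty_or_nonempty with rfl | hne₂
    · simp [idTrans]
    -- Leaving `∅` means starting from `μ` at `∅'`, so the claim reduces to the chain `∅' ⊆ B₂ ⊆
    -- B₃`.
    · have hm := mem_finUnions_of_mem H.indexing.minSet_mem
      rw [setTrans_empty hne₂, setTrans_empty (hne₂.mono h₂₃), H.setTrans_eq_flowTrans h₂ hne₂]
      refine Kernel.ext fun x => ?_
      rw [Kernel.comp_apply, Kernel.const_apply, Kernel.const_apply, flowLaw, flowLaw,
        H.flowTrans_comp hm h₂ h₃ H.indexing.minSet_nonempty (minSet_subset_finUnions h₂ hne₂) h₂₃,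
        ← Measure.comp_assoc]
  · rw [H.setTrans_eq_flowTrans h₁ hne, H.setTrans_eq_flowTrans h₁ hne,
      H.setTrans_eq_flowTrans h₂ (hne.mono h₁₂)]
    exact H.flowTrans_comp h₁ h₂ h₃ hne h₁₂ h₂₃

theorem IsMatchingFamily.isTransitionSystem_setTrans [CompactSpace T] [Nonempty T]
    (H : IsMatchingFamily S D G Qf) :
    IsTransitionSystem (finUnions 𝒜) (setTrans S Qf μ) where
  refl B _ x := by simp [idTrans, Kernel.id_apply]
  comp B₁ h₁ B₂ h₂ B₃ h₃ h₁₂ h₂₃ x Γ hΓ := by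
    rw [H.setTrans_comp h₁ h₂ h₃ h₁₂ h₂₃, Kernel.comp_apply' _ _ _ hΓ]

/-- Every value of a flow contains its starting set `∅'`, so the special treatment of `∅` is never
seen along a flow. -/
theorem IsMatchingFamily.setTrans_flow [CompactSpace T] [Nonempty T]
    (H : IsMatchingFamily S D G Qf)
    {o : ConsistentOrdering 𝒜} {s t : ℝ} (hs : 0 ≤ s) (hst : s ≤ t) (ht : t ≤ (S o).a) :
    setTrans S Qf μ ((S o).f s) ((S o).f t) = Qf o s t := by
  have hsa : s ∈ Icc 0 (S o).a := ⟨hs, hst.trans ht⟩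
  rw [H.setTrans_eq_flowTrans ((S o).flow.mem s hsa), H.flowTrans_eq hs hst ht]
  refine H.indexing.minSet_nonempty.mono ?_
  rw [← (S o).f_zero]
  exact (S o).flow.mono 0 ⟨le_rfl, hsa.1.trans hsa.2⟩ s hsa hs

theorem IsMatchingFamily.setTrans_D [CompactSpace T] [Nonempty T]
    (H : IsMatchingFamily S D G Qf)
    {o : ConsistentOrdering 𝒜} {i j : ℕ} (hi : 1 ≤ i) (hij : i ≤ j) (hj : j ≤ o.n) :
    setTrans S Qf μ (o.D i) (o.D j) = Qf o ((S o).time i) ((S o).time j) := by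
  rw [← (S o).f_time ⟨hi, hij.trans hj⟩, ← (S o).f_time ⟨hi.trans hij, hj⟩]
  exact H.setTrans_flow ((S o).time_mem (hij.trans hj)).1 ((S o).time_le hij hj)
    ((S o).time_mem hj).2

/-- Identifies the law at the first set with the measure in the almost-everywhere clause of the
consistency condition. -/
theorem IsMatchingFamily.flowLaw_D_one (H : IsMatchingFamily S D G Qf)
    (o : ConsistentOrdering 𝒜) (ν : Measure ℝ) :
    flowLaw S Qf ν (o.D 1) = ν.bind (Qf o 0 ((S o).time 1)).1 := by
  have h1 : (1 : ℕ) ∈ Icc 1 o.n := ⟨le_rfl, o.n_pos⟩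
  have h2 := (S o).time_mem o.n_pos
  rw [flowLaw, ← (S o).f_time h1, ← (S o).f_zero, H.flowTrans_eq le_rfl h2.1 h2.2]

theorem IsMatchingFamily.isGenerator_setTrans [CompactSpace T] [Nonempty T]
    (H : IsMatchingFamily S D G Qf) (o : ConsistentOrdering 𝒜) :
    IsGenerator (S o).a (fun s t => setTrans S Qf μ ((S o).f s) ((S o).f t)) D (G o) where
  maps s hs t ht h hh := by
    rw [H.setTrans_flow hs.1 ht.1 ht.2]
    exact (H.isGenerator o).maps s hs t ht h hh
  contDiff_right s hs h hh := by
    refine ((H.isGenerator o).contDiff_right s hs h hh).congr fun t ht => ?_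
    rw [H.setTrans_flow hs.1 ht.1 ht.2]
  contDiff_left t ht h hh := by
    refine ((H.isGenerator o).contDiff_left t ht h hh).congr fun s hs => ?_
    rw [H.setTrans_flow hs.1 hs.2 ht.2]
  deriv_right s hs h := by
    refine ((H.isGenerator o).deriv_right s hs h).congr (fun t ht => ?_) ?_
    · rw [H.setTrans_flow hs.1 ht.1 ht.2]
    · rw [H.setTrans_flow hs.1 le_rfl hs.2]
  deriv_left s hs h := by
    refine ((H.isGenerator o).deriv_left s hs h).congr (fun t ht => ?_) ?_
    · rw [H.setTrans_flow ht.1 ht.2 hs.2]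
    · rw [H.setTrans_flow hs.1 le_rfl hs.2]

end Transition

/-! ### Markov chains along an increasing sequence of parameters -/

section Step

theorem measurable_stepMap (l : ℕ) :
    Measurable (fun p : (ℕ → ℝ) × ℝ => Function.update p.1 l p.2) := by
  refine measurable_pi_lambda _ fun i => ?_
  by_cases h : i = l
  · subst h; simpa using measurable_snd
  · simp only [Function.update_of_ne h]
    exact (measurable_pi_apply i).comp measurable_fst

instance (κ : Kernel ℝ ℝ) [IsMarkovKernel κ] (k l : ℕ) : IsMarkovKernel (stepKernel κ k l) :=
  Kernel.IsMarkovKernel.map _ (measurable_stepMap l)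

theorem stepKernel_apply (κ : Kernel ℝ ℝ) [IsMarkovKernel κ] (k l : ℕ) (y : ℕ → ℝ) :
    stepKernel κ k l y = (κ (y k)).map (fun z => Function.update y l z) := by
  rw [stepKernel, Kernel.map_apply _ (measurable_stepMap l), Kernel.prod_apply, Kernel.id_apply,
    Kernel.comap_apply, Measure.dirac_prod, Measure.map_map (measurable_stepMap l) (by fun_prop)]
  rfl

theorem lintegral_stepKernel (κ : Kernel ℝ ℝ) [IsMarkovKernel κ] (k l : ℕ) (y : ℕ → ℝ)
    {F : (ℕ → ℝ) → ℝ≥0∞} (hF : Measurable F) :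
    ∫⁻ y', F y' ∂(stepKernel κ k l y) = ∫⁻ z, F (Function.update y l z) ∂(κ (y k)) := by
  rw [stepKernel_apply, lintegral_map hF (measurable_update y)]

end Step

/-- The sequence that agrees with `y` up to the index `m` and vanishes afterwards. -/
def trunc (m : ℕ) (y : ℕ → ℝ) : ℕ → ℝ := fun i => if i ≤ m then y i else 0

theorem measurable_trunc (m : ℕ) : Measurable (trunc m) :=
  measurable_pi_lambda _ fun i => by
    by_cases h : i ≤ m
    · simpa [trunc, h] using measurable_pi_apply i
    · simp [trunc, h]

theorem trunc_of_le {m i : ℕ} (h : i ≤ m) (y : ℕ → ℝ) : trunc m y i = y i := by simp [trunc, h]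

theorem trunc_update {m l : ℕ} (h : m < l) (y : ℕ → ℝ) (z : ℝ) :
    trunc m (Function.update y l z) = trunc m y := by
  ext i
  by_cases hi : i ≤ m
  · rw [trunc_of_le hi, trunc_of_le hi, Function.update_of_ne (by omega)]
  · simp [trunc, hi]

theorem trunc_succ (m : ℕ) (y : ℕ → ℝ) :
    trunc (m + 1) y = Function.update (trunc m y) (m + 1) (y (m + 1)) := by
  ext i
  by_cases hi : i = m + 1
  · subst hi; simp [trunc]
  · rw [Function.update_of_ne hi]
    by_cases h : i ≤ m
    · rw [trunc_of_le h, trunc_of_le (by omega)]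
    · simp [trunc, h, show ¬ i ≤ m + 1 by omega]

theorem trunc_trunc {m n : ℕ} (h : m ≤ n) (y : ℕ → ℝ) : trunc m (trunc n y) = trunc m y := by
  ext i
  by_cases hi : i ≤ m
  · rw [trunc_of_le hi, trunc_of_le hi, trunc_of_le (hi.trans h)]
  · simp [trunc, hi]

section Chain

variable {ι : Type*}

/-- The law of the first `n` values of the Markov chain that starts in `0` at the parameter `B 0`
and moves from `B i` to `B (i + 1)` according to `Q`. -/
noncomputable def chainLaw (Q : ι → ι → TransProb) (B : ℕ → ι) : ℕ → Measure (ℕ → ℝ)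
  | 0 => Measure.dirac 0
  | n + 1 => (chainLaw Q B n).bind (stepKernel (Q (B n) (B (n + 1))).1 n (n + 1))

variable {Q : ι → ι → TransProb} {B : ℕ → ι}

instance (κ : TransProb) : IsMarkovKernel κ.1 := κ.2

instance (n : ℕ) : IsProbabilityMeasure (chainLaw Q B n) := by
  induction n with
  | zero => rw [chainLaw]; infer_instance
  | succ n ih => rw [chainLaw]; infer_instance

theorem lintegral_chainLaw_succ (n : ℕ) {F : (ℕ → ℝ) → ℝ≥0∞} (hF : Measurable F) :
    ∫⁻ y, F y ∂(chainLaw Q B (n + 1)) = ∫⁻ y, ∫⁻ z, F (Function.update y (n + 1) z)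
      ∂((Q (B n) (B (n + 1))).1 (y n)) ∂(chainLaw Q B n) := by
  rw [chainLaw, Measure.lintegral_bind (Kernel.aemeasurable _) hF.aemeasurable]
  exact lintegral_congr fun y => lintegral_stepKernel _ _ _ _ hF

/-- Every step after the `m`-th changes a coordinate beyond `m` only. -/
theorem lintegral_chainLaw_trunc {m n : ℕ} (hmn : m ≤ n) {F : (ℕ → ℝ) → ℝ≥0∞}
    (hF : Measurable F) :
    ∫⁻ y, F (trunc m y) ∂(chainLaw Q B n) = ∫⁻ y, F (trunc m y) ∂(chainLaw Q B m) := by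
  induction n, hmn using Nat.le_induction with
  | base => rfl
  | succ n hn ih =>
    rw [lintegral_chainLaw_succ (F := fun y => F (trunc m y)) _ (hF.comp (measurable_trunc m)),
      ← ih]
    refine lintegral_congr fun y => ?_
    simp_rw [trunc_update (Nat.lt_succ_of_le hn)]
    simp

theorem chainLaw_zero_apply (n : ℕ) : ∀ᵐ y ∂(chainLaw Q B n), y 0 = 0 := by
  have hm : MeasurableSet {y : ℕ → ℝ | ¬ y 0 = 0} :=
    (measurable_pi_apply 0 (measurableSet_singleton 0)).compl
  rw [ae_iff, ← lintegral_indicator_one hm]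
  have h1 : ∀ y : ℕ → ℝ, ({y : ℕ → ℝ | ¬ y 0 = 0}.indicator 1 y : ℝ≥0∞)
      = {y : ℕ → ℝ | ¬ y 0 = 0}.indicator 1 (trunc 0 y) := fun y => by
    simp [indicator, trunc_of_le le_rfl]
  rw [lintegral_congr h1, lintegral_chainLaw_trunc (Nat.zero_le n)
    (measurable_one.indicator hm), chainLaw, lintegral_dirac]
  simp [trunc]

/-- The law of a chain is determined by its one-step transition probabilities. -/
theorem map_trunc_eq_chainLaw {M : Measure (ℕ → ℝ)} [IsProbabilityMeasure M] (m : ℕ)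
    (h0 : ∀ᵐ y ∂M, y 0 = 0)
    (hM : ∀ k < m, ∀ φ : (ℕ → ℝ) × ℝ → ℝ≥0∞, Measurable φ →
      ∫⁻ y, φ (trunc k y, y (k + 1)) ∂M =
        ∫⁻ y, ∫⁻ z, φ (trunc k y, z) ∂((Q (B k) (B (k + 1))).1 (y k)) ∂M) :
    M.map (trunc m) = chainLaw Q B m := by
  induction m with
  | zero =>
    have h1 : trunc 0 =ᵐ[M] fun _ => 0 := h0.mono fun y hy => by
      ext i
      rcases i with _ | i
      · simpa [trunc] using hy
      · simp [trunc]
    rw [Measure.map_congr h1, Measure.map_const, measure_univ, one_smul, chainLaw]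
  | succ m ih =>
    have ih := ih fun k hk => hM k (by omega)
    refine Measure.ext_of_lintegral _ fun F hF => ?_
    rw [lintegral_map hF (measurable_trunc _), lintegral_chainLaw_succ _ hF, ← ih,
      lintegral_map _ (measurable_trunc m)]
    · simp_rw [trunc_succ]
      rw [hM m (Nat.lt_succ_self m) (fun p => F (Function.update p.1 (m + 1) p.2))
        (hF.comp (measurable_stepMap _))]
      simp_rw [trunc_of_le le_rfl]
    · have := Measurable.lintegral_kernel_prod_right' (κ := (Q (B m) (B (m + 1))).1.comap
        (fun y : ℕ → ℝ => y m) (measurable_pi_apply m))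
        (f := fun q => F (Function.update q.1 (m + 1) q.2)) (hF.comp (measurable_stepMap _))
      simpa [Kernel.comap_apply] using this

variable [Preorder ι] {I : Set ι}

/-- The Markov property of the chain. -/
theorem lintegral_chainLaw_markov (hQ : IsTransitionSystem I Q) (hB : Monotone B)
    (hBI : ∀ i, B i ∈ I) {k l n : ℕ} (hkl : k ≤ l) (hln : l ≤ n)
    {φ : (ℕ → ℝ) × ℝ → ℝ≥0∞} (hφ : Measurable φ) :
    ∫⁻ y, φ (trunc k y, y l) ∂(chainLaw Q B n) =
      ∫⁻ y, ∫⁻ z, φ (trunc k y, z) ∂((Q (B k) (B l)).1 (y k)) ∂(chainLaw Q B n) := by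
  -- Both sides are first reduced to chains of minimal length, `l` on the left and `k` on the right.
  -- Induction on `l` with Chapman–Kolmogorov then removes one step at a time.
  have hred : ∀ l n, k ≤ l → l ≤ n → ∀ φ : (ℕ → ℝ) × ℝ → ℝ≥0∞, Measurable φ →
      ∫⁻ y, φ (trunc k y, y l) ∂(chainLaw Q B n) =
        ∫⁻ y, φ (trunc k y, y l) ∂(chainLaw Q B l) := fun l n hkl hln φ hφ => by
    have := lintegral_chainLaw_trunc (Q := Q) (B := B) hln
      (F := fun y => φ (trunc k y, y l))
      (hφ.comp ((measurable_trunc k).prodMk (measurable_pi_apply l)))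
    simpa only [trunc_trunc hkl, trunc_of_le le_rfl] using this
  have hmeas : ∀ (κ : TransProb) (φ : (ℕ → ℝ) × ℝ → ℝ≥0∞), Measurable φ →
      Measurable fun p : (ℕ → ℝ) × ℝ => ∫⁻ z, φ (p.1, z) ∂(κ.1 p.2) := fun κ φ hφ => by
    have := Measurable.lintegral_kernel_prod_right' (κ := κ.1.comap
      (fun p : (ℕ → ℝ) × ℝ => p.2) measurable_snd) (f := fun q => φ (q.1.1, q.2))
      (hφ.comp (by fun_prop))
    simpa [Kernel.comap_apply] using this
  have hk : ∀ n, k ≤ n → ∀ (κ : TransProb) (φ : (ℕ → ℝ) × ℝ → ℝ≥0∞), Measurable φ →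
      ∫⁻ y, ∫⁻ z, φ (trunc k y, z) ∂(κ.1 (y k)) ∂(chainLaw Q B n) =
      ∫⁻ y, ∫⁻ z, φ (trunc k y, z) ∂(κ.1 (y k)) ∂(chainLaw Q B k) := fun n hn κ φ hφ => by
    have := lintegral_chainLaw_trunc (Q := Q) (B := B) hn
      (F := fun y => ∫⁻ z, φ (trunc k y, z) ∂(κ.1 (y k)))
      ((hmeas κ φ hφ).comp ((measurable_trunc k).prodMk (measurable_pi_apply k)))
    simpa only [trunc_trunc le_rfl, trunc_of_le le_rfl] using this
  rw [hred l n hkl hln φ hφ, hk n (hkl.trans hln) _ φ hφ]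
  clear hln
  induction l, hkl using Nat.le_induction generalizing φ with
  | base =>
    refine lintegral_congr fun y => ?_
    rw [hQ.refl _ (hBI k), lintegral_dirac]
  | succ l hl ih =>
    rw [lintegral_chainLaw_succ (F := fun y => φ (trunc k y, y (l + 1))) _
      (hφ.comp ((measurable_trunc k).prodMk (measurable_pi_apply _)))]
    simp_rw [trunc_update (Nat.lt_succ_of_le hl), Function.update_self]
    rw [ih (hmeas (Q (B l) (B (l + 1))) φ hφ)]
    refine lintegral_congr fun y => ?_
    rw [hQ.kernel_comp (hBI k) (hBI l) (hBI (l + 1)) (hB hl) (hB (Nat.le_succ l)),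
      Kernel.lintegral_comp (g := fun z => φ (trunc k y, z)) _ _ _
        (hφ.comp measurable_prodMk_left)]

/-- A subsequence of a chain is a chain. -/
theorem map_chainLaw_comp (hQ : IsTransitionSystem I Q) {B' : ℕ → ι} (hB' : Monotone B')
    (hBI' : ∀ i, B' i ∈ I) {κ : ℕ → ℕ} (hκ : Monotone κ) (hκ0 : κ 0 = 0) {m n : ℕ}
    (hκn : ∀ i ≤ m, κ i ≤ n) (hB : ∀ i ≤ m, B' (κ i) = B i) :
    (chainLaw Q B' n).map (fun y => trunc m fun i => y (κ i)) = chainLaw Q B m := by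
  have hκm : Measurable fun (y : ℕ → ℝ) i => y (κ i) :=
    measurable_pi_lambda _ fun i => measurable_pi_apply _
  have := Measure.isProbabilityMeasure_map (μ := chainLaw Q B' n) hκm.aemeasurable
  rw [← map_trunc_eq_chainLaw (M := (chainLaw Q B' n).map fun (y : ℕ → ℝ) i => y (κ i)) m,
    Measure.map_map (measurable_trunc m) hκm]
  · rfl
  · rw [ae_map_iff (p := fun y => y 0 = 0) hκm.aemeasurable
      (measurable_pi_apply 0 (measurableSet_singleton 0))]
    simpa only [hκ0] using chainLaw_zero_apply n
  · intro k hk φ hφ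
    have hg : Measurable fun p : (ℕ → ℝ) × ℝ => ((trunc k fun i => p.1 (κ i)), p.2) :=
      ((measurable_trunc k).comp (hκm.comp measurable_fst)).prodMk measurable_snd
    -- The past of the subsequence up to `k` is a function of the past of the whole chain up to `κ
    -- k`, so the Markov property between `κ k` and `κ (k + 1)` applies.
    have htr : ∀ y : ℕ → ℝ, (trunc k fun i => y (κ i)) = trunc k fun i => trunc (κ k) y (κ i) :=
      fun y => by
        ext i
        by_cases hi : i ≤ k
        · rw [trunc_of_le hi, trunc_of_le hi, trunc_of_le (hκ hi)]
        · simp [trunc, hi]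
    rw [lintegral_map (f := fun y => φ (trunc k y, y (k + 1)))
      (hφ.comp ((measurable_trunc k).prodMk (measurable_pi_apply _))) hκm,
      lintegral_map _ hκm]
    · have key := lintegral_chainLaw_markov hQ hB' hBI' (hκ (Nat.le_succ k)) (hκn (k + 1) hk)
        (hφ.comp hg)
      simp only [Function.comp, ← htr] at key
      rw [key, hB k (by omega), hB (k + 1) hk]
    · have := Measurable.lintegral_kernel_prod_right' (κ := (Q (B k) (B (k + 1))).1.comap
        (fun y : ℕ → ℝ => y k) (measurable_pi_apply k))
        (f := fun q => φ (trunc k q.1, q.2))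
        (hφ.comp (((measurable_trunc k).comp measurable_fst).prodMk measurable_snd))
      simpa [Kernel.comap_apply] using this

/-- The transition from `B k` to `B l` is the identity here, so the Markov property gives
probability zero to the event of a change. This removes increments on empty left neighbourhoods. -/
theorem chainLaw_ae_eq (hQ : IsTransitionSystem I Q) (hB : Monotone B) (hBI : ∀ i, B i ∈ I)
    {k l n : ℕ} (hkl : k ≤ l) (hln : l ≤ n) (h : B k = B l) :
    ∀ᵐ y ∂(chainLaw Q B n), y l = y k := by
  have hs : MeasurableSet {p : (ℕ → ℝ) × ℝ | ¬ p.2 = p.1 k} :=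
    (measurableSet_eq_fun measurable_snd ((measurable_pi_apply k).comp measurable_fst)).compl
  have hm : MeasurableSet {y : ℕ → ℝ | ¬ y l = y k} :=
    (measurableSet_eq_fun (measurable_pi_apply l) (measurable_pi_apply k)).compl
  have h1 := lintegral_chainLaw_markov hQ hB hBI hkl hln (measurable_one.indicator hs)
  rw [ae_iff, ← lintegral_indicator_one hm]
  refine Eq.trans (lintegral_congr fun y => ?_) (h1.trans ?_)
  · simp [indicator, trunc_of_le le_rfl]
  · refine (lintegral_congr fun y => ?_).trans lintegral_zero
    rw [← h, hQ.refl _ (hBI k), lintegral_dirac]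
    simp [indicator, trunc_of_le le_rfl]

end Chain

/-! ### Path kernels -/

section Path

variable {Q : ℝ → ℝ → TransProb} {u : ℕ → ℝ}

instance (k : ℕ) (L : List ℕ) : IsMarkovKernel (pathKernel Q u k L) := by
  induction L generalizing k with
  | nil => rw [pathKernel]; infer_instance
  | cons l L ih => rw [pathKernel]; infer_instance

theorem pathKernel_append (k m : ℕ) (L L' : List ℕ) :
    pathKernel Q u k (L ++ m :: L') = pathKernel Q u m L' ∘ₖ pathKernel Q u k (L ++ [m]) := by
  induction L generalizing k with
  | nil => simp [pathKernel]
  | cons l L ih => simp only [List.cons_append, pathKernel, ih, Kernel.comp_assoc]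

theorem lintegral_pathKernel_cons (k l : ℕ) (L : List ℕ) (y : ℕ → ℝ) {F : (ℕ → ℝ) → ℝ≥0∞}
    (hF : Measurable F) :
    ∫⁻ y', F y' ∂(pathKernel Q u k (l :: L) y) =
      ∫⁻ z, ∫⁻ y', F y' ∂(pathKernel Q u l L (Function.update y l z))
        ∂((Q (u k) (u l)).1 (y k)) := by
  rw [pathKernel, Kernel.lintegral_comp _ _ _ hF, lintegral_stepKernel]
  exact hF.lintegral_kernel

theorem integral_pathKernel_cons (k l : ℕ) (L : List ℕ) (y : ℕ → ℝ) {F : (ℕ → ℝ) → ℝ}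
    (hF : Measurable F) {C : ℝ} (hC : ∀ y, ‖F y‖ ≤ C) :
    ∫ y', F y' ∂(pathKernel Q u k (l :: L) y) =
      ∫ z, ∫ y', F y' ∂(pathKernel Q u l L (Function.update y l z))
        ∂((Q (u k) (u l)).1 (y k)) := by
  have hi : Integrable F ((pathKernel Q u l L ∘ₖ stepKernel (Q (u k) (u l)).1 k l) y) :=
    Integrable.of_bound hF.aestronglyMeasurable C (Eventually.of_forall hC)
  rw [pathKernel, Kernel.integral_comp hi, stepKernel_apply,
    integral_map (measurable_update y).aemeasurable]
  exact (hF.stronglyMeasurable.integral_kernel).aestronglyMeasurable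

/-- Integrals along a path depend on the starting vector only through the coordinates that matter. -/
theorem dependsOn_lintegral_pathKernel (k : ℕ) (L : List ℕ) {F : (ℕ → ℝ) → ℝ≥0∞}
    (hF : Measurable F) {s : Set ℕ} (hk : k ∈ s) (hdep : DependsOn F (s ∪ {l | l ∈ L})) :
    DependsOn (fun y => ∫⁻ y', F y' ∂(pathKernel Q u k L y)) s := by
  induction L generalizing k s with
  | nil =>
    intro y y' h
    simp only [pathKernel, Kernel.id_apply]
    rw [lintegral_dirac' _ hF, lintegral_dirac' _ hF]
    exact hdep (by simpa using h)
  | cons l L ih =>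
    intro y y' h
    simp only [lintegral_pathKernel_cons k l L _ hF]
    rw [h k hk]
    refine lintegral_congr fun z => ?_
    refine ih l (s := insert l s) (mem_insert _ _) ?_ ?_
    · refine fun a b hab => hdep fun i hi => hab i ?_
      rcases hi with hi | hi
      · exact Or.inl (mem_insert_of_mem _ hi)
      · rcases List.mem_cons.1 hi with rfl | hi
        · exact Or.inl (mem_insert _ _)
        · exact Or.inr hi
    · intro i hi
      by_cases hil : i = l
      · subst hil; simp
      · rw [Function.update_of_ne hil, Function.update_of_ne hil]
        exact h i (hi.resolve_left hil)

/-- Along an increasing path, coordinates up to the starting index do not change. -/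
theorem lintegral_pathKernel_of_dependsOn {n : ℕ} (hrefl : ∀ k, 1 ≤ k → k ≤ n →
      Q (u k) (u k) = idTrans) (k : ℕ) (hk1 : 1 ≤ k) (hkn : k ≤ n) (L : List ℕ)
    (hL : L.Pairwise (· ≤ ·)) (hLk : ∀ l ∈ L, k ≤ l ∧ l ≤ n) {F : (ℕ → ℝ) → ℝ≥0∞}
    (hF : Measurable F) (hdep : DependsOn F (Iic k)) (y : ℕ → ℝ) :
    ∫⁻ y', F y' ∂(pathKernel Q u k L y) = F y := by
  induction L generalizing k y with
  | nil => rw [pathKernel, Kernel.id_apply, lintegral_dirac' _ hF]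
  | cons l L ih =>
    have hl := hLk l (by simp)
    have hL' := List.pairwise_cons.1 hL
    rw [lintegral_pathKernel_cons k l L _ hF]
    have h1 : ∀ z, ∫⁻ y', F y' ∂(pathKernel Q u l L (Function.update y l z))
        = F (Function.update y l z) := fun z =>
      ih l (hk1.trans hl.1) hl.2 hL'.2 (fun l' hl' => ⟨hL'.1 l' hl', (hLk l' (by simp [hl'])).2⟩)
        (fun a b hab => hdep fun i hi => hab i (le_trans hi hl.1)) _
    simp_rw [h1]
    -- A repeated index is resampled from its own value by `Q (u k) (u k)`, which is the identity; a
    -- larger index is not seen by `F`.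
    rcases hl.1.eq_or_lt with rfl | hlt
    · rw [hrefl k hk1 hkn]
      simp only [idTrans, Kernel.id_apply]
      rw [lintegral_dirac, Function.update_eq_self]
    · have h2 : ∀ z, F (Function.update y l z) = F y := fun z => hdep fun i hi => by
        rw [Function.update_of_ne]
        have : i ≤ k := hi
        omega
      simp [h2]

theorem pathKernel_ae_eq {n : ℕ} (hrefl : ∀ k, 1 ≤ k → k ≤ n →
      Q (u k) (u k) = idTrans) (k : ℕ) (hk1 : 1 ≤ k) (hkn : k ≤ n) (L : List ℕ)
    (hL : L.Pairwise (· ≤ ·)) (hLk : ∀ l ∈ L, k ≤ l ∧ l ≤ n) (y : ℕ → ℝ) :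
    ∀ᵐ y' ∂(pathKernel Q u k L y), ∀ i ≤ k, y' i = y i := by
  have hm' : MeasurableSet {y' : ℕ → ℝ | ∀ i ≤ k, y' i = y i} := by
    have : {y' : ℕ → ℝ | ∀ i ≤ k, y' i = y i} = ⋂ i ∈ Iic k, {y' | y' i = y i} := by
      ext; simp
    rw [this]
    exact MeasurableSet.biInter (to_countable _) fun i _ =>
      measurable_pi_apply i (measurableSet_singleton _)
  have hm : MeasurableSet {y' : ℕ → ℝ | ¬ ∀ i ≤ k, y' i = y i} := hm'.compl
  rw [ae_iff, ← lintegral_indicator_one hm, lintegral_pathKernel_of_dependsOn hrefl k hk1 hkn L hL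
    hLk (measurable_one.indicator hm)]
  · simp
  · intro a b hab
    have : (∀ i ≤ k, a i = y i) ↔ ∀ i ≤ k, b i = y i :=
      forall₂_congr fun i hi => by rw [hab i hi]
    simp only [indicator, mem_ofPred_eq, this, Pi.one_apply]

end Path

/-! ### Path kernels as conditional laws of the chain. -/

section PathChain

variable {Q : ℝ → ℝ → TransProb} {u : ℕ → ℝ} {ι : Type*} [Preorder ι] {I : Set ι}
  {R : ι → ι → TransProb} {B : ℕ → ι} {n : ℕ}

/-- The path kernels describe the conditional laws of the chain. -/
theorem lintegral_pathKernel_chainLaw (hR : IsTransitionSystem I R) (hB : Monotone B)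
    (hBI : ∀ i, B i ∈ I)
    (hQu : ∀ k l, 1 ≤ k → k ≤ l → l ≤ n → Q (u k) (u l) = R (B k) (B l)) (k : ℕ) (hk1 : 1 ≤ k)
    (L : List ℕ) (hL : L.Pairwise (· ≤ ·)) (hLk : ∀ l ∈ L, k ≤ l ∧ l ≤ n)
    {F : (ℕ → ℝ) × (ℕ → ℝ) → ℝ≥0∞} (hF : Measurable F)
    (hdep : ∀ w, DependsOn (fun y => F (w, y)) (Iic k ∪ {l | l ∈ L})) :
    ∫⁻ y, ∫⁻ y', F (trunc k y, y') ∂(pathKernel Q u k L y) ∂(chainLaw R B n) =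
      ∫⁻ y, F (trunc k y, y) ∂(chainLaw R B n) := by
  induction L generalizing k F with
  | nil =>
    refine lintegral_congr fun y => ?_
    rw [pathKernel, Kernel.id_apply, lintegral_dirac]
  | cons l L ih =>
    have hl := hLk l (by simp)
    have hL' := List.pairwise_cons.1 hL
    have hψ : Measurable fun p : (ℕ → ℝ) × (ℕ → ℝ) =>
        ∫⁻ y', F (p.1, y') ∂(pathKernel Q u l L p.2) := by
      have := Measurable.lintegral_kernel_prod_right' (κ := (pathKernel Q u l L).comap
        (fun p : (ℕ → ℝ) × (ℕ → ℝ) => p.2) measurable_snd) (f := fun q => F (q.1.1, q.2))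
        (hF.comp ((measurable_fst.comp measurable_fst).prodMk measurable_snd))
      simpa [Kernel.comap_apply] using this
    -- The remaining integral as a function of the past up to `k` and the value at `l` alone.
    -- Coordinates strictly between are set to 0 unless they are visited later, which is harmless
    -- because neither the path nor `F` reads them.
    obtain ⟨Ψ, hΨ⟩ : ∃ Ψ : (ℕ → ℝ) × ℝ → ℝ≥0∞, Ψ = fun p : (ℕ → ℝ) × ℝ => ∫⁻ y', F (p.1, y')
        ∂(pathKernel Q u l L (Function.update p.1 l p.2)) := ⟨_, rfl⟩
    have hΨm : Measurable Ψ := hΨ ▸ hψ.comp (measurable_fst.prodMk (measurable_stepMap l))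
    have h1 : ∀ y, ∫⁻ y', F (trunc k y, y') ∂(pathKernel Q u k (l :: L) y) =
        ∫⁻ z, Ψ (trunc k y, z) ∂((R (B k) (B l)).1 (y k)) := fun y => by
      rw [lintegral_pathKernel_cons k l L _ (F := fun y' => F (trunc k y, y'))
        (hF.comp measurable_prodMk_left), hQu k l hk1 hl.1 hl.2]
      refine lintegral_congr fun z => ?_
      rw [hΨ]
      refine dependsOn_lintegral_pathKernel (F := fun y' => F (trunc k y, y')) l L
        (hF.comp measurable_prodMk_left)
        (s := insert l (Iic k)) (mem_insert _ _) ?_ ?_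
      · refine fun a b hab => hdep _ fun i hi => hab i ?_
        rcases hi with hi | hi
        · exact Or.inl (mem_insert_of_mem _ hi)
        · rcases List.mem_cons.1 hi with rfl | hi
          · exact Or.inl (mem_insert _ _)
          · exact Or.inr hi
      · intro i hi
        by_cases hil : i = l
        · subst hil; simp
        · rw [Function.update_of_ne hil, Function.update_of_ne hil]
          exact (trunc_of_le (hi.resolve_left hil) y).symm
    simp_rw [h1]
    rw [← lintegral_chainLaw_markov hR hB hBI hl.1 hl.2 hΨm]
    have h2 : ∀ y, Ψ (trunc k y, y l)
        = ∫⁻ y', F (trunc k (trunc l y), y') ∂(pathKernel Q u l L y) := fun y => by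
      rw [trunc_trunc hl.1, hΨ]
      refine dependsOn_lintegral_pathKernel (F := fun y' => F (trunc k y, y')) l L
        (hF.comp measurable_prodMk_left)
        (s := insert l (Iic k)) (mem_insert _ _) ?_ ?_
      · refine fun a b hab => hdep _ fun i hi => hab i ?_
        rcases hi with hi | hi
        · exact Or.inl (mem_insert_of_mem _ hi)
        · rcases List.mem_cons.1 hi with rfl | hi
          · exact Or.inl (mem_insert _ _)
          · exact Or.inr hi
      · intro i hi
        by_cases hil : i = l
        · subst hil; simp
        · rw [Function.update_of_ne hil]
          exact trunc_of_le (hi.resolve_left hil) y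
    simp_rw [h2]
    rw [ih l (hk1.trans hl.1) hL'.2
      (fun l' hl' => ⟨hL'.1 l' hl', (hLk l' (by simp [hl'])).2⟩)
      (F := fun p => F (trunc k p.1, p.2))
      (hF.comp (((measurable_trunc k).comp measurable_fst).prodMk measurable_snd))]
    · simp_rw [trunc_trunc hl.1]
    · refine fun w a b hab => hdep _ fun i hi => hab i ?_
      rcases hi with hi | hi
      · exact Or.inl (le_trans hi hl.1)
      · rcases List.mem_cons.1 hi with rfl | hi
        · exact Or.inl (mem_Iic.2 le_rfl)
        · exact Or.inr hi

theorem measurable_indicator_pi (s : Set ℕ) :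
    Measurable (fun y : ℕ → ℝ => s.indicator y) :=
  measurable_pi_lambda _ fun i => by
    by_cases h : i ∈ s
    · simpa [indicator_of_mem h] using measurable_pi_apply i
    · simp [indicator_of_notMem h]

/-- Translates expressions `T₁ ⋯ T_m [F](x₁)`, averaged over `x₁`, into expectations under a single
chain law. The weight `c` retains the dependence on the starting value. -/
theorem integral_pathKernel_chainLaw (hR : IsTransitionSystem I R) (hB : Monotone B)
    (hBI : ∀ i, B i ∈ I)
    (hQu : ∀ k l, 1 ≤ k → k ≤ l → l ≤ n → Q (u k) (u l) = R (B k) (B l))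
    (L : List ℕ) (hL : L.Pairwise (· ≤ ·)) (hLk : ∀ l ∈ L, 1 ≤ l ∧ l ≤ n)
    {c : ℝ → ℝ} (hc : Measurable c) {C : ℝ} (hcC : ∀ x, ‖c x‖ ≤ C)
    {F : (ℕ → ℝ) → ℝ} (hF : Measurable F) {C' : ℝ} (hFC : ∀ y, ‖F y‖ ≤ C')
    (hdep : DependsOn F (insert 1 {l | l ∈ L})) :
    ∫ y, c (y 1) * ∫ y', F y' ∂(pathKernel Q u 1 L (fun _ => y 1)) ∂(chainLaw R B n) =
      ∫ y, c (y 1) * F y ∂(chainLaw R B n) := by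
  set s : Set ℕ := insert 1 {l | l ∈ L} with hs
  set ν := chainLaw R B n with hν
  have hconst : Measurable fun (y : ℕ → ℝ) (_ : ℕ) => y 1 :=
    measurable_pi_lambda _ fun _ => measurable_pi_apply 1
  have hind : Measurable fun p : (ℕ → ℝ) × (ℕ → ℝ) => (p.1 1, s.indicator p.2) :=
    ((measurable_pi_apply 1).comp measurable_fst).prodMk
      ((measurable_indicator_pi s).comp measurable_snd)
  have hind' : Measurable fun y : ℕ → ℝ => (y 1, s.indicator y) :=
    (measurable_pi_apply 1).prodMk (measurable_indicator_pi s)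
  have hsi : ∀ y : ℕ → ℝ, F (s.indicator y) = F y := fun y =>
    hdep fun i hi => indicator_of_mem hi y
  let κ : Kernel (ℕ → ℝ) (ℕ → ℝ) := (pathKernel Q u 1 L).comap _ hconst
  -- The kernel starts from a constant vector, which differs from the chain at unvisited
  -- coordinates. The two laws agree once everything outside `s` has been set to 0.
  have hlaw : (ν ⊗ₘ κ).map (fun p => (p.1 1, s.indicator p.2))
      = ν.map fun y => (y 1, s.indicator y) := by
    refine Measure.ext_of_lintegral _ fun φ hφ => ?_
    rw [lintegral_map hφ hind, lintegral_map hφ hind', 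
      Measure.lintegral_compProd (f := fun p : (ℕ → ℝ) × (ℕ → ℝ) => φ (p.1 1, s.indicator p.2))
        (hφ.comp hind)]
    have h1 := lintegral_pathKernel_chainLaw hR hB hBI hQu 1 le_rfl L hL hLk
      (F := fun p => φ (p.1 1, s.indicator p.2)) (hφ.comp hind) fun w a b hab => by
        have : s.indicator a = s.indicator b := by
          ext i
          by_cases hi : i ∈ s
          · rw [indicator_of_mem hi, indicator_of_mem hi]
            refine hab i (hi.imp (fun h => ?_) id)
            exact h.le
          · rw [indicator_of_notMem hi, indicator_of_notMem hi]
        simp only [this]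
    simp only [trunc_of_le le_rfl] at h1
    rw [← h1]
    refine lintegral_congr fun y => ?_
    simp only [κ, Kernel.comap_apply]
    refine dependsOn_lintegral_pathKernel (F := fun y' => φ (y 1, s.indicator y')) 1 L
      ?_ (s := {1}) rfl ?_ (by simp)
    · exact hφ.comp (measurable_const.prodMk (measurable_indicator_pi s))
    · intro a b hab
      have : s.indicator a = s.indicator b := by
        ext i
        by_cases hi : i ∈ s
        · rw [indicator_of_mem hi, indicator_of_mem hi]
          exact hab i hi
        · rw [indicator_of_notMem hi, indicator_of_notMem hi]
      simp only [this]
  have hg : Measurable fun p : ℝ × (ℕ → ℝ) => c p.1 * F p.2 :=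
    (hc.comp measurable_fst).mul (hF.comp measurable_snd)
  have h2 : ∫ p, c p.1 * F p.2 ∂((ν ⊗ₘ κ).map fun p => (p.1 1, s.indicator p.2)) =
      ∫ p, c p.1 * F p.2 ∂(ν.map fun y => (y 1, s.indicator y)) := by rw [hlaw]
  rw [integral_map hind.aemeasurable hg.aestronglyMeasurable,
    integral_map hind'.aemeasurable hg.aestronglyMeasurable, Measure.integral_compProd] at h2
  · simp only [hsi] at h2
    rw [← h2]
    refine integral_congr_ae (Eventually.of_forall fun y => ?_)
    simp only [κ, Kernel.comap_apply]
    rw [integral_const_mul]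
  · refine Integrable.of_bound (hg.comp hind).aestronglyMeasurable (C * C')
      (Eventually.of_forall fun p => ?_)
    rw [norm_mul]
    exact mul_le_mul (hcC _) (hFC _) (norm_nonneg _) ((norm_nonneg _).trans (hcC 0))

end PathChain

/-! ### Products and sums of increments -/

section Increments

/-- Products of bounded measurable functions of the increments. -/
noncomputable def prodFun (h : ℕ → BddMeas) (π : ℕ → ℕ) (i : ℕ) (y : ℕ → ℝ) : ℝ :=
  ∏ j ∈ Finset.Icc 2 (i - 1), h j (y (π j) - y (π j - 1))

theorem measurable_prodFun (h : ℕ → BddMeas) (π : ℕ → ℕ) (i : ℕ) :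
    Measurable (prodFun h π i) :=
  Finset.measurable_prod _ fun j _ =>
    (h j).measurable.comp ((measurable_pi_apply _).sub (measurable_pi_apply _))

theorem norm_prodFun_le (h : ℕ → BddMeas) (π : ℕ → ℕ) (i : ℕ) (y : ℕ → ℝ) :
    ‖prodFun h π i y‖ ≤ ∏ j ∈ Finset.Icc 2 (i - 1), ‖h j‖ := by
  rw [prodFun, norm_prod]
  exact Finset.prod_le_prod (fun _ _ => norm_nonneg _) fun j _ => (h j).abs_le _

theorem measurable_incrSum (π : ℕ → ℕ) (i : ℕ) : Measurable (incrSum π i) :=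
  Finset.measurable_sum _ fun _ _ => (measurable_pi_apply _).sub (measurable_pi_apply _)

/-- The indices that occur in the increments with numbers `2, …, i`. -/
def incrSupport (π : ℕ → ℕ) (i : ℕ) : Set ℕ := {l | ∃ j ∈ Icc 2 i, l = π j - 1 ∨ l = π j}

theorem dependsOn_prodFun (h : ℕ → BddMeas) (π : ℕ → ℕ) (i : ℕ) :
    DependsOn (prodFun h π i) (incrSupport π (i - 1)) := fun a b hab =>
  Finset.prod_congr rfl fun j hj => by
    rw [hab _ ⟨j, Finset.mem_Icc.1 hj, Or.inr rfl⟩, hab _ ⟨j, Finset.mem_Icc.1 hj, Or.inl rfl⟩]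

theorem dependsOn_incrSum (π : ℕ → ℕ) (i : ℕ) :
    DependsOn (incrSum π i) (incrSupport π i) := fun a b hab =>
  Finset.sum_congr rfl fun j hj => by
    rw [hab _ ⟨j, Finset.mem_Icc.1 hj, Or.inr rfl⟩, hab _ ⟨j, Finset.mem_Icc.1 hj, Or.inl rfl⟩]

theorem incrSum_eq (π : ℕ → ℕ) {i : ℕ} (hi : 2 ≤ i) (y : ℕ → ℝ) :
    incrSum π i y = incrSum π (i - 1) y + (y (π i) - y (π i - 1)) := by
  obtain ⟨k, rfl⟩ : ∃ k, i = k + 1 := ⟨i - 1, by omega⟩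
  rw [incrSum, incrSum, Finset.sum_Icc_succ_top hi]
  rfl

/-- No integer lies strictly between `π i - 1` and `π i`, so the other indices can be sorted
separately into those at most `π i - 1` and the larger ones. This supplies the position `p` in the
consistency condition. -/
theorem exists_sorted_split (π : ℕ → ℕ) {i : ℕ} (hi : 2 ≤ i) :
    ∃ lo hi : List ℕ, (lo ++ [π i - 1, π i] ++ hi).Pairwise (· ≤ ·) ∧
      (lo ++ [π i - 1, π i] ++ hi).Perm
        ((List.range' 2 (i - 1)).flatMap fun j => [π j - 1, π j]) ∧
      ∀ l, l ∈ lo ++ hi ↔ l ∈ incrSupport π (i - 1) := by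
  obtain ⟨k, rfl⟩ : ∃ k, i = k + 2 := ⟨i - 2, by omega⟩
  set R : List ℕ := (List.range' 2 k).flatMap fun j => [π j - 1, π j] with hR
  set m := π (k + 2) - 1 with hm
  have hmem : ∀ l, l ∈ R ↔ l ∈ incrSupport π (k + 2 - 1) := fun l => by
    simp only [hR, List.mem_flatMap, List.mem_range'_1, incrSupport, mem_ofPred_eq, mem_Icc,
      List.mem_cons, List.not_mem_nil, or_false]
    refine exists_congr fun j => and_congr_left fun _ => ?_
    omega
  let p : ℕ → Bool := fun l => decide (l ≤ m)
  let lo := (R.filter p).mergeSort (· ≤ ·)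
  let hi := (R.filter (fun l => !p l)).mergeSort (· ≤ ·)
  have hlo : ∀ l ∈ lo, l ≤ m := fun l hl => by
    have := (List.mem_filter.1 ((List.mergeSort_perm _ _).mem_iff.1 hl)).2
    simpa [p] using this
  have hhi : ∀ l ∈ hi, m < l := fun l hl => by
    have := (List.mem_filter.1 ((List.mergeSort_perm _ _).mem_iff.1 hl)).2
    simpa [p] using this
  have hperm : (lo ++ hi).Perm R :=
    ((List.mergeSort_perm _ _).append (List.mergeSort_perm _ _)).trans
      (List.filter_append_perm p R)
  have hslo : lo.Pairwise (· ≤ ·) := by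
    have := List.pairwise_mergeSort (le := fun a b : ℕ => decide (a ≤ b))
      (fun a b c => by simpa using le_trans) (fun a b => by simpa using le_total a b) (R.filter p)
    simpa using this
  have hshi : hi.Pairwise (· ≤ ·) := by
    have := List.pairwise_mergeSort (le := fun a b : ℕ => decide (a ≤ b))
      (fun a b c => by simpa using le_trans) (fun a b => by simpa using le_total a b)
      (R.filter fun l => !p l)
    simpa using this
  refine ⟨lo, hi, ?_, ?_, fun l => by rw [hperm.mem_iff, hmem]⟩
  · rw [List.pairwise_append, List.pairwise_append]
    refine ⟨⟨hslo, by simp [hm], fun a ha b hb => ?_⟩, hshi, fun a ha b hb => ?_⟩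
    · have := hlo a ha
      simp only [List.mem_cons, List.not_mem_nil, or_false] at hb
      omega
    · have := hhi b hb
      simp only [List.mem_append, List.mem_cons, List.not_mem_nil, or_false] at ha
      rcases ha with ha | ha | ha
      · have := hlo a ha; omega
      · omega
      · omega
  · have h1 : (List.range' 2 (k + 2 - 1)) = List.range' 2 k ++ [k + 2] := by
      have : k + 2 - 1 = k + 1 := rfl
      rw [this, List.range'_1_concat, add_comm 2 k]
    rw [h1, List.flatMap_append]
    simp only [List.flatMap_cons, List.flatMap_nil, List.append_nil, ← hR]
    rw [List.append_assoc]
    refine (List.Perm.append_left lo List.perm_append_comm).trans ?_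
    rw [← List.append_assoc]
    exact hperm.append_right _

end Increments

/-! ### Integrating the backward equation -/

section Integrate

variable {a : ℝ} {Q : ℝ → ℝ → TransProb} {D : Submodule ℝ BddMeas} {G : ℝ → D →ₗ[ℝ] BddMeas}

/-- Fubini, with the time integral evaluated by the backward equation. The function `h` is fixed, so
the continuous version `Ψ` of the derivative gives a bounded, jointly measurable integrand. -/
theorem IsGenerator.integral_integral_eq (hG : IsGenerator a Q D G)
    (hQ : IsTransitionSystem (Icc 0 a) Q) {s t : ℝ} (hs : 0 ≤ s) (hst : s ≤ t) (hta : t ≤ a)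
    {h : BddMeas} (hh : h ∈ D) {Ω : Type*} [MeasurableSpace Ω] (m : Measure Ω)
    [IsProbabilityMeasure m] {p g : Ω → ℝ} (hp : Measurable p) {C : ℝ} (hC : ∀ ω, ‖p ω‖ ≤ C)
    (hg : Measurable g) :
    ∫ w in s..t, (∫ ω, p ω * opApply (G w) (transOp (Q w t) h) (g ω) ∂m) =
      ∫ ω, p ω * (transOp (Q s t) h (g ω) - h (g ω)) ∂m := by
  obtain ⟨Ψ, hΨc, hΨ, hint⟩ := hG.exists_continuous hQ (hs.trans hst) hta hh
  have hmΨ : Measurable fun q : ℝ × ℝ => Ψ q.1 q.2 :=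
    measurable_uncurry_of_continuous_of_measurable (u := fun w x => Ψ w x)
      (fun x => (BddMeas.eval x).continuous.comp hΨc) (fun w => (Ψ w).measurable)
  obtain ⟨C', hC'⟩ := (isCompact_Icc (a := s) (b := t)).exists_bound_of_continuousOn
    hΨc.continuousOn
  have h1 : ∫ w in s..t, (∫ ω, p ω * opApply (G w) (transOp (Q w t) h) (g ω) ∂m) =
      ∫ w in s..t, (∫ ω, p ω * Ψ w (g ω) ∂m) := by
    refine intervalIntegral.integral_congr_ae (Eventually.of_forall fun r hr => ?_)
    rw [uIoc_of_le hst] at hr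
    rw [hΨ r ⟨hs.trans_lt hr.1, hr.2⟩]
  have hC0 : ∀ ω, 0 ≤ C := fun ω => (norm_nonneg _).trans (hC ω)
  rw [h1, intervalIntegral.integral_of_le hst, integral_integral_swap]
  · refine integral_congr_ae (Eventually.of_forall fun ω => ?_)
    simp only
    rw [integral_const_mul, ← intervalIntegral.integral_of_le hst, hint s ⟨hs, hst⟩]
  · refine Integrable.of_bound (C := C * C') ?_ ?_
    · exact ((hp.comp measurable_snd).mul (hmΨ.comp
        (measurable_fst.prodMk (hg.comp measurable_snd)))).aestronglyMeasurable
    · have hfst : ∀ᵐ q ∂((volume.restrict (Ioc s t)).prod m), q.1 ∈ Ioc s t :=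
        Measure.quasiMeasurePreserving_fst.ae (ae_restrict_mem measurableSet_Ioc)
      filter_upwards [hfst] with q hq
      change ‖p q.2 * Ψ q.1 (g q.2)‖ ≤ _
      rw [norm_mul]
      exact mul_le_mul (hC _) (((Ψ q.1).abs_le _).trans (hC' _ ⟨hq.1.le, hq.2⟩)) (norm_nonneg _)
        (hC0 q.2)

/-- Here the function acted on varies with `ω`, and no joint bound or measurability comes for free.
The absolute convergence required in the consistency condition justifies Fubini instead. -/
theorem IsGenerator.integral_integral_eq' (hG : IsGenerator a Q D G)
    (hQ : IsTransitionSystem (Icc 0 a) Q) {s t : ℝ} (hs : 0 ≤ s) (hst : s ≤ t) (hta : t ≤ a)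
    {Ω : Type*} [MeasurableSpace Ω] (m : Measure Ω) [IsProbabilityMeasure m] (U : Ω → D)
    (g : Ω → ℝ)
    (hint : Integrable (fun q : ℝ × Ω => opApply (G q.1) (transOp (Q q.1 t) (U q.2).1) (g q.2))
      ((volume.restrict (Icc s t)).prod m)) :
    ∫ v in s..t, (∫ ω, opApply (G v) (transOp (Q v t) (U ω).1) (g ω) ∂m) =
      ∫ ω, (transOp (Q s t) (U ω).1 (g ω) - (U ω).1 (g ω)) ∂m := by
  rw [intervalIntegral.integral_of_le hst, ← integral_Icc_eq_integral_Ioc,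
    integral_integral_swap hint]
  refine integral_congr_ae (Eventually.of_forall fun ω => ?_)
  simp only
  rw [integral_Icc_eq_integral_Ioc, ← intervalIntegral.integral_of_le hst,
    hG.integral_eq hQ hs hst hta (U ω).2]

end Integrate

/-! ### The consistency condition in terms of the chain -/

section Consistency

variable {μ : Measure ℝ} {Qf Qg : ℝ → ℝ → TransProb} {D : Submodule ℝ BddMeas}
  {Gf Gg : ℝ → D →ₗ[ℝ] BddMeas} {n : ℕ} {t u : ℕ → ℝ} {π : ℕ → ℕ}
  {ι : Type*} [Preorder ι] {I : Set ι} {R : ι → ι → TransProb} {B : ℕ → ι} {af ag : ℝ}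

theorem rhsFun_eq (h : ℕ → D) (π : ℕ → ℕ) (i : ℕ) (hi : List ℕ) (y : ℕ → ℝ) :
    rhsFun h π i hi y = prodFun (fun j => (h j).1) π i y * ((h i).1 (y 1 + incrSum π i y) -
      if hi = [] then 0 else (h i).1 (y 1 + incrSum π (i - 1) y)) := by
  classical
  rw [rhsFun]
  split_ifs <;> simp [prodFun, incrProd]

theorem norm_mul_apply_le (h : ℕ → BddMeas) (π : ℕ → ℕ) (i : ℕ) (g : BddMeas) (x : ℝ)
    (y : ℕ → ℝ) :
    ‖prodFun h π i y * g x‖ ≤ (∏ j ∈ Finset.Icc 2 (i - 1), ‖h j‖) * ‖g‖ := by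
  rw [norm_mul]
  exact mul_le_mul (norm_prodFun_le _ _ _ _) (g.abs_le _) (norm_nonneg _)
    (Finset.prod_nonneg fun _ _ => norm_nonneg _)

/-- Integrating both sides of the consistency condition in time leaves differences of path integrals
at the two ends of the interval. Averaging over the starting value with weight `c` turns these into
expectations under the chain along the second ordering, and the terms with `h_i(Y₁ + Σ_{i-1})`
cancel. -/
theorem GeneratorConsistency.integral_eq_of_mem
    (hcons : GeneratorConsistency μ Qf Qg D Gf Gg n t u π)
    (hGf : IsGenerator af Qf D Gf) (hQf : IsTransitionSystem (Icc 0 af) Qf)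
    (hGg : IsGenerator ag Qg D Gg) (hQg : IsTransitionSystem (Icc 0 ag) Qg)
    (ht : ∀ i ≤ n, t i ∈ Icc 0 af) (htm : ∀ i j, i ≤ j → j ≤ n → t i ≤ t j)
    (hu : ∀ i ≤ n, u i ∈ Icc 0 ag) (hum : ∀ i j, i ≤ j → j ≤ n → u i ≤ u j)
    (hR : IsTransitionSystem I R) (hB : Monotone B) (hBI : ∀ i, B i ∈ I)
    (hQu : ∀ k l, 1 ≤ k → k ≤ l → l ≤ n → Qg (u k) (u l) = R (B k) (B l))
    (hlaw : (chainLaw R B n).map (fun y => y 1) = μ.bind (Qf 0 (t 1)).1)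
    (hπ : BijOn π (Icc 1 n) (Icc 1 n)) (hπ1 : π 1 = 1) {i : ℕ} (hi : i ∈ Icc 2 n)
    (c : BddMeas) (h : ℕ → D) :
    ∫ y, c (y 1) * (prodFun (fun j => (h j).1) π i y * (h i).1 (y 1 + incrSum π i y))
        ∂(chainLaw R B n) =
      ∫ y, c (y 1) * (prodFun (fun j => (h j).1) π i y *
        transOp (Qf (t (i - 1)) (t i)) (h i).1 (y 1 + incrSum π (i - 1) y))
        ∂(chainLaw R B n) := by
  obtain ⟨hi2, hin⟩ := hi
  obtain ⟨lo, hi, hsort, hperm, hmem⟩ := exists_sorted_split π hi2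
  obtain ⟨U, hU, hae⟩ := hcons i (Finset.mem_Icc.2 ⟨hi2, hin⟩) lo hi hsort hperm h
  set ν := chainLaw R B n with hν
  set P : (ℕ → ℝ) → ℝ := prodFun (fun j => (h j).1) π i with hP
  set Th := transOp (Qf (t (i - 1)) (t i)) (h i).1 with hTh
  -- bounds on the indices
  have hπ2 : ∀ j ∈ Icc 2 n, 2 ≤ π j ∧ π j ≤ n := fun j hj => by
    have hj1 : j ∈ Icc 1 n := ⟨by have := hj.1; omega, hj.2⟩
    have h1 := hπ.mapsTo hj1
    refine ⟨?_, h1.2⟩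
    have hne : π j ≠ 1 := fun heq => by
      have := hπ.injOn hj1 ⟨le_rfl, by have := hj.1; have := hj.2; omega⟩ (heq.trans hπ1.symm)
      have := hj.1
      omega
    have := h1.1
    omega
  have hπi := hπ2 i ⟨hi2, hin⟩
  have hsupp : ∀ l ∈ lo ++ hi, 1 ≤ l ∧ l ≤ n := fun l hl => by
    obtain ⟨j, hj, hjl⟩ := (hmem l).1 hl
    have := hπ2 j ⟨hj.1, by have := hj.2; omega⟩
    omega
  have hsort' := List.pairwise_append.1 hsort
  have hsort'' := List.pairwise_append.1 hsort'.1
  have hlo_le : ∀ l ∈ lo, l ≤ π i - 1 := fun l hl => hsort''.2.2 l hl _ (by simp)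
  have hhi_ge : ∀ l ∈ hi, π i ≤ l := fun l hl => hsort'.2.2 _ (by simp) l hl
  have hlo1 : ∀ l ∈ lo, 1 ≤ l ∧ l ≤ n := fun l hl => hsupp l (by simp [hl])
  have hhi1 : ∀ l ∈ hi, 1 ≤ l ∧ l ≤ n := fun l hl => hsupp l (by simp [hl])
  have hslohi : (lo ++ hi).Pairwise (· ≤ ·) :=
    List.pairwise_append.2 ⟨hsort''.1, hsort'.2.1, fun a ha b hb =>
      hsort'.2.2 a (by simp [ha]) b hb⟩
  have hslom : (lo ++ [π i - 1]).Pairwise (· ≤ ·) :=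
    List.pairwise_append.2 ⟨hsort''.1, List.pairwise_singleton _ _, fun a ha b hb => by
      rw [List.mem_singleton.1 hb]; exact hlo_le a ha⟩
  have hrefl : ∀ k, 1 ≤ k → k ≤ n → Qg (u k) (u k) = idTrans := fun k hk hkn =>
    hQg.eq_idTrans (hu k hkn)
  -- the integrands and their properties
  set C : ℝ := (∏ j ∈ Finset.Icc 2 (i - 1), ‖(h j).1‖) * ‖Th - (h i).1‖ with hC
  set C₂ : ℝ := (∏ j ∈ Finset.Icc 2 (i - 1), ‖(h j).1‖) * ‖(h i).1‖ with hC₂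
  have hPm : Measurable P := measurable_prodFun _ _ _
  have hsm : ∀ j, Measurable fun y : ℕ → ℝ => y 1 + incrSum π j y := fun j =>
    (measurable_pi_apply 1).add (measurable_incrSum π j)
  have hrm : Measurable (rhsFun h π i hi) := by
    have : rhsFun h π i hi = fun y => P y * ((h i).1 (y 1 + incrSum π i y) -
        if hi = [] then 0 else (h i).1 (y 1 + incrSum π (i - 1) y)) :=
      funext fun y => rhsFun_eq h π i hi y
    rw [this]
    refine hPm.mul (((h i).1.measurable.comp (hsm i)).sub ?_)
    split_ifs
    · exact measurable_const
    · exact (h i).1.measurable.comp (hsm (i - 1))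
  have hrb : ∀ y, ‖rhsFun h π i hi y‖ ≤ C₂ + C₂ := fun y => by
    have hC₂0 : 0 ≤ C₂ := mul_nonneg (Finset.prod_nonneg fun _ _ => norm_nonneg _) (norm_nonneg _)
    rw [rhsFun_eq, mul_sub]
    refine (norm_sub_le _ _).trans (add_le_add (norm_mul_apply_le _ _ _ _ _ _) ?_)
    split_ifs
    · simpa using hC₂0
    · exact norm_mul_apply_le _ _ _ _ _ _
  have hPdep : ∀ a b : ℕ → ℝ, (∀ l ∈ lo ++ hi, a l = b l) → P a = P b := fun a b hab =>
    dependsOn_prodFun _ π i fun l hl => hab l ((hmem l).2 hl)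
  have hSdep : ∀ a b : ℕ → ℝ, (∀ l ∈ lo ++ hi, a l = b l) →
      incrSum π (i - 1) a = incrSum π (i - 1) b := fun a b hab =>
    dependsOn_incrSum π (i - 1) fun l hl => hab l ((hmem l).2 hl)
  -- the inner integral on the right-hand side, started on the diagonal
  set K : (ℕ → ℝ) → ℝ := fun y => if hi = [] then P y * (h i).1 (y 1 + incrSum π (i - 1) y) else 0
    with hK
  have hupd : ∀ (y : ℕ → ℝ) (z : ℝ), ∀ l < π i, Function.update y (π i) z l = y l :=
    fun y z l hl => Function.update_of_ne hl.ne _ _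
  -- On the diagonal the `i`-th increment vanishes, so `Σ_i = Σ_{i-1}`. If `hi` is empty this leaves
  -- the full product; otherwise the subtracted term in `rhsFun` cancels it, since the later path
  -- leaves the coordinates up to `π i` unchanged.
  have hUK : ∀ y, (U y).1 (y (π i - 1)) = K y := fun y => by
    rw [hU]
    simp only [hK]
    split_ifs with hnil
    · subst hnil
      have hlt : ∀ l ∈ lo ++ [], Function.update y (π i) (y (π i - 1)) l = y l := fun l hl => by
        have := hlo_le l (by simpa using hl)
        exact hupd _ _ _ (by omega)
      rw [pathKernel, Kernel.id_apply, integral_dirac, rhsFun_eq, incrSum_eq π hi2,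
        ← hP, hPdep _ _ hlt, hSdep _ _ hlt, Function.update_self, hupd _ _ _ (show 1 < π i by omega),
        hupd _ _ _ (show π i - 1 < π i by omega)]
      simp
    · refine (integral_congr_ae ?_).trans (integral_zero _ _)
      have hpath := pathKernel_ae_eq hrefl (π i) (by omega) hπi.2 hi hsort'.2.1
        (fun l hl => ⟨hhi_ge l hl, (hhi1 l hl).2⟩) (Function.update y (π i) (y (π i - 1)))
      filter_upwards [hpath] with y' hy'
      rw [rhsFun_eq, incrSum_eq π hi2, hy' (π i) le_rfl, hy' (π i - 1) (by omega),
        Function.update_self, hupd _ _ _ (show π i - 1 < π i by omega)]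
      simp [hnil]
  have hKm : Measurable K := by
    simp only [hK]
    split_ifs
    · exact hPm.mul ((h i).1.measurable.comp (hsm (i - 1)))
    · exact measurable_const
  have hKb : ∀ y, ‖K y‖ ≤ C₂ := fun y => by
    have hC₂0 : 0 ≤ C₂ := mul_nonneg (Finset.prod_nonneg fun _ _ => norm_nonneg _) (norm_nonneg _)
    simp only [hK]
    split_ifs
    · exact norm_mul_apply_le _ _ _ _ _ _
    · simpa using hC₂0
  -- the condition for fixed initial value
  have hpoint : ∀ᵐ x ∂(μ.bind (Qf 0 (t 1)).1),
      ∫ y, P y * (Th - (h i).1) (y 1 + incrSum π (i - 1) y)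
        ∂(pathKernel Qg u 1 (lo ++ hi) fun _ => x) =
      ∫ y, rhsFun h π i hi y ∂(pathKernel Qg u 1 (lo ++ (π i - 1) :: π i :: hi) fun _ => x) -
      ∫ y, K y ∂(pathKernel Qg u 1 (lo ++ [π i - 1]) fun _ => x) := by
    filter_upwards [hae] with x hx
    have hL := hGf.integral_integral_eq hQf (ht (i - 1) (by omega)).1 (htm _ _ (by omega) hin)
      (ht i hin).2 (h i).2 (pathKernel Qg u 1 (lo ++ hi) fun _ => x) hPm
      (norm_prodFun_le _ _ _) (hsm (i - 1))
    have hRr := hGg.integral_integral_eq' hQg (hu (π i - 1) (by omega)).1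
      (hum _ _ (by omega) hπi.2) (hu (π i) hπi.2).2 _ U (fun y => y (π i - 1)) hx.1
    have heq := hx.2
    rw [hRr] at heq
    refine (hL.symm.trans heq).trans ?_
    -- Applying the transition from `u (π i - 1)` to `u (π i)` to `U y` prepends the index `π i` to
    -- the path through `hi`.
    have hTU : ∀ y, transOp (Qg (u (π i - 1)) (u (π i))) (U y).1 (y (π i - 1)) =
        ∫ y', rhsFun h π i hi y' ∂(pathKernel Qg u (π i - 1) (π i :: hi) y) := fun y => by
      rw [integral_pathKernel_cons _ _ _ _ hrm hrb, transOp_apply]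
      exact integral_congr_ae (Eventually.of_forall fun z => hU y z)
    simp_rw [hTU, hUK]
    have hI : Integrable (rhsFun h π i hi) ((pathKernel Qg u (π i - 1) (π i :: hi) ∘ₖ
        pathKernel Qg u 1 (lo ++ [π i - 1])) fun _ => x) :=
      Integrable.of_bound hrm.aestronglyMeasurable _ (Eventually.of_forall hrb)
    have hI' : Integrable (fun y => ∫ y', rhsFun h π i hi y'
        ∂(pathKernel Qg u (π i - 1) (π i :: hi) y)) (pathKernel Qg u 1 (lo ++ [π i - 1]) fun _ => x) := by
      refine Integrable.of_bound
        (hrm.stronglyMeasurable.integral_kernel).aestronglyMeasurable (C₂ + C₂)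
        (Eventually.of_forall fun y => ?_)
      have := norm_integral_le_of_norm_le_const
        (μ := pathKernel Qg u (π i - 1) (π i :: hi) y) (Eventually.of_forall hrb)
      simpa using this
    have hI'' : Integrable K (pathKernel Qg u 1 (lo ++ [π i - 1]) fun _ => x) :=
      Integrable.of_bound hKm.aestronglyMeasurable _ (Eventually.of_forall hKb)
    rw [integral_sub hI' hI'', pathKernel_append 1 (π i - 1) lo (π i :: hi), Kernel.integral_comp hI]
  have hpoint' : ∀ᵐ y ∂ν,
      ∫ y', P y' * (Th - (h i).1) (y' 1 + incrSum π (i - 1) y')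
        ∂(pathKernel Qg u 1 (lo ++ hi) fun _ => y 1) =
      ∫ y', rhsFun h π i hi y' ∂(pathKernel Qg u 1 (lo ++ (π i - 1) :: π i :: hi) fun _ => y 1) -
      ∫ y', K y' ∂(pathKernel Qg u 1 (lo ++ [π i - 1]) fun _ => y 1) := by
    rw [← hlaw] at hpoint
    exact ae_of_ae_map (measurable_pi_apply 1).aemeasurable hpoint
  -- integrate over the initial value
  have hF₁m : Measurable fun y => P y * (Th - (h i).1) (y 1 + incrSum π (i - 1) y) :=
    hPm.mul ((Th - (h i).1).measurable.comp (hsm (i - 1)))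
  have e₁ := integral_pathKernel_chainLaw hR hB hBI hQu (lo ++ hi) hslohi hsupp c.measurable
    c.abs_le hF₁m (C' := C) (fun y => norm_mul_apply_le _ _ _ _ _ _) fun a b hab => by
      have h1 : ∀ l ∈ lo ++ hi, a l = b l := fun l hl => hab l (Or.inr hl)
      simp only [hPdep a b h1, hSdep a b h1, hab 1 (Or.inl rfl)]
  have e₂ := integral_pathKernel_chainLaw hR hB hBI hQu (lo ++ (π i - 1) :: π i :: hi)
    (by simpa using hsort) (fun l hl => by
      simp only [List.mem_append, List.mem_cons] at hl
      rcases hl with hl | rfl | rfl | hl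
      · exact hlo1 l hl
      · omega
      · omega
      · exact hhi1 l hl) c.measurable c.abs_le hrm hrb fun a b hab => by
      have h1 : ∀ l ∈ lo ++ hi, a l = b l := fun l hl => hab l (Or.inr (by
        simp only [List.mem_append, List.mem_cons, mem_ofPred_eq] at hl ⊢
        tauto))
      rw [rhsFun_eq, rhsFun_eq, incrSum_eq π hi2, incrSum_eq π hi2, ← hP, hPdep a b h1,
        hSdep a b h1, hab 1 (Or.inl rfl), hab (π i) (Or.inr (by simp)),
        hab (π i - 1) (Or.inr (by simp))]
  have e₃ := integral_pathKernel_chainLaw hR hB hBI hQu (lo ++ [π i - 1]) hslom (fun l hl => by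
      simp only [List.mem_append, List.mem_singleton] at hl
      rcases hl with hl | rfl
      · exact hlo1 l hl
      · omega) c.measurable c.abs_le hKm hKb fun a b hab => by
      simp only [hK]
      split_ifs with hnil
      · have h1 : ∀ l ∈ lo ++ hi, a l = b l := fun l hl => hab l (Or.inr (by
          subst hnil
          simp only [List.append_nil] at hl
          simp [hl]))
        rw [hPdep a b h1, hSdep a b h1, hab 1 (Or.inl rfl)]
      · rfl
  have hint : ∀ (F : (ℕ → ℝ) → ℝ) (C' : ℝ), Measurable F → (∀ y, ‖F y‖ ≤ C') →
      Integrable (fun y => c (y 1) * F y) ν := fun F C' hF hFb => by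
    refine Integrable.of_bound
      ((c.measurable.comp (measurable_pi_apply 1)).mul hF).aestronglyMeasurable (‖c‖ * C')
      (Eventually.of_forall fun y => ?_)
    rw [norm_mul]
    exact mul_le_mul (c.abs_le _) (hFb y) (norm_nonneg _) (norm_nonneg _)
  have hintp : ∀ (L : List ℕ) (F : (ℕ → ℝ) → ℝ) (C' : ℝ), Measurable F → (∀ y, ‖F y‖ ≤ C') →
      Integrable (fun y : ℕ → ℝ => c (y 1) * ∫ y', F y' ∂(pathKernel Qg u 1 L fun _ => y 1)) ν :=
    fun L F C' hF hFb => by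
    refine hint _ C' ?_ fun y => ?_
    · have h1 := (hF.stronglyMeasurable.integral_kernel (κ := pathKernel Qg u 1 L)).measurable
      exact h1.comp (measurable_pi_lambda _ fun _ => measurable_pi_apply 1)
    · have := norm_integral_le_of_norm_le_const
        (μ := pathKernel Qg u 1 L fun _ => y 1) (Eventually.of_forall hFb)
      simpa using this
  have hmain : ∫ y, c (y 1) * (P y * (Th - (h i).1) (y 1 + incrSum π (i - 1) y)) ∂ν =
      ∫ y, c (y 1) * rhsFun h π i hi y ∂ν - ∫ y, c (y 1) * K y ∂ν := by
    rw [← e₁, ← e₂, ← e₃, ← integral_sub (hintp _ _ _ hrm hrb) (hintp _ _ _ hKm hKb)]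
    refine integral_congr_ae ?_
    filter_upwards [hpoint'] with y hy
    rw [hy, mul_sub]
  have hI₁ : Integrable (fun y => c (y 1) * (P y * Th (y 1 + incrSum π (i - 1) y))) ν :=
    hint _ _ (hPm.mul (Th.measurable.comp (hsm (i - 1))))
    (fun y => norm_mul_apply_le (fun j => (h j).1) π i Th _ y)
  have hI₂ : Integrable (fun y => c (y 1) * (P y * (h i).1 (y 1 + incrSum π (i - 1) y))) ν :=
    hint _ _ (hPm.mul ((h i).1.measurable.comp (hsm (i - 1))))
    (fun y => norm_mul_apply_le (fun j => (h j).1) π i (h i).1 _ y)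
  have hI₃ : Integrable (fun y => c (y 1) * (P y * (h i).1 (y 1 + incrSum π i y))) ν :=
    hint _ _ (hPm.mul ((h i).1.measurable.comp (hsm i)))
    (fun y => norm_mul_apply_le (fun j => (h j).1) π i (h i).1 _ y)
  have hleft : ∫ y, c (y 1) * (P y * (Th - (h i).1) (y 1 + incrSum π (i - 1) y)) ∂ν =
      ∫ y, c (y 1) * (P y * Th (y 1 + incrSum π (i - 1) y)) ∂ν -
        ∫ y, c (y 1) * (P y * (h i).1 (y 1 + incrSum π (i - 1) y)) ∂ν := by
    rw [← integral_sub hI₁ hI₂]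
    refine integral_congr_ae (Eventually.of_forall fun y => ?_)
    simp only [BddMeas.sub_apply]
    ring
  -- The term `h_i(Y₁ + Σ_{i-1})` enters through `K` when `hi` is empty and through `rhsFun` when it
  -- is not; the difference is the same in both cases.
  have hright : ∫ y, c (y 1) * rhsFun h π i hi y ∂ν - ∫ y, c (y 1) * K y ∂ν =
      ∫ y, c (y 1) * (P y * (h i).1 (y 1 + incrSum π i y)) ∂ν -
        ∫ y, c (y 1) * (P y * (h i).1 (y 1 + incrSum π (i - 1) y)) ∂ν := by
    rw [← integral_sub (hint _ _ hrm hrb) (hint _ _ hKm hKb), ← integral_sub hI₃ hI₂]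
    refine integral_congr_ae (Eventually.of_forall fun y => ?_)
    simp only [rhsFun_eq, hK, ← hP]
    split_ifs <;> ring
  linarith

end Consistency

/-! ### Approximation by functions in the domain of the generators. -/

section Density

variable {D : Submodule ℝ BddMeas}

theorem exists_tendsto_of_dense (hD : Dense (D : Set BddMeas)) (h : BddMeas) :
    ∃ s : ℕ → D, Tendsto (fun k => (s k).1) atTop (𝓝 h) ∧ ∀ k, ‖(s k).1‖ ≤ ‖h‖ + 1 := by
  have hex : ∀ k : ℕ, ∃ g : D, dist h g.1 < 1 / (k + 1 : ℝ) := fun k => by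
    obtain ⟨g, hg, hgd⟩ := hD.exists_dist_lt h (ε := 1 / (k + 1 : ℝ)) (by positivity)
    exact ⟨⟨g, hg⟩, hgd⟩
  choose s hs using hex
  refine ⟨s, ?_, fun k => ?_⟩
  · rw [tendsto_iff_dist_tendsto_zero]
    refine squeeze_zero (fun _ => dist_nonneg) (fun k => ?_) tendsto_one_div_add_atTop_nhds_zero_nat
    rw [dist_comm]
    exact (hs k).le
  · have h1 : ‖(s k).1 - h‖ ≤ 1 := by
      rw [← dist_eq_norm, dist_comm]
      refine (hs k).le.trans ?_
      rw [div_le_one (by positivity)]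
      simp
    have := norm_add_le h ((s k).1 - h)
    rw [add_sub_cancel] at this
    linarith

/-- All factors converge in norm under uniform bounds, so dominated convergence applies with a
constant majorant. -/
theorem tendsto_integral_prodFun (ν : Measure (ℕ → ℝ)) [IsProbabilityMeasure ν] (c : BddMeas)
    {h : ℕ → BddMeas} {s : ℕ → ℕ → BddMeas} (hs : ∀ j, Tendsto (s j) atTop (𝓝 (h j)))
    (hb : ∀ j k, ‖s j k‖ ≤ ‖h j‖ + 1) (π : ℕ → ℕ) (i : ℕ) {g : BddMeas} {r : ℕ → BddMeas}
    (hr : Tendsto r atTop (𝓝 g)) {C : ℝ} (hrC : ∀ k, ‖r k‖ ≤ C) {z : (ℕ → ℝ) → ℝ}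
    (hz : Measurable z) :
    Tendsto (fun k => ∫ y, c (y 1) * (prodFun (fun j => s j k) π i y * r k (z y)) ∂ν) atTop
      (𝓝 (∫ y, c (y 1) * (prodFun h π i y * g (z y)) ∂ν)) := by
  have hev : ∀ x : ℝ, ∀ {s : ℕ → BddMeas} {h : BddMeas}, Tendsto s atTop (𝓝 h) →
      Tendsto (fun k => s k x) atTop (𝓝 (h x)) := fun x s h hs =>
    ((BddMeas.eval x).continuous.tendsto h).comp hs
  refine tendsto_integral_of_dominated_convergence
    (fun _ => ‖c‖ * ((∏ j ∈ Finset.Icc 2 (i - 1), (‖h j‖ + 1)) * C)) (fun k => ?_)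
    (integrable_const _) (fun k => Eventually.of_forall fun y => ?_)
    (Eventually.of_forall fun y => ?_)
  · exact ((c.measurable.comp (measurable_pi_apply 1)).mul ((measurable_prodFun _ _ _).mul
      ((r k).measurable.comp hz))).aestronglyMeasurable
  · rw [norm_mul]
    refine mul_le_mul (c.abs_le _) ((norm_mul_apply_le _ _ _ _ _ _).trans ?_) (norm_nonneg _)
      (norm_nonneg _)
    refine mul_le_mul (Finset.prod_le_prod (fun _ _ => norm_nonneg _) fun j _ => hb j k) (hrC k)
      (norm_nonneg _) (Finset.prod_nonneg fun _ _ => by positivity)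
  · exact tendsto_const_nhds.mul (Tendsto.mul
      (f := fun k => prodFun (fun j => s j k) π i y)
      (tendsto_finsetProd _ fun j _ => hev (y (π j) - y (π j - 1)) (hs j)) (hev (z y) hr))

end Density

/-! ### From test functions to conditional laws of rearranged increments. -/

section Consistency

variable {μ : Measure ℝ} {Qf Qg : ℝ → ℝ → TransProb} {D : Submodule ℝ BddMeas}
  {Gf Gg : ℝ → D →ₗ[ℝ] BddMeas} {n : ℕ} {t u : ℕ → ℝ} {π : ℕ → ℕ}
  {ι : Type*} [Preorder ι] {I : Set ι} {R : ι → ι → TransProb} {B : ℕ → ι} {af ag : ℝ}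

theorem GeneratorConsistency.integral_eq
    (hcons : GeneratorConsistency μ Qf Qg D Gf Gg n t u π) (hD : Dense (D : Set BddMeas))
    (hGf : IsGenerator af Qf D Gf) (hQf : IsTransitionSystem (Icc 0 af) Qf)
    (hGg : IsGenerator ag Qg D Gg) (hQg : IsTransitionSystem (Icc 0 ag) Qg)
    (ht : ∀ i ≤ n, t i ∈ Icc 0 af) (htm : ∀ i j, i ≤ j → j ≤ n → t i ≤ t j)
    (hu : ∀ i ≤ n, u i ∈ Icc 0 ag) (hum : ∀ i j, i ≤ j → j ≤ n → u i ≤ u j)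
    (hR : IsTransitionSystem I R) (hB : Monotone B) (hBI : ∀ i, B i ∈ I)
    (hQu : ∀ k l, 1 ≤ k → k ≤ l → l ≤ n → Qg (u k) (u l) = R (B k) (B l))
    (hlaw : (chainLaw R B n).map (fun y => y 1) = μ.bind (Qf 0 (t 1)).1)
    (hπ : BijOn π (Icc 1 n) (Icc 1 n)) (hπ1 : π 1 = 1) {i : ℕ} (hi : i ∈ Icc 2 n)
    (c : BddMeas) (h : ℕ → BddMeas) :
    ∫ y, c (y 1) * (prodFun h π i y * h i (y 1 + incrSum π i y)) ∂(chainLaw R B n) =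
      ∫ y, c (y 1) * (prodFun h π i y *
        transOp (Qf (t (i - 1)) (t i)) (h i) (y 1 + incrSum π (i - 1) y)) ∂(chainLaw R B n) := by
  choose s hs hb using fun j => exists_tendsto_of_dense hD (h j)
  have hsm : ∀ j, Measurable fun y : ℕ → ℝ => y 1 + incrSum π j y := fun j =>
    (measurable_pi_apply 1).add (measurable_incrSum π j)
  refine tendsto_nhds_unique
    (tendsto_integral_prodFun (chainLaw R B n) c hs hb π i (hs i) (hb i) (hsm i)) ?_
  refine (tendsto_integral_prodFun (chainLaw R B n) c hs hb π i
    ((continuous_transOp (Qf (t (i - 1)) (t i))).tendsto _ |>.comp (hs i))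
    (fun k => (norm_transOp_le _ _).trans (hb i k)) (hsm (i - 1))).congr fun k => ?_
  exact (hcons.integral_eq_of_mem hGf hQf hGg hQg ht htm hu hum hR hB hBI hQu hlaw hπ hπ1 hi c
    fun j => s j k).symm

/-- The increments with numbers `1, …, k`, preceded by `v`. -/
def incrVec (π : ℕ → ℕ) (k : ℕ) (y : ℕ → ℝ) (v : ℝ) (j : ℕ) : ℝ :=
  if j = 0 then v else if j = 1 then y 1 else if j ≤ k then y (π j) - y (π j - 1) else 0

theorem measurable_incrVec (π : ℕ → ℕ) (k : ℕ) :
    Measurable fun p : (ℕ → ℝ) × ℝ => incrVec π k p.1 p.2 :=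
  measurable_pi_lambda _ fun j => by
    simp only [incrVec]
    have h : ∀ l, Measurable fun p : (ℕ → ℝ) × ℝ => p.1 l := fun l =>
      (measurable_pi_apply l).comp measurable_fst
    split_ifs
    · exact measurable_snd
    · exact h 1
    · exact (h _).sub (h _)
    · exact measurable_const

theorem incrVec_mem_pi {π : ℕ → ℕ} {k : ℕ} {y : ℕ → ℝ} {v : ℝ} {s : ℕ → Set ℝ}
    (hs : ∀ j, k < j → (0 : ℝ) ∈ s j) :
    incrVec π k y v ∈ univ.pi s ↔
      y 1 ∈ s 1 ∧ (∀ j ∈ Finset.Icc 2 k, y (π j) - y (π j - 1) ∈ s j) ∧ v ∈ s 0 := by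
  refine ⟨fun h => ⟨by simpa [incrVec] using h 1 trivial, fun j hj => ?_,
    by simpa [incrVec] using h 0 trivial⟩, fun h j _ => ?_⟩
  · rw [Finset.mem_Icc] at hj
    have := h j trivial
    rwa [incrVec, if_neg (by omega), if_neg (by omega), if_pos hj.2] at this
  · rw [incrVec]
    split_ifs with h0 h1 h2
    · exact h0 ▸ h.2.2
    · exact h1 ▸ h.1
    · exact h.2.1 j (Finset.mem_Icc.2 ⟨by omega, h2⟩)
    · exact hs j (by omega)

theorem indicator_pi_incrVec {π : ℕ → ℕ} {k : ℕ} {y : ℕ → ℝ} {v : ℝ} {s : ℕ → Set ℝ}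
    (hs : ∀ j, k < j → (0 : ℝ) ∈ s j) :
    (univ.pi s).indicator (1 : (ℕ → ℝ) → ℝ) (incrVec π k y v) = (s 1).indicator 1 (y 1) *
      ((∏ j ∈ Finset.Icc 2 k, (s j).indicator 1 (y (π j) - y (π j - 1))) *
        (s 0).indicator 1 v) := by
  classical
  simp only [indicator_apply, Pi.one_apply, Finset.prod_boole, incrVec_mem_pi hs]
  by_cases h1 : y 1 ∈ s 1 <;> by_cases h2 : v ∈ s 0 <;> simp [h1, h2]

/-- With indicators as test functions, the hypothesis says that two laws of the vector of increments
and the next value agree on boxes, a generating π-system. It follows that, given the earlier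
increments, `z'` has conditional law `κ (z)`. -/
theorem measure_eq_of_integral_incrVec (ν : Measure (ℕ → ℝ)) [IsProbabilityMeasure ν]
    (π : ℕ → ℕ) {k : ℕ} (hk : 1 ≤ k) (κ : TransProb) {z z' : (ℕ → ℝ) → ℝ} (hz : Measurable z)
    (hz' : Measurable z')
    (H : ∀ (c : BddMeas) (h : ℕ → BddMeas),
      ∫ y, c (y 1) * (prodFun h π (k + 1) y * h (k + 1) (z' y)) ∂ν =
        ∫ y, c (y 1) * (prodFun h π (k + 1) y * transOp κ (h (k + 1)) (z y)) ∂ν)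
    {F : (ℕ → ℝ) → ℝ≥0∞} (hF : Measurable F) :
    ∫⁻ y, F (incrVec π k y (z' y)) ∂ν = ∫⁻ y, ∫⁻ v, F (incrVec π k y v) ∂(κ.1 (z y)) ∂ν := by
  have hκ := κ.2
  have hm := measurable_incrVec π k
  have hmz : Measurable fun y => incrVec π k y (z' y) := hm.comp (measurable_id.prodMk hz')
  set M₁ := ν.map fun y => incrVec π k y (z' y) with hM₁
  set M₂ := (ν ⊗ₘ κ.1.comap z hz).map fun p => incrVec π k p.1 p.2 with hM₂
  have : IsProbabilityMeasure M₁ := Measure.isProbabilityMeasure_map hmz.aemeasurable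
  have : IsProbabilityMeasure M₂ := Measure.isProbabilityMeasure_map hm.aemeasurable
  have hlin : ∀ F : (ℕ → ℝ) → ℝ≥0∞, Measurable F →
      ∫⁻ w, F w ∂M₂ = ∫⁻ y, ∫⁻ v, F (incrVec π k y v) ∂(κ.1 (z y)) ∂ν := fun F hF => by
    rw [hM₂, lintegral_map hF hm,
      Measure.lintegral_compProd (f := fun p => F (incrVec π k p.1 p.2)) (hF.comp hm)]
    rfl
  have hM : M₁ = M₂ := by
    refine ext_of_generate_finite _ generateFrom_squareCylinders.symm
      (isPiSystem_squareCylinders (fun _ => MeasurableSpace.isPiSystem_measurableSet) (by simp))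
      ?_ (by simp)
    rintro _ ⟨a, s₀, hs₀, rfl⟩
    set s : ℕ → Set ℝ := fun j => if j ∈ a then s₀ j else univ with hs
    have hs' : ∀ j, MeasurableSet (s j) := fun j => by
      simp only [hs]
      split_ifs
      · exact hs₀ j trivial
      · exact MeasurableSet.univ
    have hpi : (a : Set ℕ).pi s₀ = univ.pi s := by
      ext w
      simp only [Set.mem_pi, Finset.mem_coe, mem_univ, true_implies]
      refine forall_congr' fun j => ?_
      by_cases hj : j ∈ a <;> simp [hj, hs]
    rw [hpi]
    have hS : MeasurableSet (univ.pi s) := MeasurableSet.univ_pi hs'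
    -- Coordinates of `incrVec` beyond `k` are 0, so a box that excludes 0 there is null for both
    -- laws.
    by_cases h0 : ∀ j, k < j → (0 : ℝ) ∈ s j
    -- The next value sits in the otherwise free slot 0 of the vector, so the side with index 0 is
    -- assigned to the test function with number `k + 1`.
    · set h : ℕ → BddMeas := fun j =>
        if j = k + 1 then BddMeas.ind _ (hs' 0) else BddMeas.ind _ (hs' j) with hh
      have hprod : ∀ y v, (univ.pi s).indicator (1 : (ℕ → ℝ) → ℝ) (incrVec π k y v) =
          BddMeas.ind _ (hs' 1) (y 1) * (prodFun h π (k + 1) y * h (k + 1) v) := fun y v => by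
        rw [indicator_pi_incrVec h0, prodFun, Nat.add_sub_cancel]
        have h1 : ∀ j ∈ Finset.Icc 2 k, h j (y (π j) - y (π j - 1)) =
            (s j).indicator 1 (y (π j) - y (π j - 1)) := fun j hj => by
          have := (Finset.mem_Icc.1 hj).2
          have h2 : h j = BddMeas.ind _ (hs' j) := if_neg (by omega)
          rw [h2]
          rfl
        rw [Finset.prod_congr rfl h1]
        have h2 : h (k + 1) = BddMeas.ind _ (hs' 0) := if_pos rfl
        rw [h2]
        rfl
      have e := H (BddMeas.ind _ (hs' 1)) h
      simp_rw [transOp_apply, ← integral_const_mul, ← hprod] at e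
      have e₁ : M₁.real (univ.pi s) =
          ∫ y, (univ.pi s).indicator (1 : (ℕ → ℝ) → ℝ) (incrVec π k y (z' y)) ∂ν := by
        rw [← integral_indicator_one hS, hM₁, integral_map hmz.aemeasurable]
        exact (measurable_one.indicator hS).aestronglyMeasurable
      have e₂ : M₂.real (univ.pi s) = ∫ y, ∫ v,
          (univ.pi s).indicator (1 : (ℕ → ℝ) → ℝ) (incrVec π k y v) ∂(κ.1 (z y)) ∂ν := by
        have hi : Integrable (fun p : (ℕ → ℝ) × ℝ =>
            (univ.pi s).indicator (1 : (ℕ → ℝ) → ℝ) (incrVec π k p.1 p.2))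
            (ν ⊗ₘ κ.1.comap z hz) := by
          refine Integrable.of_bound
            ((measurable_one.indicator hS).comp hm).aestronglyMeasurable 1
            (Eventually.of_forall fun p => ?_)
          refine (norm_indicator_le_norm_self _ _).trans ?_
          simp
        rw [← integral_indicator_one hS, hM₂, integral_map hm.aemeasurable
          (measurable_one.indicator hS).aestronglyMeasurable, Measure.integral_compProd hi]
        rfl
      rw [← e₁, ← e₂] at e
      exact (measureReal_eq_measureReal_iff).1 e
    · push Not at h0
      obtain ⟨j, hj, hj0⟩ := h0
      have hnot : ∀ y v, incrVec π k y v ∉ univ.pi s := fun y v hmem => by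
        have := hmem j trivial
        by_cases hj1 : j = 1
        · omega
        · rw [incrVec, if_neg (by omega), if_neg hj1, if_neg (by omega)] at this
          exact hj0 this
      rw [← lintegral_indicator_one hS, ← lintegral_indicator_one hS,
        hlin _ (measurable_one.indicator hS), hM₁,
        lintegral_map (measurable_one.indicator hS) hmz]
      simp [hnot]
  rw [← hlin F hF, ← hM, hM₁, lintegral_map hF hmz]

end Consistency

/-! ### Change of the numbering of a semilattice. -/

section Reordering

variable {T : Type u} [TopologicalSpace T] [CompactSpace T] [Nonempty T] {𝒜 : Set (Set T)}
  {S : ∀ o : ConsistentOrdering 𝒜, ConnectingFlow o} {D : Submodule ℝ BddMeas}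
  {G : ConsistentOrdering 𝒜 → ℝ → D →ₗ[ℝ] BddMeas}
  {Qf : ConsistentOrdering 𝒜 → ℝ → ℝ → TransProb} {μ : Measure ℝ} [IsProbabilityMeasure μ]

/-- The law of the additive process at the left neighbourhoods of a consistent ordering `o`: the
coordinate with index `i` has the law of the value at `o.D i`. -/
noncomputable def orderLaw (S : ∀ o : ConsistentOrdering 𝒜, ConnectingFlow o)
    (Qf : ConsistentOrdering 𝒜 → ℝ → ℝ → TransProb) (μ : Measure ℝ) [IsProbabilityMeasure μ]
    (o : ConsistentOrdering 𝒜) : Measure (ℕ → ℝ) :=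
  chainLaw (setTrans S Qf μ) o.D o.n

instance (o : ConsistentOrdering 𝒜) : IsProbabilityMeasure (orderLaw S Qf μ o) :=
  inferInstanceAs (IsProbabilityMeasure (chainLaw (setTrans S Qf μ) o.D o.n))

/-- The first step leaves from `o.D 0 = ∅`, where the kernel is constant and forgets the starting
value 0. -/
theorem IsMatchingFamily.map_orderLaw_one (H : IsMatchingFamily S D G Qf)
    (o : ConsistentOrdering 𝒜) :
    (orderLaw S Qf μ o).map (fun y => y 1) = flowLaw S Qf μ (o.D 1) := by
  refine Measure.ext_of_lintegral _ fun φ hφ => ?_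
  rw [lintegral_map hφ (measurable_pi_apply 1), orderLaw]
  have h := lintegral_chainLaw_markov (H.isTransitionSystem_setTrans (μ := μ)) o.D_mono
    (o.D_mem_finUnions H.indexing.empty_mem) (Nat.zero_le 1) o.n_pos
    (φ := fun p => φ p.2) (hφ.comp measurable_snd)
  refine h.trans ?_
  simp [setTrans_empty (o.D_nonempty le_rfl), Kernel.const_apply]

/-- The sums of the first increments of `y` in the order given by `π`. -/
noncomputable def permSum (π : ℕ → ℕ) (y : ℕ → ℝ) (i : ℕ) : ℝ :=
  if i = 0 then 0 else y 1 + incrSum π i y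

theorem measurable_permSum (π : ℕ → ℕ) : Measurable (permSum π) :=
  measurable_pi_lambda _ fun i => by
    simp only [permSum]
    split_ifs
    · exact measurable_const
    · exact (measurable_pi_apply 1).add (measurable_incrSum π i)

/-- The values of the partial sums, up to the index `k`, of a sequence of increments. -/
noncomputable def cumulate (k : ℕ) (w : ℕ → ℝ) (i : ℕ) : ℝ :=
  if i = 0 then 0 else if i ≤ k then w 1 + ∑ j ∈ Finset.Icc 2 i, w j else 0

theorem measurable_cumulate (k : ℕ) : Measurable (cumulate k) :=
  measurable_pi_lambda _ fun i => by
    simp only [cumulate]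
    split_ifs
    · exact measurable_const
    · exact (measurable_pi_apply 1).add (Finset.measurable_sum _ fun _ _ => measurable_pi_apply _)
    · exact measurable_const

/-- The past of the rearranged partial sums is a function of the increments, so a conditional law
given the increments is enough for the chain property. -/
theorem cumulate_incrVec (π : ℕ → ℕ) (k : ℕ) (y : ℕ → ℝ) (v : ℝ) :
    cumulate k (incrVec π k y v) = trunc k (permSum π y) := by
  ext i
  by_cases hik : i ≤ k
  · rw [trunc_of_le hik, cumulate, permSum, if_pos hik]
    split_ifs with h0
    · rfl
    · congr 1
      refine Finset.sum_congr rfl fun j hj => ?_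
      rw [Finset.mem_Icc] at hj
      rw [incrVec, if_neg (by omega), if_neg (by omega), if_pos (by omega)]
  · simp [cumulate, trunc, hik]

/-- By `map_trunc_eq_chainLaw` it suffices to identify the one-step transitions of the rearranged
partial sums. From the second step on they are given by the integrated consistency condition; the
first set is common to both orderings. -/
theorem IsMatchingFamily.map_permSum_orderLaw (H : IsMatchingFamily S D G Qf)
    (hcons : Consistency μ S Qf D G) {o o' : ConsistentOrdering 𝒜} (hn : o.n = o'.n) {π : ℕ → ℕ}
    (hπ : BijOn π (Icc 1 o.n) (Icc 1 o.n)) (hπA : ∀ i ∈ Icc 1 o.n, o.A i = o'.A (π i))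
    (hπ1 : π 1 = 1) :
    (orderLaw S Qf μ o').map (fun y => trunc o.n (permSum π y)) = orderLaw S Qf μ o := by
  have hm := measurable_permSum π
  have : IsProbabilityMeasure ((orderLaw S Qf μ o').map (permSum π)) :=
    Measure.isProbabilityMeasure_map hm.aemeasurable
  have hone : (1 : ℕ) ∈ Icc 1 o.n := ⟨le_rfl, o.n_pos⟩
  have hD1 : o.D 1 = o'.D 1 := by rw [o.D_one, o'.D_one, hπA 1 hone, hπ1]
  have hQ := H.isTransitionSystem_setTrans (μ := μ)
  have hgc := hcons o o' π hn fun i hi => ⟨Finset.mem_Icc.2 (hπ.mapsTo (Finset.mem_Icc.1 hi)),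
    hπA i (Finset.mem_Icc.1 hi)⟩
  refine (Measure.map_map (f := permSum π) (measurable_trunc _) hm).symm.trans ?_
  refine map_trunc_eq_chainLaw o.n ?_ fun k hk φ hφ => ?_
  · exact (ae_map_iff hm.aemeasurable (p := fun z : ℕ → ℝ => z 0 = 0)
      (measurable_pi_apply 0 (measurableSet_singleton 0))).2 (Eventually.of_forall fun y => rfl)
  rw [lintegral_map (f := fun z : ℕ → ℝ => φ (trunc k z, z (k + 1)))
    (hφ.comp ((measurable_trunc k).prodMk (measurable_pi_apply _))) hm]
  have := fun B B' : Set T => (setTrans S Qf μ B B').2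
  have hin : Measurable fun z : ℕ → ℝ => ∫⁻ v, φ (trunc k z, v)
      ∂((setTrans S Qf μ (o.D k) (o.D (k + 1))).1 (z k)) := by
    have h1 : Measurable fun p : (ℕ → ℝ) × ℝ => φ (trunc k p.1, p.2) :=
      hφ.comp (((measurable_trunc k).comp measurable_fst).prodMk measurable_snd)
    exact h1.lintegral_kernel_prod_right'
      (κ := (setTrans S Qf μ (o.D k) (o.D (k + 1))).1.comap _ (measurable_pi_apply k))
  rw [lintegral_map hin hm]
  rcases Nat.eq_zero_or_pos k with rfl | hk0
  · have htr : ∀ y, trunc 0 (permSum π y) = 0 := fun y => by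
      ext i
      rcases Nat.eq_zero_or_pos i with rfl | hi
      · simp [trunc, permSum]
      · simp [trunc, hi.ne']
    have h1 : ∀ y, permSum π y (0 + 1) = y 1 := fun y => by simp [permSum, incrSum]
    simp only [htr, h1]
    have h2 := lintegral_map (μ := orderLaw S Qf μ o') (f := fun v : ℝ => φ (0, v))
      (hφ.comp measurable_prodMk_left) (measurable_pi_apply 1)
    rw [← h2, H.map_orderLaw_one, ← hD1]
    simp [setTrans_empty (o.D_nonempty le_rfl), Kernel.const_apply]
  -- A function of the past and the next partial sum, written in terms of the vector of increments
  -- with the next sum in slot 0.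
  · have hF : Measurable fun w : ℕ → ℝ => φ (cumulate k w, w 0) :=
      hφ.comp ((measurable_cumulate k).prodMk (measurable_pi_apply 0))
    have key := measure_eq_of_integral_incrVec (orderLaw S Qf μ o') π hk0
      (setTrans S Qf μ (o.D k) (o.D (k + 1))) (z := fun y => permSum π y k)
      (z' := fun y => permSum π y (k + 1)) ((measurable_pi_apply k).comp hm)
      ((measurable_pi_apply (k + 1)).comp hm) (fun c h => ?_) hF
    · simpa only [cumulate_incrVec, incrVec, if_true] using key
    · have h1 := hgc.integral_eq (i := k + 1) (R := setTrans S Qf μ) (B := o'.D) H.dense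
        (H.isGenerator o) (H.isTransitionSystem o) (H.isGenerator o') (H.isTransitionSystem o')
        (fun i hi => (S o).time_mem hi) (fun i j hij hj => (S o).time_le hij hj)
        (fun i hi => (S o').time_mem (hn ▸ hi)) (fun i j hij hj => (S o').time_le hij (hn ▸ hj))
        hQ o'.D_mono (o'.D_mem_finUnions H.indexing.empty_mem)
        (fun i j hi hij hj => (H.setTrans_D hi hij (hn ▸ hj)).symm) ?_ hπ hπ1
        ⟨by omega, by omega⟩ c h
      · rw [Nat.add_sub_cancel, ← H.setTrans_D (μ := μ) hk0 k.le_succ (by omega), hn] at h1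
        simpa only [permSum, if_neg hk0.ne', if_neg k.succ_ne_zero, orderLaw] using h1
      · rw [hn, ← H.flowLaw_D_one, hD1]
        exact H.map_orderLaw_one o'

end Reordering

namespace ConsistentOrdering

variable {T : Type u} {𝒜 : Set (Set T)} (o : ConsistentOrdering 𝒜)

/-- `C` is a union of left neighbourhoods of `o`. -/
def Resolves (C : Set T) : Prop :=
  C ⊆ o.D o.n ∧ ∀ i ∈ Icc 1 o.n, o.atom i ⊆ C ∨ Disjoint (o.atom i) C

variable {o}

theorem atom_disjoint_D {i j : ℕ} (hij : i < j) : Disjoint (o.atom j) (o.D i) :=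
  disjoint_left.2 fun _ hx hx' => hx.2 (o.D_mono (by omega) hx')

theorem atom_subset_D {i j : ℕ} (hij : i ≤ j) : o.atom i ⊆ o.D j :=
  fun _ hx => o.D_mono hij hx.1

/-! ### Sets that are resolved by an ordering -/

theorem resolves_empty : o.Resolves ∅ := ⟨empty_subset _, fun _ _ => Or.inr (disjoint_empty _)⟩

theorem resolves_of_mem {A : Set T} (hA : A ∈ o.sets) : o.Resolves A := by
  refine ⟨?_, fun i hi => o.atom_subset_or_disjoint hi hA⟩
  obtain ⟨i, hi, rfl⟩ := hA
  exact o.A_subset_D hi.1 hi.2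

theorem Resolves.union {A B : Set T} (hA : o.Resolves A) (hB : o.Resolves B) :
    o.Resolves (A ∪ B) := by
  refine ⟨union_subset hA.1 hB.1, fun i hi => ?_⟩
  rcases hA.2 i hi with h | h
  · exact Or.inl (h.trans subset_union_left)
  · rcases hB.2 i hi with h' | h'
    · exact Or.inl (h'.trans subset_union_right)
    · exact Or.inr (disjoint_union_right.2 ⟨h, h'⟩)

theorem Resolves.diff {A B : Set T} (hA : o.Resolves A) (hB : o.Resolves B) :
    o.Resolves (A \ B) := by
  refine ⟨sdiff_subset.trans hA.1, fun i hi => ?_⟩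
  rcases hA.2 i hi with h | h
  · rcases hB.2 i hi with h' | h'
    · exact Or.inr (disjoint_left.2 fun x hx hx' => hx'.2 (h' hx))
    · exact Or.inl fun x hx => ⟨h hx, disjoint_left.1 h' hx⟩
  · exact Or.inr (h.mono_right sdiff_subset)

theorem resolves_sUnion {𝓕 : Set (Set T)} (hfin : 𝓕.Finite) (h : ∀ C ∈ 𝓕, o.Resolves C) :
    o.Resolves (⋃₀ 𝓕) := by
  induction 𝓕, hfin using Set.Finite.induction_on with
  | empty => simpa using resolves_empty
  | insert _ _ ih =>
    rw [sUnion_insert]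
    exact (h _ (mem_insert _ _)).union (ih fun C hC => h C (mem_insert_of_mem _ hC))

/-- A set of `𝒞(u)` is resolved by every ordering that contains certain finitely many sets. -/
theorem exists_finite_resolves {C : Set T} (hC : C ∈ finUnions (diffs 𝒜)) :
    ∃ 𝓐 : Set (Set T), 𝓐.Finite ∧ 𝓐 ⊆ 𝒜 ∧ ∀ o : ConsistentOrdering 𝒜,
      (∀ A ∈ 𝓐, A.Nonempty → A ∈ o.sets) → o.Resolves C := by
  obtain ⟨𝓕, hfin, hsub, rfl⟩ := hC
  have hex : ∀ C ∈ 𝓕, ∃ 𝓐 : Set (Set T), 𝓐.Finite ∧ 𝓐 ⊆ 𝒜 ∧ ∀ o : ConsistentOrdering 𝒜,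
      (∀ A ∈ 𝓐, A.Nonempty → A ∈ o.sets) → o.Resolves C := fun C hC => by
    obtain ⟨A, hA, B, ⟨𝓑, h𝓑, h𝓑A, rfl⟩, rfl⟩ := hsub hC
    refine ⟨insert A 𝓑, h𝓑.insert A, insert_subset hA h𝓑A, fun o ho => ?_⟩
    have hr : ∀ A' ∈ insert A 𝓑, o.Resolves A' := fun A' hA' => by
      rcases A'.eq_empty_or_nonempty with rfl | hne
      · exact resolves_empty
      · exact resolves_of_mem (ho A' hA' hne)
    exact (hr A (mem_insert _ _)).diff
      (resolves_sUnion h𝓑 fun B hB => hr B (mem_insert_of_mem _ hB))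
  choose! 𝓐 h1 h2 h3 using hex
  refine ⟨⋃ C ∈ 𝓕, 𝓐 C, hfin.biUnion h1, iUnion₂_subset h2, fun o ho => ?_⟩
  exact resolves_sUnion hfin fun C hC => h3 C hC o fun A hA =>
    ho A (mem_iUnion₂.2 ⟨C, hC, hA⟩)

/-! ### The additive set function of a sequence of increments -/

variable [Nonempty T]

/-- The `i`-th left neighbourhood is nonempty and its distinguished point belongs to `C`. -/
def Hits (o : ConsistentOrdering 𝒜) (C : Set T) (i : ℕ) : Prop :=
  (o.atom i).Nonempty ∧ Classical.epsilon (· ∈ o.atom i) ∈ C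

open Classical in
/-- The value at `C` of the additive set function that has the increments of `y` as its values at
the left neighbourhoods of `o`. -/
noncomputable def val (o : ConsistentOrdering 𝒜) (y : ℕ → ℝ) (C : Set T) : ℝ :=
  ∑ i ∈ Finset.range o.n, if o.Hits C (i + 1) then y (i + 1) - y i else 0

theorem epsilon_mem_atom {i : ℕ} (h : (o.atom i).Nonempty) :
    Classical.epsilon (· ∈ o.atom i) ∈ o.atom i := Classical.epsilon_spec h

/-- For a set that contains or misses the whole neighbourhood, the choice of the distinguished point
is irrelevant. -/
theorem hits_iff {C : Set T} {i : ℕ} (h : o.atom i ⊆ C ∨ Disjoint (o.atom i) C) :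
    o.Hits C i ↔ (o.atom i).Nonempty ∧ o.atom i ⊆ C := by
  refine and_congr_right fun hne => ⟨fun hC => ?_, fun hC => hC (epsilon_mem_atom hne)⟩
  exact h.resolve_right fun hd => disjoint_left.1 hd (epsilon_mem_atom hne) hC

theorem not_hits_of_disjoint {C : Set T} {i : ℕ} (h : Disjoint (o.atom i) C) : ¬ o.Hits C i :=
  fun hC => disjoint_left.1 h (epsilon_mem_atom hC.1) hC.2

theorem measurable_val (o : ConsistentOrdering 𝒜) (C : Set T) :
    Measurable fun y : ℕ → ℝ => o.val y C :=
  Finset.measurable_sum _ fun i _ => by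
    split_ifs
    · exact (measurable_pi_apply _).sub (measurable_pi_apply _)
    · exact measurable_const

theorem val_congr {y y' : ℕ → ℝ} {C : Set T} (h : ∀ i ≤ o.n, y i = y' i) :
    o.val y C = o.val y' C :=
  Finset.sum_congr rfl fun i hi => by
    have := Finset.mem_range.1 hi
    rw [h i this.le, h (i + 1) this]

/-- Neighbourhoods beyond `k` are disjoint from `o.D k`. The values at subsets of `o.D k` are
therefore functions of the past of the chain. -/
theorem val_trunc_of_subset {k : ℕ} {C : Set T} (hC : C ⊆ o.D k) (y : ℕ → ℝ) :
    o.val (trunc k y) C = o.val y C :=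
  Finset.sum_congr rfl fun i hi => by
    rcases lt_or_ge k (i + 1) with h | h
    · rw [if_neg (not_hits_of_disjoint ((atom_disjoint_D h).mono_right hC)),
        if_neg (not_hits_of_disjoint ((atom_disjoint_D h).mono_right hC))]
    · rw [trunc_of_le h, trunc_of_le (by omega)]

theorem val_diff (y : ℕ → ℝ) (A B : Set T) : o.val y (A \ B) = o.val y A - o.val y (A ∩ B) := by
  rw [val, val, val, ← Finset.sum_sub_distrib]
  refine Finset.sum_congr rfl fun i _ => ?_
  by_cases h : (o.atom (i + 1)).Nonempty <;>
    by_cases hA : Classical.epsilon (· ∈ o.atom (i + 1)) ∈ A <;>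
    by_cases hB : Classical.epsilon (· ∈ o.atom (i + 1)) ∈ B <;> simp [Hits, h, hA, hB]

theorem val_eq_sum_indicator (y : ℕ → ℝ) (C : Set T) :
    o.val y C = ∑ i ∈ Finset.range o.n, C.indicator
      ({_x | (o.atom (i + 1)).Nonempty}.indicator fun _ => y (i + 1) - y i)
        (Classical.epsilon (· ∈ o.atom (i + 1))) := by
  classical
  refine Finset.sum_congr rfl fun i _ => ?_
  by_cases h : (o.atom (i + 1)).Nonempty <;>
    by_cases hC : Classical.epsilon (· ∈ o.atom (i + 1)) ∈ C <;> simp [Hits, h, hC]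

/-- As a sum of signed point masses at distinguished points, `o.val y` obeys inclusion–exclusion
exactly and for arbitrary sets, resolved or not. -/
theorem val_iUnion (y : ℕ → ℝ) {n : ℕ} (C : Fin n → Set T) :
    o.val y (⋃ i, C i) = inclExcl (fun C y => o.val y C) C y := by
  have h : ⋃ i, C i = ⋃ i ∈ (Finset.univ : Finset (Fin n)), C i := by simp
  simp only [inclExcl, val_eq_sum_indicator, Finset.mul_sum]
  rw [Finset.sum_comm]
  refine Finset.sum_congr rfl fun i _ => ?_
  rw [h, Finset.indicator_biUnion_eq_sum_powerset]
  simp [Finset.powerset_univ]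

theorem exists_resolves [TopologicalSpace T] (h𝒜 : IsIndexingCollection 𝒜) (J : Finset (Set T))
    (hJ : ∀ C ∈ J, C ∈ finUnions (diffs 𝒜)) {B : ℕ → Set T} (hB : Monotone B) (m : ℕ)
    (hBu : ∀ i ≤ m, B i ∈ finUnions 𝒜) :
    ∃ (o : ConsistentOrdering 𝒜) (κ : ℕ → ℕ), (∀ C ∈ J, o.Resolves C) ∧ Monotone κ ∧
      (∀ i, κ i ≤ o.n) ∧ ∀ i ≤ m, o.D (κ i) = B i := by
  choose! 𝓐 h1 h2 h3 using fun C (hC : C ∈ finUnions (diffs 𝒜)) => exists_finite_resolves hC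
  obtain ⟨o, κ, ho, hκ⟩ := h𝒜.exists_ordering (𝓐 := ⋃ C ∈ (J : Set (Set T)), 𝓐 C)
    (J.finite_toSet.biUnion fun C hC => h1 C (hJ C hC))
    (iUnion₂_subset fun C hC => h2 C (hJ C hC)) hB m hBu
  exact ⟨o, κ, fun C hC => h3 C (hJ C hC) o fun A hA =>
    ho A (mem_iUnion₂.2 ⟨C, hC, hA⟩), hκ⟩

/-! ### Comparison of two orderings -/

/-- The neighbourhood with number `i` in `o` has number `π i` in `o'`, and the `i`-th increment of
the rearranged sums is the `π i`-th increment of `y`, so the two sums have the same terms. -/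
theorem val_permSum {o o' : ConsistentOrdering 𝒜} (h : o.sets = o'.sets) {π : ℕ → ℕ}
    (hπ : BijOn π (Icc 1 o.n) (Icc 1 o.n)) (hπA : ∀ i ∈ Icc 1 o.n, o.A i = o'.A (π i))
    (hπ1 : π 1 = 1) (hn : o.n = o'.n) {y : ℕ → ℝ} (hy : y 0 = 0) (C : Set T) :
    o.val (trunc o.n (permSum π y)) C = o'.val y C := by
  rw [val_congr (fun i hi => trunc_of_le hi _), val, val, ← hn]
  have hmem : ∀ i ∈ Finset.range o.n, i + 1 ∈ Icc 1 o.n := fun i hi =>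
    ⟨by omega, Finset.mem_range.1 hi⟩
  refine Finset.sum_bij (fun i _ => π (i + 1) - 1) (fun i hi => ?_) (fun i hi j hj hij => ?_)
    (fun j hj => ?_) fun i hi => ?_
  · have := hπ.mapsTo (hmem i hi)
    have h1 := this.1
    have h2 := this.2
    exact Finset.mem_range.2 (by omega)
  · have h1 := (hπ.mapsTo (hmem i hi)).1
    have h2 := (hπ.mapsTo (hmem j hj)).1
    have := hπ.injOn (hmem i hi) (hmem j hj) (by omega)
    omega
  · obtain ⟨i, hi, hij⟩ := hπ.surjOn (hmem j hj)
    have h1 := hi.1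
    have h2 := hi.2
    refine ⟨i - 1, Finset.mem_range.2 (by omega), ?_⟩
    rw [Nat.sub_add_cancel h1, hij, Nat.add_sub_cancel]
  · have h1 := (hπ.mapsTo (hmem i hi)).1
    have hat : o.atom (i + 1) = o'.atom (π (i + 1)) :=
      atom_congr h (hmem i hi) (hn ▸ hπ.mapsTo (hmem i hi)) (hπA _ (hmem i hi))
    have hhit : o.Hits C (i + 1) ↔ o'.Hits C (π (i + 1) - 1 + 1) := by
      rw [Nat.sub_add_cancel h1, Hits, Hits, hat]
    have hinc : permSum π y (i + 1) - permSum π y i = y (π (i + 1) - 1 + 1) - y (π (i + 1) - 1) := by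
      rw [Nat.sub_add_cancel h1]
      rcases Nat.eq_zero_or_pos i with rfl | hi0
      · simp [permSum, incrSum, hπ1, hy]
      · rw [permSum, permSum, if_neg (by omega), if_neg (by omega), incrSum_eq π (by omega),
          Nat.add_sub_cancel]
        ring
    rw [hinc]
    classical exact if_congr hhit rfl rfl

/-- The neighbourhoods of `p` numbered `κ m + 1, …, κ (m + 1)` lie in the neighbourhood `m + 1` of
`o`, and their increments telescope to its increment. -/
theorem val_refinement {o p : ConsistentOrdering 𝒜} {κ : ℕ → ℕ} (hκ : Monotone κ)
    (hκn : ∀ i, κ i ≤ p.n) (hD : ∀ i ≤ o.n, p.D (κ i) = o.D i) {y : ℕ → ℝ}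
    (hy : ∀ i < p.n, p.D (i + 1) = p.D i → y (i + 1) = y i) {C : Set T} (hC : o.Resolves C) :
    o.val (fun i => y (κ i)) C = p.val y C := by
  have hsub : ∀ m < o.n, ∀ j ∈ Finset.Ico (κ m) (κ (m + 1)), p.atom (j + 1) ⊆ o.atom (m + 1) :=
    fun m hm j hj x hx => by
      rw [Finset.mem_Ico] at hj
      refine ⟨?_, fun hx' => ?_⟩
      · rw [← hD (m + 1) hm]
        exact p.D_mono hj.2 hx.1
      · rw [Nat.add_sub_cancel, ← hD m hm.le] at hx'
        exact hx.2 (p.D_mono (by omega) hx')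
  have key : ∀ m ≤ o.n,
      (∑ i ∈ Finset.range m, open Classical in
        if o.Hits C (i + 1) then y (κ (i + 1)) - y (κ i) else 0) =
      ∑ j ∈ Finset.Ico (κ 0) (κ m), open Classical in
        if p.Hits C (j + 1) then y (j + 1) - y j else 0 := by
    intro m hm
    induction m with
    | zero => simp
    | succ m ih =>
      have hle : κ m ≤ κ (m + 1) := hκ m.le_succ
      rw [Finset.sum_range_succ, ih (by omega),
        ← Finset.sum_Ico_consecutive _ (hκ (Nat.zero_le m)) hle]
      congr 1
      by_cases hh : o.Hits C (m + 1)
      · rw [if_pos hh, ← Finset.sum_Ico_sub y hle]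
        refine Finset.sum_congr rfl fun j hj => ?_
        have hj' := Finset.mem_Ico.1 hj
        have hat := ((hits_iff (hC.2 (m + 1) ⟨by omega, hm⟩)).1 hh).2
        -- An empty neighbourhood has no point to carry its increment; the hypothesis on `y` makes
        -- that increment 0.
        rcases (p.atom (j + 1)).eq_empty_or_nonempty with he | hne
        · have : p.D (j + 1) = p.D j :=
            Subset.antisymm (sdiff_eq_empty.1 he) (p.D_mono j.le_succ)
          rw [hy j (hj'.2.trans_le (hκn _)) this]
          simp
        · rw [if_pos ⟨hne, hat (hsub m hm j hj (epsilon_mem_atom hne))⟩]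
      · rw [if_neg hh]
        refine (Finset.sum_eq_zero fun j hj => if_neg fun hp => hh ?_).symm
        have hmem := hsub m hm j hj (epsilon_mem_atom hp.1)
        have hr := hC.2 (m + 1) ⟨by omega, hm⟩
        refine (hits_iff hr).2 ⟨⟨_, hmem⟩, hr.resolve_right fun hd => ?_⟩
        exact disjoint_left.1 hd hmem hp.2
  have hκ0 : κ 0 = 0 := by
    by_contra hne
    have := p.D_nonempty (Nat.one_le_iff_ne_zero.2 hne)
    rw [hD 0 (Nat.zero_le _), D_zero] at this
    exact this.ne_empty rfl
  -- What remains are the neighbourhoods of `p` outside `o.D o.n`, which a set resolved by `o` does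
  -- not meet.
  rw [val, val, key o.n le_rfl, hκ0, ← Finset.range_eq_Ico,
    ← Finset.sum_range_add_sum_Ico _ (hκn o.n), eq_comm, add_eq_left]
  refine Finset.sum_eq_zero fun j hj => if_neg (not_hits_of_disjoint ?_)
  have hlt : κ o.n < j + 1 := Nat.lt_succ_of_le (Finset.mem_Ico.1 hj).1
  exact (atom_disjoint_D hlt).mono_right (hC.1.trans_eq (hD o.n le_rfl).symm)

/-- The increments up to `k` telescope from `y 0 = 0`, and those on empty neighbourhoods vanish by
hypothesis. -/
theorem val_D {y : ℕ → ℝ} (hy : ∀ i < o.n, o.D (i + 1) = o.D i → y (i + 1) = y i)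
    (hy0 : y 0 = 0) {k : ℕ} (hk : k ≤ o.n) : o.val y (o.D k) = y k := by
  rw [val, ← Finset.sum_range_add_sum_Ico _ hk, Finset.sum_eq_zero (s := Finset.Ico k o.n),
    add_zero]
  · have hsum := Finset.sum_range_sub y k
    rw [hy0, sub_zero] at hsum
    rw [← hsum]
    refine Finset.sum_congr rfl fun j hj => ?_
    have hj' := Finset.mem_range.1 hj
    rcases (o.atom (j + 1)).eq_empty_or_nonempty with he | hne
    · have : o.D (j + 1) = o.D j := Subset.antisymm (sdiff_eq_empty.1 he) (o.D_mono j.le_succ)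
      rw [hy j (by omega) this, sub_self, ite_self]
    · rw [if_pos ⟨hne, atom_subset_D hj' (epsilon_mem_atom hne)⟩]
  · intro j hj
    exact if_neg (not_hits_of_disjoint (atom_disjoint_D (Nat.lt_succ_of_le (Finset.mem_Ico.1 hj).1)))

end ConsistentOrdering

/-! ### Independence of the finite-dimensional laws from the ordering. -/

section Laws

variable {T : Type u} [TopologicalSpace T] {𝒜 : Set (Set T)}
  {S : ∀ o : ConsistentOrdering 𝒜, ConnectingFlow o} {D : Submodule ℝ BddMeas}
  {G : ConsistentOrdering 𝒜 → ℝ → D →ₗ[ℝ] BddMeas}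
  {Qf : ConsistentOrdering 𝒜 → ℝ → ℝ → TransProb} {μ : Measure ℝ} [IsProbabilityMeasure μ]

theorem orderLaw_apply_zero (o : ConsistentOrdering 𝒜) : ∀ᵐ y ∂(orderLaw S Qf μ o), y 0 = 0 :=
  chainLaw_zero_apply _

variable [CompactSpace T] [Nonempty T]

theorem IsMatchingFamily.orderLaw_ae_eq (H : IsMatchingFamily S D G Qf)
    (o : ConsistentOrdering 𝒜) :
    ∀ᵐ y ∂(orderLaw S Qf μ o), ∀ i < o.n, o.D (i + 1) = o.D i → y (i + 1) = y i := by
  rw [ae_all_iff]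
  intro i
  by_cases h : i < o.n ∧ o.D (i + 1) = o.D i
  · filter_upwards [chainLaw_ae_eq (H.isTransitionSystem_setTrans (μ := μ)) o.D_mono
      (o.D_mem_finUnions H.indexing.empty_mem) i.le_succ (Nat.succ_le_of_lt h.1) h.2.symm]
      with y hy _ _ using hy
  · exact Eventually.of_forall fun y h1 h2 => (h ⟨h1, h2⟩).elim

theorem IsMatchingFamily.map_val_eq_of_sets_eq (H : IsMatchingFamily S D G Qf)
    (hcons : Consistency μ S Qf D G) {o o' : ConsistentOrdering 𝒜} (h : o.sets = o'.sets)
    {ι : Type*} (c : ι → Set T) :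
    (orderLaw S Qf μ o).map (fun y i => o.val y (c i)) =
      (orderLaw S Qf μ o').map (fun y i => o'.val y (c i)) := by
  obtain ⟨hn, π, hπ, hπA, hπ1⟩ := ConsistentOrdering.exists_perm h
  have hm : Measurable fun (y : ℕ → ℝ) i => o.val y (c i) :=
    measurable_pi_lambda _ fun i => o.measurable_val (c i)
  rw [← H.map_permSum_orderLaw hcons hn hπ hπA hπ1,
    Measure.map_map (f := fun y => trunc o.n (permSum π y)) hm
      ((measurable_trunc _).comp (measurable_permSum π))]
  refine Measure.map_congr ?_
  filter_upwards [orderLaw_apply_zero o'] with y hy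
  exact funext fun i => ConsistentOrdering.val_permSum h hπ hπA hπ1 hn hy (c i)

/-- The larger semilattice is first renumbered so as to be adapted to the smaller one. The chain of
`o` is then a subsequence of the finer chain, and `val_refinement` compares the values. -/
theorem IsMatchingFamily.map_val_eq_of_sets_subset (H : IsMatchingFamily S D G Qf)
    (hcons : Consistency μ S Qf D G) {o o' : ConsistentOrdering 𝒜} (h : o.sets ⊆ o'.sets)
    {ι : Type*} {c : ι → Set T} (hc : ∀ i, o.Resolves (c i)) :
    (orderLaw S Qf μ o).map (fun y i => o.val y (c i)) =
      (orderLaw S Qf μ o').map (fun y i => o'.val y (c i)) := by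
  obtain ⟨p, κ, hp, hκ, hκn, hD⟩ := ConsistentOrdering.exists_refinement h
  rw [← H.map_val_eq_of_sets_eq hcons hp c]
  have hm : Measurable fun (y : ℕ → ℝ) i => o.val y (c i) :=
    measurable_pi_lambda _ fun i => o.measurable_val (c i)
  have hκ0 : κ 0 = 0 := by
    by_contra hne
    have := p.D_nonempty (Nat.one_le_iff_ne_zero.2 hne)
    rw [hD 0 (Nat.zero_le _), ConsistentOrdering.D_zero] at this
    exact this.ne_empty rfl
  have hκm : Measurable fun y : ℕ → ℝ => trunc o.n fun i => y (κ i) :=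
    (measurable_trunc o.n).comp (measurable_pi_lambda _ fun i => measurable_pi_apply _)
  have h1 : (orderLaw S Qf μ p).map (fun y => trunc o.n fun i => y (κ i)) = orderLaw S Qf μ o :=
    map_chainLaw_comp (H.isTransitionSystem_setTrans (μ := μ)) p.D_mono
      (p.D_mem_finUnions H.indexing.empty_mem) hκ hκ0 (fun i _ => hκn i) hD
  rw [← h1, Measure.map_map hm hκm]
  refine Measure.map_congr ?_
  filter_upwards [H.orderLaw_ae_eq p] with y hy
  refine funext fun i => ?_
  rw [← ConsistentOrdering.val_refinement hκ hκn hD hy (hc i)]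
  exact ConsistentOrdering.val_congr fun j hj => trunc_of_le hj _

/-- The law of the values at sets resolved by an ordering does not depend on the ordering. -/
theorem IsMatchingFamily.map_val_eq (H : IsMatchingFamily S D G Qf)
    (hcons : Consistency μ S Qf D G) (o o' : ConsistentOrdering 𝒜)
    {ι : Type*} {c : ι → Set T} (hc : ∀ i, o.Resolves (c i)) (hc' : ∀ i, o'.Resolves (c i)) :
    (orderLaw S Qf μ o).map (fun y i => o.val y (c i)) =
      (orderLaw S Qf μ o').map (fun y i => o'.val y (c i)) := by
  -- Both orderings are compared with one ordering of a semilattice containing all their sets.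
  obtain ⟨p, -, hp, -⟩ := H.indexing.exists_ordering (𝓐 := o.sets ∪ o'.sets)
    (o.sets_finite.union o'.sets_finite) (union_subset o.sets_subset o'.sets_subset)
    (B := fun _ => ∅) monotone_const 0 fun _ _ => empty_mem_finUnions 𝒜
  rw [H.map_val_eq_of_sets_subset hcons
      (fun A hA => hp A (Or.inl hA) (o.nonempty_of_mem_sets hA)) hc,
    H.map_val_eq_of_sets_subset hcons
      (fun A hA => hp A (Or.inr hA) (o'.nonempty_of_mem_sets hA)) hc']

end Laws

/-! ### Inclusions and intersections for the classes generated by `𝒜`. -/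

section Sets

variable {T : Type u} {𝒜 : Set (Set T)}

theorem mem_diffs_of_mem {A : Set T} (hA : A ∈ 𝒜) : A ∈ diffs 𝒜 :=
  ⟨A, hA, ∅, empty_mem_finUnions _, sdiff_empty.symm⟩

theorem finUnions_subset_finUnions_diffs {B : Set T} (hB : B ∈ finUnions 𝒜) :
    B ∈ finUnions (diffs 𝒜) := by
  obtain ⟨F, hF, hFB, rfl⟩ := hB
  exact ⟨F, hF, fun A hA => mem_diffs_of_mem (hFB hA), rfl⟩

theorem IsIndexingCollection.inter_mem_diffs [TopologicalSpace T]
    (h𝒜 : IsIndexingCollection 𝒜) {C C' : Set T}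
    (hC : C ∈ diffs 𝒜) (hC' : C' ∈ diffs 𝒜) : C ∩ C' ∈ diffs 𝒜 := by
  obtain ⟨A, hA, B, hB, rfl⟩ := hC
  obtain ⟨A', hA', B', hB', rfl⟩ := hC'
  refine ⟨A ∩ A', h𝒜.inter_mem hA hA', B ∪ B', union_mem_finUnions hB hB', ?_⟩
  ext x
  simp only [mem_inter_iff, Set.mem_sdiff, mem_union]
  tauto

theorem biInter_mem_of_inter_mem {𝓑 : Set (Set T)} (h : ∀ A ∈ 𝓑, ∀ B ∈ 𝓑, A ∩ B ∈ 𝓑)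
    {ι : Type*} {K : Finset ι} (hK : K.Nonempty) {C : ι → Set T} (hC : ∀ i ∈ K, C i ∈ 𝓑) :
    ⋂ i ∈ K, C i ∈ 𝓑 := by
  classical
  induction hK using Finset.Nonempty.cons_induction with
  | singleton i => simpa using hC i
  | cons i K hi hK ih =>
    rw [Finset.cons_eq_insert, Finset.set_biInter_insert]
    exact h _ (hC i (by simp)) _ (ih fun j hj => hC j (by simp [hj]))

end Sets

/-! ### Additivity and the Markov transition from finite-dimensional laws. -/

section FiniteDimensional

variable {T : Type u} [TopologicalSpace T] [Nonempty T] {𝒜 : Set (Set T)}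
  {S : ∀ o : ConsistentOrdering 𝒜, ConnectingFlow o} {D : Submodule ℝ BddMeas}
  {G : ConsistentOrdering 𝒜 → ℝ → D →ₗ[ℝ] BddMeas}
  {Qf : ConsistentOrdering 𝒜 → ℝ → ℝ → TransProb} {μ : Measure ℝ} [IsProbabilityMeasure μ]
  {Ω : Type*} [MeasurableSpace Ω] {P : Measure Ω} {X : Set T → Ω → ℝ}

/-- The finite-dimensional distributions of `X` on `𝒞(u)` are those of the additive set functions
of the chains along consistent orderings. -/
structure HasOrderLaws (S : ∀ o : ConsistentOrdering 𝒜, ConnectingFlow o)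
    (Qf : ConsistentOrdering 𝒜 → ℝ → ℝ → TransProb) (μ : Measure ℝ) [IsProbabilityMeasure μ]
    (P : Measure Ω) (X : Set T → Ω → ℝ) : Prop where
  measurable : ∀ C, Measurable (X C)
  map_eq : ∀ J : Finset (Set T), (∀ C ∈ J, C ∈ finUnions (diffs 𝒜)) →
    ∀ o : ConsistentOrdering 𝒜, (∀ C ∈ J, o.Resolves C) →
      P.map (fun ω (C : J) => X C ω) = (orderLaw S Qf μ o).map (fun y (C : J) => o.val y C)

theorem HasOrderLaws.lintegral_eq (hX : HasOrderLaws S Qf μ P X) (J : Finset (Set T))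
    (hJ : ∀ C ∈ J, C ∈ finUnions (diffs 𝒜)) (o : ConsistentOrdering 𝒜)
    (ho : ∀ C ∈ J, o.Resolves C) {F : (Set T → ℝ) → ℝ≥0∞} (hF : Measurable F)
    (hdep : DependsOn F (J : Set (Set T))) :
    ∫⁻ ω, F (fun C => X C ω) ∂P = ∫⁻ y, F (o.val y) ∂(orderLaw S Qf μ o) := by
  classical
  set e : (J → ℝ) → Set T → ℝ := fun w C => if h : C ∈ J then w ⟨C, h⟩ else 0 with he
  have hem : Measurable e := measurable_pi_lambda _ fun C => by
    simp only [he]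
    split_ifs
    · exact measurable_pi_apply _
    · exact measurable_const
  have hFe : ∀ v : Set T → ℝ, F v = F (e fun C : J => v C) := fun v => hdep fun C hC => by
    simp [he, Finset.mem_coe.1 hC]
  have h1 := lintegral_map (μ := P) (hF.comp hem)
    (measurable_pi_lambda (fun ω (C : J) => X C ω) fun C => hX.measurable _)
  have h2 := lintegral_map (μ := orderLaw S Qf μ o) (hF.comp hem)
    (measurable_pi_lambda (fun y (C : J) => o.val y C) fun C => o.measurable_val C)
  simp only [Function.comp_apply] at h1 h2
  rw [lintegral_congr fun ω => hFe fun C => X C ω, lintegral_congr fun y => hFe (o.val y), ← h1,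
    ← h2, hX.map_eq J hJ o ho]

/-- A relation between finitely many values that holds for every deterministic `o.val y` holds
almost surely for X, because the joint laws agree. -/
theorem HasOrderLaws.ae_of_forall (h𝒜 : IsIndexingCollection 𝒜) (hX : HasOrderLaws S Qf μ P X)
    (J : Finset (Set T)) (hJ : ∀ C ∈ J, C ∈ finUnions (diffs 𝒜)) {s : Set (Set T → ℝ)}
    (hs : MeasurableSet s) (hdep : DependsOn (fun v => v ∈ s) (J : Set (Set T)))
    (H : ∀ (o : ConsistentOrdering 𝒜) y, o.val y ∈ s) : ∀ᵐ ω ∂P, (fun C => X C ω) ∈ s := by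
  obtain ⟨o, -, ho, -⟩ := ConsistentOrdering.exists_resolves h𝒜 J hJ (B := fun _ => ∅)
    monotone_const 0 fun _ _ => empty_mem_finUnions 𝒜
  have h1 := hX.lintegral_eq J hJ o ho (F := sᶜ.indicator 1) (measurable_one.indicator hs.compl)
    fun v w hvw => by
      have : (v ∈ s) = (w ∈ s) := hdep hvw
      classical
      simp only [indicator_apply, mem_compl_iff, this]
      rfl
  have h2 : ∀ y, sᶜ.indicator (1 : (Set T → ℝ) → ℝ≥0∞) (o.val y) = 0 := fun y =>
    indicator_of_notMem (notMem_compl_iff.2 (H o y)) _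
  have hXm : Measurable fun ω C => X C ω := measurable_pi_lambda _ hX.measurable
  simp only [h2, lintegral_zero] at h1
  rw [lintegral_eq_zero_iff (f := fun ω => sᶜ.indicator 1 fun C => X C ω)
    ((measurable_one.indicator hs.compl).comp hXm)] at h1
  filter_upwards [h1] with ω hω
  by_contra hnot
  have : sᶜ.indicator (1 : (Set T → ℝ) → ℝ≥0∞) (fun C => X C ω) = 1 :=
    indicator_of_mem (mem_compl hnot) _
  exact one_ne_zero (this.symm.trans hω)

theorem HasOrderLaws.iUnion_ae_eq (h𝒜 : IsIndexingCollection 𝒜) (hX : HasOrderLaws S Qf μ P X)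
    {n : ℕ} {C : Fin n → Set T} (hC : ∀ i, C i ∈ diffs 𝒜) :
    X (⋃ i, C i) =ᵐ[P] inclExcl X C := by
  classical
  set J : Finset (Set T) := insert (⋃ i, C i)
    ((Finset.univ.filter fun K : Finset (Fin n) => K.Nonempty).image fun K => ⋂ i ∈ K, C i) with hJ
  have hJU : ⋃ i, C i ∈ J := Finset.mem_insert_self _ _
  have hJI : ∀ K : Finset (Fin n), K.Nonempty → ⋂ i ∈ K, C i ∈ J := fun K hK =>
    Finset.mem_insert_of_mem (Finset.mem_image.2 ⟨K, by simpa using hK, rfl⟩)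
  have hm : MeasurableSet {v : Set T → ℝ | v (⋃ i, C i) =
      ∑ K : Finset (Fin n) with K.Nonempty, (-1) ^ (K.card + 1) * v (⋂ i ∈ K, C i)} :=
    measurableSet_eq_fun (measurable_pi_apply _)
      (Finset.measurable_sum _ fun K _ => (measurable_pi_apply _).const_mul _)
  refine hX.ae_of_forall h𝒜 J (fun B hB => ?_) hm (fun v w hvw => ?_) fun o y => ?_
  · rcases Finset.mem_insert.1 hB with rfl | hB
    · exact iUnion_mem_finUnions hC
    · obtain ⟨K, hK, rfl⟩ := Finset.mem_image.1 hB
      exact mem_finUnions_of_mem (biInter_mem_of_inter_mem (fun _ h1 _ h2 =>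
        h𝒜.inter_mem_diffs h1 h2) (by simpa using hK) fun i _ => hC i)
  · have h1 : (∑ K : Finset (Fin n) with K.Nonempty, (-1) ^ (K.card + 1) * v (⋂ i ∈ K, C i)) =
        ∑ K : Finset (Fin n) with K.Nonempty, (-1) ^ (K.card + 1) * w (⋂ i ∈ K, C i) :=
      Finset.sum_congr rfl fun K hK => by rw [hvw _ (hJI K (by simpa using hK))]
    simp only [mem_ofPred_eq, h1, hvw _ hJU]
  · exact ConsistentOrdering.val_iUnion y C

theorem HasOrderLaws.isAdditiveProcess (h𝒜 : IsIndexingCollection 𝒜)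
    (hX : HasOrderLaws S Qf μ P X) : IsAdditiveProcess 𝒜 P X where
  measurable C _ := hX.measurable C
  union n A hA := hX.iUnion_ae_eq h𝒜 fun i => mem_diffs_of_mem (hA i)
  union_diffs n C hC := hX.iUnion_ae_eq h𝒜 hC
  diff A hA B hB := by
    classical
    have hm : MeasurableSet {v : Set T → ℝ | v (A \ B) = v A - v (A ∩ B)} :=
      measurableSet_eq_fun (measurable_pi_apply _)
        ((measurable_pi_apply A).sub (measurable_pi_apply (A ∩ B)))
    refine hX.ae_of_forall h𝒜 {A \ B, A, A ∩ B} (fun C hC => ?_) hm (fun v w hvw => ?_)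
      fun o y => ConsistentOrdering.val_diff y A B
    · simp only [Finset.mem_insert, Finset.mem_singleton] at hC
      rcases hC with rfl | rfl | rfl
      · exact mem_finUnions_of_mem ⟨A, hA, B, hB, rfl⟩
      · exact mem_finUnions_of_mem (mem_diffs_of_mem hA)
      · exact finUnions_subset_finUnions_diffs (h𝒜.inter_mem_finUnions hA hB)
    · simp only [mem_ofPred_eq, hvw (A \ B) (by simp), hvw A (by simp), hvw (A ∩ B) (by simp)]

/-- The transition from `B` to `B'`, given finitely many values at sets of `𝒜` contained in `B`. -/
theorem HasOrderLaws.measure_inter_eq [CompactSpace T] (H : IsMatchingFamily S D G Qf)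
    (hX : HasOrderLaws S Qf μ P X) {B B' : Set T} (hB : B ∈ finUnions 𝒜) (hB' : B' ∈ finUnions 𝒜)
    (hBB' : B ⊆ B') (t : Finset (Set T)) (ht : ∀ A ∈ t, A ∈ 𝒜 ∧ A ⊆ B) {E : Set T → Set ℝ}
    (hE : ∀ A ∈ t, MeasurableSet (E A)) {Γ : Set ℝ} (hΓ : MeasurableSet Γ) :
    P ((⋂ A ∈ t, X A ⁻¹' E A) ∩ X B' ⁻¹' Γ) =
      ∫⁻ ω in ⋂ A ∈ t, X A ⁻¹' E A, (setTrans S Qf μ B B').1 (X B ω) Γ ∂P := by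
  classical
  set J : Finset (Set T) := insert B (insert B' t) with hJ
  have hJu : ∀ C ∈ J, C ∈ finUnions (diffs 𝒜) := fun C hC => by
    simp only [hJ, Finset.mem_insert] at hC
    rcases hC with rfl | rfl | hC
    · exact finUnions_subset_finUnions_diffs hB
    · exact finUnions_subset_finUnions_diffs hB'
    · exact mem_finUnions_of_mem (mem_diffs_of_mem (ht C hC).1)
  -- One ordering resolves all the sets concerned and has `B` and `B'` among its unions, so that the
  -- process at `B` and `B'` is the chain at the times `κ 0` and `κ 1`.
  obtain ⟨o, κ, ho, hκ, hκn, hD⟩ := ConsistentOrdering.exists_resolves H.indexing J hJu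
    (B := fun i => if i = 0 then B else B')
    (monotone_nat_of_le_succ fun i => by
      rcases Nat.eq_zero_or_pos i with rfl | hi
      · simpa using hBB'
      · simp [hi.ne']) 1 fun i _ => by
        split_ifs <;> assumption
  have hD0 : o.D (κ 0) = B := by simpa using hD 0 (Nat.zero_le _)
  have hD1 : o.D (κ 1) = B' := by simpa using hD 1 le_rfl
  set M : Set (Set T → ℝ) := {v | ∀ A ∈ t, v A ∈ E A} with hM
  have hMm : MeasurableSet M := by
    have : M = ⋂ A ∈ t, {v | v A ∈ E A} := by ext; simp [hM]
    rw [this]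
    exact Finset.measurableSet_biInter _ fun A hA => measurable_pi_apply A (hE A hA)
  have hXm : Measurable fun ω C => X C ω := measurable_pi_lambda _ hX.measurable
  have hpre : (⋂ A ∈ t, X A ⁻¹' E A) = (fun ω C => X C ω) ⁻¹' M := by
    ext ω
    simp [hM]
  have hQm : Measurable fun x => (setTrans S Qf μ B B').1 x Γ := Kernel.measurable_coe _ hΓ
  set F₁ : (Set T → ℝ) → ℝ≥0∞ := fun v => M.indicator 1 v * Γ.indicator 1 (v B') with hF₁
  set F₂ : (Set T → ℝ) → ℝ≥0∞ := fun v =>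
    M.indicator 1 v * (setTrans S Qf μ B B').1 (v B) Γ with hF₂
  have hF₁m : Measurable F₁ := (measurable_one.indicator hMm).mul
    ((measurable_one.indicator hΓ).comp (measurable_pi_apply _))
  have hF₂m : Measurable F₂ := (measurable_one.indicator hMm).mul
    (hQm.comp (measurable_pi_apply _))
  have hMdep : ∀ v w : Set T → ℝ, (∀ C ∈ (J : Set (Set T)), v C = w C) →
      M.indicator (1 : (Set T → ℝ) → ℝ≥0∞) v = M.indicator 1 w := fun v w hvw => by
    have : v ∈ M ↔ w ∈ M := forall₂_congr fun A hA => by rw [hvw A (by simp [hJ, hA])]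
    simp only [indicator_apply, this, Pi.one_apply]
  have e₁ := hX.lintegral_eq J hJu o ho hF₁m fun v w hvw => by
    simp only [hF₁, hMdep v w hvw, hvw B' (by simp [hJ])]
  have e₂ := hX.lintegral_eq J hJu o ho hF₂m fun v w hvw => by
    simp only [hF₂, hMdep v w hvw, hvw B (by simp [hJ])]
  have l₁ : P ((⋂ A ∈ t, X A ⁻¹' E A) ∩ X B' ⁻¹' Γ) = ∫⁻ ω, F₁ (fun C => X C ω) ∂P := by
    rw [← lintegral_indicator_one ((hpre ▸ hXm hMm).inter (hX.measurable B' hΓ)), hpre]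
    refine lintegral_congr fun ω => ?_
    simp only [hF₁]
    rw [inter_indicator_one]
    rfl
  have l₂ : ∫⁻ ω in ⋂ A ∈ t, X A ⁻¹' E A, (setTrans S Qf μ B B').1 (X B ω) Γ ∂P =
      ∫⁻ ω, F₂ (fun C => X C ω) ∂P := by
    rw [hpre, ← lintegral_indicator (hXm hMm)]
    refine lintegral_congr fun ω => ?_
    by_cases h : (fun C => X C ω) ∈ M
    · rw [indicator_of_mem (show ω ∈ (fun ω C => X C ω) ⁻¹' M from h)]
      simp [hF₂, h]
    · rw [indicator_of_notMem (show ω ∉ (fun ω C => X C ω) ⁻¹' M from h)]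
      simp [hF₂, h]
  rw [l₁, l₂, e₁, e₂]
  have hvalm : Measurable fun y : ℕ → ℝ => o.val y :=
    measurable_pi_lambda _ fun C => o.measurable_val C
  -- The sets of `t` lie in `B`, so the conditioning event is a function of the chain up to time `κ
  -- 0`.
  have hMtr : ∀ y, M.indicator (1 : (Set T → ℝ) → ℝ≥0∞) (o.val y) =
      M.indicator 1 (o.val (trunc (κ 0) y)) := fun y => by
    have : o.val y ∈ M ↔ o.val (trunc (κ 0) y) ∈ M := forall₂_congr fun A hA => by
      rw [ConsistentOrdering.val_trunc_of_subset ((ht A hA).2.trans_eq hD0.symm)]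
    simp only [indicator_apply, this, Pi.one_apply]
  have hmk := lintegral_chainLaw_markov (H.isTransitionSystem_setTrans (μ := μ)) o.D_mono
    (o.D_mem_finUnions H.indexing.empty_mem) (hκ (Nat.zero_le 1)) (hκn 1)
    (φ := fun p => M.indicator 1 (o.val p.1) * Γ.indicator 1 p.2)
    (((measurable_one.indicator hMm).comp (hvalm.comp measurable_fst)).mul
      ((measurable_one.indicator hΓ).comp measurable_snd))
  have hval : ∀ᵐ y ∂(orderLaw S Qf μ o), o.val y B = y (κ 0) ∧ o.val y B' = y (κ 1) := by
    filter_upwards [H.orderLaw_ae_eq o, orderLaw_apply_zero o] with y hy hy0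
    exact ⟨hD0 ▸ ConsistentOrdering.val_D hy hy0 (hκn 0),
      hD1 ▸ ConsistentOrdering.val_D hy hy0 (hκn 1)⟩
  refine (lintegral_congr_ae ?_).trans (hmk.trans (lintegral_congr_ae ?_))
  · filter_upwards [hval] with y hy
    simp only [hF₁, hMtr y, hy.2]
  · filter_upwards [hval] with y hy
    simp only [hF₂, hMtr y, hy.1]
    rw [lintegral_const_mul _ (measurable_one.indicator hΓ), lintegral_indicator_one hΓ, hD0, hD1]

end FiniteDimensional

/-! ### Kolmogorov extension -/

/-- A diagonal compactness argument in a product space: points whose restrictions lie eventually in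
given compact sets have a limit point with the same property. -/
theorem exists_restrict_mem_of_isCompact {ι : Type*} (J : ℕ → Finset ι)
    (K : ∀ n, Set (J n → ℝ)) (hK : ∀ n, IsCompact (K n)) (x : ℕ → ι → ℝ)
    (hx : ∀ n, ∀ k ≤ n, (J k).restrict (x n) ∈ K k) :
    ∃ y : ι → ℝ, ∀ k, (J k).restrict y ∈ K k := by
  classical
  have hU : (hyperfilter ℕ : Filter ℕ) ≤ atTop := Nat.hyperfilter_le_atTop
  have hz : ∀ k, ∃ z ∈ K k, Tendsto (fun n => (J k).restrict (x n)) (hyperfilter ℕ) (𝓝 z) := by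
    intro k
    have h1 : ∀ᶠ n in (hyperfilter ℕ : Filter ℕ), (J k).restrict (x n) ∈ K k :=
      hU ((eventually_ge_atTop k).mono fun n hn => hx n k hn)
    obtain ⟨z, hz, hz'⟩ := (hK k).ultrafilter_le_nhds
      ((hyperfilter ℕ).map fun n => (J k).restrict (x n)) (le_principal_iff.2 h1)
    exact ⟨z, hz, hz'⟩
  choose z hzK hz using hz
  -- Limits along one ultrafilter are taken coordinate by coordinate; by uniqueness they agree with
  -- the limits in every `J k` containing the coordinate.
  refine ⟨fun i => if h : ∃ c, Tendsto (fun n => x n i) (hyperfilter ℕ) (𝓝 c)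
    then h.choose else 0, fun k => ?_⟩
  convert hzK k using 1
  ext i
  have hi : Tendsto (fun n => x n i) (hyperfilter ℕ) (𝓝 (z k i)) :=
    (tendsto_pi_nhds.1 (hz k)) i
  have hex : ∃ c, Tendsto (fun n => x n i) (hyperfilter ℕ) (𝓝 c) := ⟨_, hi⟩
  simp only [Finset.restrict, dif_pos hex]
  exact tendsto_nhds_unique hex.choose_spec hi

/-- If the contents stayed above `ε > 0`, compact sets approximating the bases with total error
below `ε` would keep all finite intersections nonempty. The compactness argument would then give a
point in every `A n`. -/
theorem projectiveFamilyContent_tendsto_zero {ι : Type*}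
    {P : ∀ J : Finset ι, Measure (J → ℝ)} [∀ J, IsProbabilityMeasure (P J)]
    (hP : IsProjectiveMeasureFamily (α := fun _ : ι => ℝ) P) (A : ℕ → Set (ι → ℝ))
    (hA : ∀ n, A n ∈ measurableCylinders (fun _ : ι => ℝ)) (hanti : Antitone A)
    (hinter : ⋂ n, A n = ∅) :
    Tendsto (fun n => projectiveFamilyContent hP (A n)) atTop (𝓝 0) := by
  have hanti' : Antitone fun n => projectiveFamilyContent hP (A n) := fun m n hmn =>
    projectiveFamilyContent_mono hP (hA n) (hA m) (hanti hmn)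
  by_contra hnot
  have hlim := tendsto_atTop_iInf hanti'
  set ε := ⨅ n, projectiveFamilyContent hP (A n) with hε
  have hε0 : ε ≠ 0 := fun h => hnot (h ▸ hlim)
  have hεle : ∀ n, ε ≤ projectiveFamilyContent hP (A n) := fun n => iInf_le _ n
  obtain ⟨δ, hδ, hδsum⟩ := ENNReal.exists_pos_sum_of_countable' hε0 ℕ
  choose J S hS hAS using fun n => (mem_measurableCylinders (A n)).1 (hA n)
  have hK : ∀ n, ∃ K ⊆ S n, IsCompact K ∧ P (J n) (S n \ K) < δ n := fun n => by
    exact (hS n).exists_isCompact_sdiff_lt (measure_ne_top _ _) (hδ n).ne'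
  choose K hKS hKc hKδ using hK
  have hKm : ∀ n, MeasurableSet (K n) := fun n => (hKc n).isClosed.measurableSet
  have hcyl : ∀ n, cylinder (J n) (K n) ∈ measurableCylinders (fun _ : ι => ℝ) := fun n =>
    cylinder_mem_measurableCylinders _ _ (hKm n)
  have hne : ∀ n, ∃ x : ι → ℝ, ∀ k ≤ n, (J k).restrict x ∈ K k := by
    intro n
    by_contra! hcon
    -- If the compact cylinders up to `n` had no common point, the errors alone would cover `A n`,
    -- which they are too small to do.
    have hsub : A n ⊆ ⋃ k ≤ n, (A k \ cylinder (J k) (K k)) := by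
      intro x hx
      obtain ⟨k, hk, hxk⟩ := hcon x
      exact mem_iUnion₂.2 ⟨k, hk, hanti hk hx, hxk⟩
    have hmem : ∀ k, A k \ cylinder (J k) (K k) ∈ measurableCylinders (fun _ : ι => ℝ) :=
      fun k => isSetRing_measurableCylinders.sdiff_mem (hA k) (hcyl k)
    have hval : ∀ k, projectiveFamilyContent hP (A k \ cylinder (J k) (K k)) ≤ δ k := by
      intro k
      rw [hAS k, sdiff_cylinder_same, projectiveFamilyContent_cylinder hP ((hS k).diff (hKm k))]
      exact (hKδ k).le
    have h1 : projectiveFamilyContent hP (A n) ≤ ∑ k ∈ Finset.range (n + 1), δ k := by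
      refine (projectiveFamilyContent_mono hP (hA n) ?_ hsub).trans
        ((projectiveFamilyContent_iUnion_le hP hmem n).trans (Finset.sum_le_sum fun k _ => hval k))
      have := isSetRing_measurableCylinders.biUnion_mem (C := measurableCylinders (fun _ : ι => ℝ))
        (Finset.range (n + 1)) (fun k _ => hmem k)
      simpa [Finset.mem_range_succ_iff] using this
    exact absurd ((hεle n).trans (h1.trans (ENNReal.sum_le_tsum _))) (not_le.2 hδsum)
  choose x hx using hne
  obtain ⟨y, hy⟩ := exists_restrict_mem_of_isCompact J K hKc x hx
  have : y ∈ ⋂ n, A n := mem_iInter.2 fun n => by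
    rw [hAS n]
    exact hKS n (hy n)
  simp [hinter] at this

/-- **Kolmogorov's extension theorem** for real-valued processes. -/
theorem exists_isProjectiveLimit {ι : Type*}
    {P : ∀ J : Finset ι, Measure (J → ℝ)} [∀ J, IsProbabilityMeasure (P J)]
    (hP : IsProjectiveMeasureFamily (α := fun _ : ι => ℝ) P) :
    ∃ ρ : Measure (ι → ℝ), IsProjectiveLimit (α := fun _ : ι => ℝ) ρ P := by
  have hsub : (projectiveFamilyContent hP).IsSigmaSubadditive := by
    refine isSigmaSubadditive_of_addContent_iUnion_eq_tsum
      isSetRing_measurableCylinders fun f hf hf_Union hf' => ?_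
    exact addContent_iUnion_eq_sum_of_tendsto_zero isSetRing_measurableCylinders
      (projectiveFamilyContent hP) (fun _ _ => projectiveFamilyContent_ne_top hP)
      (fun s hs anti_s inter_s => projectiveFamilyContent_tendsto_zero hP s hs anti_s inter_s)
      hf hf_Union hf'
  refine ⟨(projectiveFamilyContent hP).measure isSetSemiring_measurableCylinders
    generateFrom_measurableCylinders.ge hsub, fun I => ?_⟩
  ext s hs
  rw [Measure.map_apply (by fun_prop) hs, AddContent.measure_eq]
  · exact projectiveFamilyContent_cylinder hP hs
  · exact generateFrom_measurableCylinders.symm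
  · exact cylinder_mem_measurableCylinders _ _ hs

/-! ### Initial law and the Markov property with respect to the minimal filtration. -/

section Markov

theorem measurable_minFiltration {T : Type u} {𝒜 : Set (Set T)} {Ω : Type*} {X : Set T → Ω → ℝ}
    {A B : Set T} (hA : A ∈ 𝒜) (hAB : A ⊆ B) :
    Measurable[minFiltration 𝒜 X B] (X A) :=
  Measurable.mono (comap_measurable (X A))
    (le_iSup₂_of_le (f := fun A (_ : A ∈ {A | A ∈ 𝒜 ∧ A ⊆ B}) =>
      MeasurableSpace.comap (X A) inferInstance) A ⟨hA, hAB⟩ le_rfl) le_rfl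

variable {T : Type u} [TopologicalSpace T] [Nonempty T] {𝒜 : Set (Set T)}
  {S : ∀ o : ConsistentOrdering 𝒜, ConnectingFlow o} {D : Submodule ℝ BddMeas}
  {G : ConsistentOrdering 𝒜 → ℝ → D →ₗ[ℝ] BddMeas}
  {Qf : ConsistentOrdering 𝒜 → ℝ → ℝ → TransProb} {μ : Measure ℝ} [IsProbabilityMeasure μ]
  {Ω : Type*} [mΩ : MeasurableSpace Ω] {P : Measure Ω}
  {X : Set T → Ω → ℝ}

theorem HasOrderLaws.minFiltration_le (hX : HasOrderLaws S Qf μ P X) (B : Set T) :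
    minFiltration 𝒜 X B ≤ mΩ :=
  iSup₂_le fun A _ => (hX.measurable A).comap_le

/-- For a finite union `B`, the value `X B` is generated by the values at members of `𝒜` inside `B`
only up to a null set, through inclusion–exclusion. -/
theorem HasOrderLaws.exists_ae_eq_minFiltration (h𝒜 : IsIndexingCollection 𝒜)
    (hX : HasOrderLaws S Qf μ P X) {B : Set T} (hB : B ∈ finUnions 𝒜) :
    ∃ Y : Ω → ℝ, Measurable[minFiltration 𝒜 X B] Y ∧ X B =ᵐ[P] Y := by
  obtain ⟨F, hF, hFA, rfl⟩ := hB
  obtain ⟨n, A, -, rfl⟩ := hF.fin_param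
  have hA : ∀ i, A i ∈ 𝒜 := fun i => hFA (mem_range_self i)
  refine ⟨inclExcl X A, ?_, ?_⟩
  · refine Finset.measurable_sum _ fun K hK => Measurable.const_mul ?_ _
    have hK' : K.Nonempty := by simpa using hK
    obtain ⟨i, hi⟩ := hK'
    exact measurable_minFiltration
      (biInter_mem_of_inter_mem (fun _ h1 _ h2 => h𝒜.inter_mem h1 h2) ⟨i, hi⟩ fun j _ => hA j)
      ((biInter_subset_of_mem (t := A) (Finset.mem_coe.2 hi)).trans
        (subset_sUnion_of_mem (mem_range_self i)))
  · rw [sUnion_range]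
    exact hX.iUnion_ae_eq h𝒜 fun i => mem_diffs_of_mem (hA i)

variable [CompactSpace T]

/-- For an ordering having `∅'` among its unions, the chain moves from `∅` to `∅'` with the law at
`∅'`, which is `μ` because the transition from `∅'` to itself is the identity. -/
theorem HasOrderLaws.map_minSet (H : IsMatchingFamily S D G Qf) (hX : HasOrderLaws S Qf μ P X) :
    P.map (X (minSet 𝒜)) = μ := by
  have hmem := H.indexing.minSet_mem
  have hJ : ∀ C ∈ ({minSet 𝒜} : Finset (Set T)), C ∈ finUnions (diffs 𝒜) := fun C hC => by
    rw [Finset.mem_singleton.1 hC]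
    exact mem_finUnions_of_mem (mem_diffs_of_mem hmem)
  obtain ⟨o, κ, ho, -, hκn, hD⟩ := ConsistentOrdering.exists_resolves H.indexing _ hJ
    (B := fun _ => minSet 𝒜) monotone_const 0 fun _ _ => mem_finUnions_of_mem hmem
  have hD0 : o.D (κ 0) = minSet 𝒜 := hD 0 le_rfl
  have hlaw : flowLaw S Qf μ (minSet 𝒜) = μ := by
    rw [flowLaw, H.flowTrans_self (mem_finUnions_of_mem hmem) H.indexing.minSet_nonempty]
    simp [idTrans]
  refine Measure.ext_of_lintegral _ fun φ hφ => ?_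
  rw [lintegral_map hφ (hX.measurable _)]
  have h1 := hX.lintegral_eq _ hJ o ho (F := fun v => φ (v (minSet 𝒜)))
    (hφ.comp (measurable_pi_apply _)) fun v w hvw => by simp only [hvw (minSet 𝒜) (by simp)]
  have h2 := lintegral_chainLaw_markov (H.isTransitionSystem_setTrans (μ := μ)) o.D_mono
    (o.D_mem_finUnions H.indexing.empty_mem) (Nat.zero_le (κ 0)) (hκn 0)
    (φ := fun p => φ p.2) (hφ.comp measurable_snd)
  refine h1.trans ((lintegral_congr_ae ?_).trans (h2.trans ?_))
  · filter_upwards [H.orderLaw_ae_eq o, orderLaw_apply_zero o] with y hy hy0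
    have := ConsistentOrdering.val_D hy hy0 (hκn 0)
    rw [hD0] at this
    rw [this]
  · rw [hD0, ConsistentOrdering.D_zero, setTrans_empty H.indexing.minSet_nonempty, hlaw]
    simp [Kernel.const_apply]

variable [IsProbabilityMeasure P]

/-- Both sides are finite measures in `s`. They agree on finite intersections of events generated by
single values `X A`, a π-system generating the σ-algebra. -/
theorem HasOrderLaws.setLIntegral_eq (H : IsMatchingFamily S D G Qf)
    (hX : HasOrderLaws S Qf μ P X) {B B' : Set T} (hB : B ∈ finUnions 𝒜) (hB' : B' ∈ finUnions 𝒜)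
    (hBB' : B ⊆ B') {Γ : Set ℝ} (hΓ : MeasurableSet Γ) {s : Set Ω}
    (hs : MeasurableSet[minFiltration 𝒜 X B] s) :
    P (s ∩ X B' ⁻¹' Γ) = ∫⁻ ω in s, (setTrans S Qf μ B B').1 (X B ω) Γ ∂P := by
  have hle := hX.minFiltration_le B
  set m₁ : Measure Ω := P.restrict (X B' ⁻¹' Γ) with hm₁
  set m₂ : Measure Ω := P.withDensity fun ω => (setTrans S Qf μ B B').1 (X B ω) Γ with hm₂
  have a₁ : ∀ s, MeasurableSet[minFiltration 𝒜 X B] s → m₁ s = P (s ∩ X B' ⁻¹' Γ) := fun s hs =>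
    Measure.restrict_apply (hle s hs)
  have a₂ : ∀ s, MeasurableSet[minFiltration 𝒜 X B] s →
      m₂ s = ∫⁻ ω in s, (setTrans S Qf μ B B').1 (X B ω) Γ ∂P := fun s hs =>
    withDensity_apply _ (hle s hs)
  have key : ∀ (t : Finset (Set T)), (↑t ⊆ {A | A ∈ 𝒜 ∧ A ⊆ B}) → ∀ f : Set T → Set Ω,
      (∀ A ∈ t, MeasurableSet[MeasurableSpace.comap (X A) inferInstance] (f A)) →
      m₁ (⋂ A ∈ t, f A) = m₂ (⋂ A ∈ t, f A) := fun t ht f hf => by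
    choose! E hE hEf using hf
    have hst : ⋂ A ∈ t, f A = ⋂ A ∈ t, X A ⁻¹' E A :=
      iInter₂_congr fun A hA => (hEf A hA).symm
    have hms : MeasurableSet[minFiltration 𝒜 X B] (⋂ A ∈ t, X A ⁻¹' E A) :=
      Finset.measurableSet_biInter _ fun A hA =>
        measurable_minFiltration (ht hA).1 (ht hA).2 (hE A hA)
    rw [hst, a₁ _ hms, a₂ _ hms]
    exact hX.measure_inter_eq H hB hB' hBB' t (fun A hA => ht hA) hE hΓ
  have htrim : m₁.trim hle = m₂.trim hle := by
    have : IsFiniteMeasure (m₁.trim hle) := isFiniteMeasure_trim hle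
    refine ext_of_generate_finite _ (generateFrom_piiUnionInter_measurableSet _ _).symm
      (isPiSystem_piiUnionInter _ (fun A => @MeasurableSpace.isPiSystem_measurableSet _
        (MeasurableSpace.comap (X A) inferInstance)) _) ?_ ?_
    · rintro _ ⟨t, ht, f, hf, rfl⟩
      have hms : MeasurableSet[minFiltration 𝒜 X B] (⋂ A ∈ t, f A) :=
        Finset.measurableSet_biInter _ fun A hA =>
          le_iSup₂_of_le (f := fun A (_ : A ∈ {A | A ∈ 𝒜 ∧ A ⊆ B}) =>
            MeasurableSpace.comap (X A) inferInstance) A (ht hA) le_rfl _ (hf A hA)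
      rw [trim_measurableSet_eq hle hms, trim_measurableSet_eq hle hms]
      exact key t ht f hf
    · rw [trim_measurableSet_eq hle MeasurableSet.univ, trim_measurableSet_eq hle MeasurableSet.univ]
      simpa using key ∅ (by simp) (fun _ => univ) (by simp)
  rw [← a₁ s hs, ← a₂ s hs, ← trim_measurableSet_eq hle hs, htrim, trim_measurableSet_eq hle hs]

theorem HasOrderLaws.isQMarkov (H : IsMatchingFamily S D G Qf) (hX : HasOrderLaws S Qf μ P X) :
    IsQMarkov 𝒜 P (setTrans S Qf μ) X where
  additive := hX.isAdditiveProcess H.indexing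
  markov B hB B' hB' hBB' Γ hΓ := by
    have hle := hX.minFiltration_le B
    have hQm : Measurable fun x => ((setTrans S Qf μ B B').1 x).real Γ :=
      (Kernel.measurable_coe _ hΓ).ennreal_toReal
    have hgm : Measurable fun ω => ((setTrans S Qf μ B B').1 (X B ω)).real Γ :=
      hQm.comp (hX.measurable B)
    have hint : Integrable (fun ω => ((setTrans S Qf μ B B').1 (X B ω)).real Γ) P :=
      Integrable.of_bound hgm.aestronglyMeasurable 1 (Eventually.of_forall fun ω => by
        rw [Real.norm_of_nonneg measureReal_nonneg]
        exact measureReal_le_one)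
    refine (ae_eq_condExp_of_forall_setIntegral_eq hle ?_ (fun s _ _ => hint.integrableOn)
      (fun s hs _ => ?_) ?_).symm
    · exact (integrable_const (1 : ℝ)).indicator (hX.measurable B' hΓ)
    · rw [integral_indicator (hX.measurable B' hΓ), Measure.restrict_restrict (hX.measurable B' hΓ),
        setIntegral_const, smul_eq_mul, mul_one, inter_comm, measureReal_def,
        hX.setLIntegral_eq H hB hB' hBB' hΓ hs]
      simp only [measureReal_def]
      refine integral_toReal ?_ (Eventually.of_forall fun ω => measure_lt_top _ _)
      exact ((Kernel.measurable_coe _ hΓ).comp (hX.measurable B)).aemeasurable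
    -- Adaptedness holds only after replacing `X B` by an almost surely equal adapted version.
    · obtain ⟨Y, hY, hXY⟩ := hX.exists_ae_eq_minFiltration H.indexing hB
      refine ⟨fun ω => ((setTrans S Qf μ B B').1 (Y ω)).real Γ,
        (hQm.comp hY).stronglyMeasurable, ?_⟩
      filter_upwards [hXY] with ω hω
      rw [hω]

end Markov

/-- The completion of a probability measure, on the original type. -/
theorem exists_complete_extension {α : Type*} [m : MeasurableSpace α] (ρ : Measure α)
    [IsProbabilityMeasure ρ] :
    ∃ (m' : MeasurableSpace α) (ρ' : @Measure α m'), m ≤ m' ∧ ρ'.IsComplete ∧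
      ∀ s, ρ' s = ρ s :=
  ⟨(inferInstance : MeasurableSpace (NullMeasurableSpace α ρ)), ρ.completion,
    fun _ hs => hs.nullMeasurableSet, Measure.completion.isComplete ρ,
    fun s => Measure.completion_apply ρ s⟩

theorem map_eq_of_le {α β : Type*} {m m' : MeasurableSpace α} [MeasurableSpace β]
    {ρ : @Measure α m} {ρ' : @Measure α m'} (hm : m ≤ m') (h : ∀ s, ρ' s = ρ s) {f : α → β}
    (hf : Measurable[m] f) : @Measure.map α β m' _ f ρ' = @Measure.map α β m _ f ρ := by
  ext s hs
  rw [@Measure.map_apply α β m' _ ρ' f (hf.mono hm le_rfl) s hs,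
    @Measure.map_apply α β m _ ρ f hf s hs, h]

/-! ### Construction of the process. -/

section Existence

variable {T : Type u} [TopologicalSpace T] [CompactSpace T] [Nonempty T] {𝒜 : Set (Set T)}
  {S : ∀ o : ConsistentOrdering 𝒜, ConnectingFlow o} {D : Submodule ℝ BddMeas}
  {G : ConsistentOrdering 𝒜 → ℝ → D →ₗ[ℝ] BddMeas}
  {Qf : ConsistentOrdering 𝒜 → ℝ → ℝ → TransProb} {μ : Measure ℝ} [IsProbabilityMeasure μ]

theorem IsMatchingFamily.exists_hasOrderLaws (H : IsMatchingFamily S D G Qf)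
    (hcons : Consistency μ S Qf D G) :
    ∃ (Ω : Type u) (_ : MeasurableSpace Ω) (P : Measure Ω) (X : Set T → Ω → ℝ),
      IsProbabilityMeasure P ∧ P.IsComplete ∧ HasOrderLaws S Qf μ P X := by
  classical
  let ι : Type u := {C : Set T // C ∈ finUnions (diffs 𝒜)}
  have hex : ∀ J : Finset ι, ∃ o : ConsistentOrdering 𝒜, ∀ C ∈ J, o.Resolves C.1 := fun J => by
    obtain ⟨o, -, ho, -⟩ := ConsistentOrdering.exists_resolves H.indexing (J.image Subtype.val)
      (fun C hC => by
        obtain ⟨C, -, rfl⟩ := Finset.mem_image.1 hC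
        exact C.2) (B := fun _ => ∅) monotone_const 0 fun _ _ => empty_mem_finUnions 𝒜
    exact ⟨o, fun C hC => ho _ (Finset.mem_image_of_mem _ hC)⟩
  choose o ho using hex
  have hvm : ∀ (o : ConsistentOrdering 𝒜) (J : Finset ι),
      Measurable fun (y : ℕ → ℝ) (C : J) => o.val y C.1.1 := fun o J =>
    measurable_pi_lambda _ fun C => o.measurable_val _
  let M : ∀ J : Finset ι, Measure (J → ℝ) := fun J =>
    (orderLaw S Qf μ (o J)).map fun y (C : J) => (o J).val y C.1.1
  have : ∀ J, IsProbabilityMeasure (M J) := fun J =>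
    Measure.isProbabilityMeasure_map (hvm _ _).aemeasurable
  -- The ordering chosen for the larger index set also resolves the sets of the smaller one, so
  -- projectivity is the independence of the laws from the ordering.
  have hM : IsProjectiveMeasureFamily (α := fun _ : ι => ℝ) M := fun I J hJI => by
    have h1 := Measure.map_map (μ := orderLaw S Qf μ (o I))
      (Finset.measurable_restrict₂ (X := fun _ : ι => ℝ) hJI) (hvm (o I) I)
    refine Eq.trans ?_ h1.symm
    exact H.map_val_eq hcons (o J) (o I) (c := fun C : J => C.1.1) (fun C => ho J _ C.2)
      fun C => ho I _ (hJI C.2)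
  obtain ⟨ρ, hρ⟩ := exists_isProjectiveLimit hM
  have hρP : IsProbabilityMeasure ρ := hρ.isProbabilityMeasure
  -- The coordinate process on `𝒞(u)`; the value 0 elsewhere plays no role in the joint laws.
  let X : Set T → (ι → ℝ) → ℝ := fun C ω =>
    if h : C ∈ finUnions (diffs 𝒜) then ω ⟨C, h⟩ else 0
  have hXm : ∀ C, Measurable (X C) := fun C => by
    by_cases h : C ∈ finUnions (diffs 𝒜)
    · simpa only [X, dif_pos h] using measurable_pi_apply (X := fun _ : ι => ℝ) ⟨C, h⟩
    · simpa only [X, dif_neg h] using measurable_const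
  have hXJm : ∀ J : Finset (Set T), Measurable fun ω (C : J) => X C ω := fun J =>
    measurable_pi_lambda _ fun C => hXm _
  have hmap : ∀ J : Finset (Set T), (∀ C ∈ J, C ∈ finUnions (diffs 𝒜)) →
      ∀ p : ConsistentOrdering 𝒜, (∀ C ∈ J, p.Resolves C) →
        ρ.map (fun ω (C : J) => X C ω) = (orderLaw S Qf μ p).map (fun y (C : J) => p.val y C) := by
    intro J hJ p hp
    set J' : Finset ι := J.attach.image fun C => ⟨C.1, hJ C.1 C.2⟩ with hJ'
    have hmem : ∀ C : J, (⟨C.1, hJ C.1 C.2⟩ : ι) ∈ J' := fun C =>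
      Finset.mem_image_of_mem _ (Finset.mem_attach _ _)
    have hg : Measurable fun (w : J' → ℝ) (C : J) => w ⟨⟨C.1, hJ C.1 C.2⟩, hmem C⟩ :=
      measurable_pi_lambda _ fun C => measurable_pi_apply _
    have hXJ : (fun ω (C : J) => X C ω) = (fun (w : J' → ℝ) (C : J) =>
        w ⟨⟨C.1, hJ C.1 C.2⟩, hmem C⟩) ∘ J'.restrict := by
      funext ω C
      simp only [X, dif_pos (hJ C.1 C.2)]
      rfl
    rw [hXJ, ← Measure.map_map hg (Finset.measurable_restrict J'), hρ J',
      Measure.map_map hg (hvm _ _)]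
    exact H.map_val_eq hcons (o J') p (c := fun C : J => C.1) (fun C => ho J' _ (hmem C))
      fun C => hp C.1 C.2
  -- Completing the space changes neither the measurability of the coordinates nor their joint laws.
  obtain ⟨m', ρ', hm', hρc, hρ'⟩ := exists_complete_extension ρ
  refine ⟨ι → ℝ, m', ρ', X, ⟨(hρ' univ).trans hρP.measure_univ⟩, hρc,
    fun C => (hXm C).mono hm' le_rfl, fun J hJ p hp => ?_⟩
  exact (map_eq_of_le hm' hρ' (hXJm J)).trans (hmap J hJ p hp)

end Existence

end SetMarkov

theorem theorem2 {T : Type u} [TopologicalSpace T] [CompactSpace T] [T2Space T] [Nonempty T]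
    (𝒜 : Set (Set T)) (h𝒜 : SetMarkov.IsIndexingCollection 𝒜)
    (S : ∀ o : SetMarkov.ConsistentOrdering 𝒜, SetMarkov.ConnectingFlow o)
    (μ : Measure ℝ) [IsProbabilityMeasure μ]
    (D : Submodule ℝ SetMarkov.BddMeas) (hD : Dense (D : Set SetMarkov.BddMeas))
    (G : SetMarkov.ConsistentOrdering 𝒜 → ℝ → D →ₗ[ℝ] SetMarkov.BddMeas)
    (Qf : SetMarkov.ConsistentOrdering 𝒜 → ℝ → ℝ → SetMarkov.TransProb)
    (hQf : ∀ o, SetMarkov.IsTransitionSystem (Icc 0 (S o).a) (Qf o))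
    (hG : ∀ o, SetMarkov.IsGenerator (S o).a (Qf o) D (G o))
    (hmatch : SetMarkov.Matching S Qf D G)
    (hcons : SetMarkov.Consistency μ S Qf D G) :
    ∃ Q : Set T → Set T → SetMarkov.TransProb,
      SetMarkov.IsTransitionSystem (SetMarkov.finUnions 𝒜) Q ∧
      ∃ (Ω : Type u) (_ : MeasurableSpace Ω) (P : Measure Ω) (X : Set T → Ω → ℝ),
        IsProbabilityMeasure P ∧ P.IsComplete ∧
        SetMarkov.IsQMarkov 𝒜 P Q X ∧
        P.map (X (SetMarkov.minSet 𝒜)) = μ ∧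
        ∀ o, SetMarkov.IsGenerator (S o).a (fun s t => Q ((S o).f s) ((S o).f t)) D (G o) := by
  have H : SetMarkov.IsMatchingFamily S D G Qf := ⟨h𝒜, hD, hQf, hG, hmatch⟩
  obtain ⟨Ω, mΩ, P, X, hP, hPc, hX⟩ := H.exists_hasOrderLaws hcons
  exact ⟨SetMarkov.setTrans S Qf μ, H.isTransitionSystem_setTrans, Ω, mΩ, P, X, hP, hPc,
    hX.isQMarkov H, hX.map_minSet H, H.isGenerator_setTrans⟩
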